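/- Let $n\ge 2$ and $x_1<x_2<\dots<x_{2n}$ be real; write $x=x_1$. For $1\le i\le n-1$ let $$\omega'_i=\frac{(u-x_1)^{i-1}\,du}{\prod_{j=1}^{2n}(u-x_j)^{1/2}}$$ (principal values; this is a continuous determination off the segments $[x_{2j-1},x_{2j}]$, $1\le j\le n$, and up to the boundary of the closed upper half-plane from above), let $C_j$ ($1\le j\le n-1$) be a circle centred on $\mathbb R$, run through clockwise, that surrounds $x_{2j-1},x_{2j}$ and leaves the other marked points outside, and put $$P=\Big(\int_{C_j}\omega'_i\Big)_{1\le i,j\le n-1},\qquad Q(z)=\Big(\int_x^z\omega'_1,\dots,\int_x^z\omega'_{n-1}\Big)^{t},\qquad \psi(\mathbf x)=\prod_{1\le i<j\le 2n}(x_j-x_i)^{1/4}\,\det P .$$ For $1\le k\le n-1$ let $H_k(z)$ be the harmonic measure of the slit $K_k=(x_{2k},x_{2k+1})$ seen from $z$ in the upper half-plane with normal reflection on the arcs $(x_{2j-1},x_{2j})$, $1\le j\le n$: the bounded harmonic function, continuous on the closed half-plane, with value $1$ on $K_k$, value $0$ on the other slits and on $(-\infty,x_1]\cup[x_{2n},\infty)$,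 and vanishing normal derivative on the arcs $(x_{2j-1},x_{2j})$. Let $H=(H_1,\dots,H_{n-1})^t$. Then: 1. $P$ is invertible, $\psi\ne0$, the functions $\psi,P,P^{-1}$ are differentiable in $x=x_1$ (the other $x_j$ being fixed), and, with $e_1,e_2,\dots$ the standard basis vectors of $\mathbb C^{n-1}$ ($e_2=0$ if $n=2$), $$8\,\mathrm{Tr}(P^{-1}\partial_xP)\,e_1+8\,P\,\partial_x(P^{-1})\,e_1=4e_2 .$$ 2. As the real point $z$ decreases to $x$, $P^{-1}Q(z)=(z-x)^{1/2}a+(z-x)^{3/2}b+O((z-x)^{5/2})$, where $a$ is differentiable in $x$, and $$4\frac{\partial_x\psi}{\psi}\,a+4\,\partial_xa=6b .$$ 3. The functions $H_k$ exist and are unique on the closed half-plane, and $\mathrm{Re}(P^{-1}Q)=T\,H$ there, with an invertible triangular real matrix $T$ that does not depend on $\mathbf x$. As the real point $z$ decreases to $x$, $H(z)=(z-x)^{1/2}a+(z-x)^{3/2}b+O((z-x)^{5/2})$, where $a$ is differentiable in $x$, and these coefficients $a,b$ of the reflected harmonic measure satisfy the same relation $$4\frac{\partial_x\psi}{\psi}\,a+4\,\partial_xa=6b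 .$$ -/

import Mathlib

open scoped Topology Matrix

noncomputable section

namespace USTDrift

/- Throughout `n = g + 1` with `g` the genus, and the `2n = 2g + 2` marked points
`x_1 < ... < x_{2n}` are `x 0 < ... < x (2g+1)` (all indices are shifted by one). -/

/-- The index of the left end `x_{2j-1}` of the `j`-th free arc. -/
def freeL {g : ℕ} (j : Fin (g + 1)) : Fin (2 * g + 2) := ⟨2 * (j : ℕ), by omega⟩

/-- The index of the right end `x_{2j}` of the `j`-th free arc. -/
def freeR {g : ℕ} (j : Fin (g + 1)) : Fin (2 * g + 2) := ⟨2 * (j : ℕ) + 1, by omega⟩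

/-- The index of the left end `x_{2k}` of the `k`-th slit `K_k = (x_{2k}, x_{2k+1})`. -/
def slitL {g : ℕ} (k : Fin g) : Fin (2 * g + 2) := ⟨2 * (k : ℕ) + 1, by omega⟩

/-- The index of the right end `x_{2k+1}` of the `k`-th slit `K_k = (x_{2k}, x_{2k+1})`. -/
def slitR {g : ℕ} (k : Fin g) : Fin (2 * g + 2) := ⟨2 * (k : ℕ) + 2, by omega⟩

/-- The closed upper half-plane. -/
def closedUpper : Set ℂ := {z | 0 ≤ z.im}

/-- `h` is `z ↦ Harm(z, K_k)`, the harmonic measure of the wired slit `K_k` in the upper half-plane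
with normal reflection on the free arcs `(x_{2j-1}, x_{2j})`, `1 ≤ j ≤ n`: the bounded solution of
the mixed boundary value problem with value `1` on `K_k`, value `0` on the other slits and on the
wired arc `(x_{2n}, x_1)` through infinity, and zero normal derivative on the free arcs. -/
structure IsReflectedHarmonicMeasure {g : ℕ} (x : Fin (2 * g + 2) → ℝ) (k : Fin g)
    (h : ℂ → ℝ) : Prop where
  harmonic : InnerProductSpace.HarmonicOnNhd h {z : ℂ | 0 < z.im}
  bounded : ∃ B : ℝ, ∀ z ∈ closedUpper, |h z| ≤ B
  continuous : ContinuousOn h closedUpper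
  slits : ∀ j : Fin g, ∀ s ∈ Set.Icc (x (slitL j)) (x (slitR j)),
    h (s : ℂ) = if j = k then 1 else 0
  outer : ∀ s : ℝ, s ≤ x 0 ∨ x (Fin.last (2 * g + 1)) ≤ s → h (s : ℂ) = 0
  free : ∀ j : Fin (g + 1), ∀ s ∈ Set.Ioo (x (freeL j)) (x (freeR j)),
    HasDerivWithinAt (fun y : ℝ => h ((s : ℂ) + (y : ℂ) * Complex.I)) 0 (Set.Ici 0) 0

/-- The density of `ω'_i = (u - x_1)^{i-1} du / ∏_j (u - x_j)^{1/2}`. With principal values, the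
denominator is a continuous determination off the closed free arcs (hence along every cycle `C_j`),
and on the closed upper half-plane. -/
def omega' {g : ℕ} (x : Fin (2 * g + 2) → ℝ) (i : Fin g) (u : ℂ) : ℂ :=
  (u - (x 0 : ℂ)) ^ (i : ℕ) / ∏ j, (u - (x j : ℂ)) ^ (1 / 2 : ℂ)

/-- The circle with centre `c` and radius `R` surrounds the two points `x_{2j-1}`, `x_{2j}` and
leaves all other marked points strictly outside. -/
def Encircles {g : ℕ} (x : Fin (2 * g + 2) → ℝ) (j : Fin g) (c R : ℝ) : Prop :=
  ∀ k : Fin (2 * g + 2),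
    ((k : ℕ) / 2 = (j : ℕ) → |x k - c| < R) ∧ ((k : ℕ) / 2 ≠ (j : ℕ) → R < |x k - c|)

/-- The period matrix `P = (∫_{C_j} ω'_i)_{i,j}`, with `C_j` the circle of centre `c x j`
and radius `R x j` run through clockwise. -/
def periodMatrix {g : ℕ} (c R : (Fin (2 * g + 2) → ℝ) → Fin g → ℝ)
    (x : Fin (2 * g + 2) → ℝ) : Matrix (Fin g) (Fin g) ℂ :=
  Matrix.of fun i j => -∮ u in C((c x j : ℂ), R x j), omega' x i u

/-- The vector `Q(z) = ∫_{x_1}^z (ω'_1, ..., ω'_{n-1})`, along the segment from `x_1` to `z`. -/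
def Q {g : ℕ} (x : Fin (2 * g + 2) → ℝ) (z : ℂ) : Fin g → ℂ := fun i =>
  (z - (x 0 : ℂ)) * ∫ t in (0 : ℝ)..1, omega' x i ((x 0 : ℂ) + (t : ℂ) * (z - (x 0 : ℂ)))

/-- The partition function `ψ = ∏_{i<j} (x_j - x_i)^{1/4} det(∫_{C_j} ω'_i)`. -/
def psi {g : ℕ} (c R : (Fin (2 * g + 2) → ℝ) → Fin g → ℝ) (x : Fin (2 * g + 2) → ℝ) : ℂ :=
  ((∏ i, ∏ j ∈ Finset.Ioi i, (x j - x i) ^ (1 / 4 : ℝ) : ℝ) : ℂ) * (periodMatrix c R x).det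

/-- `F` is differentiable in its first variable `x_1` at `x`. -/
def DiffX1 {g : ℕ} {E : Type*} [NormedAddCommGroup E] [NormedSpace ℝ E]
    (F : (Fin (2 * g + 2) → ℝ) → E) (x : Fin (2 * g + 2) → ℝ) : Prop :=
  DifferentiableAt ℝ (fun s : ℝ => F (Function.update x 0 s)) (x 0)

/-- The partial derivative of `F` in its first variable `x_1` at `x`. -/
def dX1 {g : ℕ} {E : Type*} [NormedAddCommGroup E] [NormedSpace ℝ E]
    (F : (Fin (2 * g + 2) → ℝ) → E) (x : Fin (2 * g + 2) → ℝ) : E :=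
  deriv (fun s : ℝ => F (Function.update x 0 s)) (x 0)

/-- The entrywise partial derivative in `x_1` of a matrix-valued function. -/
def dX1Matrix {g : ℕ} (M : (Fin (2 * g + 2) → ℝ) → Matrix (Fin g) (Fin g) ℂ)
    (x : Fin (2 * g + 2) → ℝ) : Matrix (Fin g) (Fin g) ℂ :=
  Matrix.of fun i j => dX1 (fun y => M y i j) x

/-- The standard basis vector `e_m` of `ℂ^g`, for `m = 1, 2, ...` (zero if `m > g`). -/
def e (g m : ℕ) : Fin g → ℂ := fun i => if (i : ℕ) + 1 = m then 1 else 0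

/-- `f(z) = (z - x)^{1/2} a + (z - x)^{3/2} b + O((z - x)^{5/2})` as the real point `z` decreases
to `x`. -/
def HasHalfIntegerExpansion {E : Type*} [NormedAddCommGroup E] [NormedSpace ℝ E]
    (f : ℝ → E) (x : ℝ) (a b : E) : Prop :=
  (fun z : ℝ => f z - ((z - x) ^ (1 / 2 : ℝ) • a + (z - x) ^ (3 / 2 : ℝ) • b))
    =O[𝓝[>] x] (fun z : ℝ => (z - x) ^ (5 / 2 : ℝ))

end USTDrift

end

/-!
The proof replaces the complex period matrix by a real one and reduces the two relations to one
linear relation between the rows of that matrix and their derivatives in `x_1`.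

**The imaginary part of `Q`.** In the upper half-plane `Q` is a primitive of the density `ω'`
(`hasDerivAt_Q`), it extends continuously to the real line (`continuousOn_Q`), and it is bounded
(`exists_norm_Q_le`). On the real line the density is real on the wired arcs and imaginary on the
free arcs (`omega'_im_eq_zero`, `omega'_free`). Hence `Im Q` is constant on every wired arc, zero on
the two unbounded ones, and has vanishing normal derivative on the free arcs. The upper half of
`C_j` joins the two wired arcs next to the `j`-th free arc, and the lower half contributes minus the
complex conjugate of the upper one (`circleIntegral_omega'`); the period of `ω'_i` along `C_j` is
therefore `2 i` times the increment of `Im Q_i` over the `j`-th free arc. Thus `P = i M` with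
`M = imPeriod x` real (`periodMatrix_apply`). A combination of the rows of `M` which vanishes would
give a polynomial of degree less than `g` whose product with a density of constant sign has integral
zero over each of `g` disjoint free arcs; it would have `g` roots, so `M` is invertible
(`det_imPeriod_ne_zero`).

**The derivative in `x_1`.** The periods do not depend on the circles, which may therefore be kept
fixed while `x_1` moves, and `∂_{x_1} ω'_{i+1} = (1/2 - i) ω'_i` for `i ≥ 1`. So the rows of
`M' = ∂_{x_1} M` below the first are multiples of the preceding rows of `M`
(`exists_hasDerivAt_imPeriod`); equivalently the only nonzero entries of `M' M⁻¹` below its first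
row are the entries `1/2 - i` on the subdiagonal. Reading off the trace and the first column gives
`tr (M⁻¹ M') e_1 - M' M⁻¹ e_1 = e_2 / 2` (`trace_smul_sub_mulVec`), which is the matrix identity
(`period_identity`); by Jacobi's formula the trace is the logarithmic derivative of `det M`.

**The drift relation.** On the first free arc `Im Q_i` is, up to a common sign, the integral of
`(s - x_1)^{i - 3/2}` times `w(s) = ∏_{j ≥ 2} (x_j - s)^{-1/2}`. Taylor's formula for `w`, with
`w'(x_1) / w(x_1) = E / 2` and `E = ∑_{j ≥ 2} (x_j - x_1)⁻¹`, gives the half-integer expansion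
(`hasHalfIntegerExpansion_im_Q`): up to that sign, the coefficients of `P⁻¹ Q` are
`a = 2 w(x_1) M⁻¹ e_1` and `b = (2/3) w(x_1) M⁻¹ (E e_1 / 2 + e_2)`. In `4 (∂ψ/ψ) a + 4 ∂a` the
contributions of `det M` and `M⁻¹` combine through the matrix identity to a multiple of `M⁻¹ e_2`,
and those of `∏ (x_j - x_i)^{1/4}` and `w(x_1)` to a multiple of `E M⁻¹ e_1`; the sum is `6 b`
(`drift_relation`).

**The harmonic measures.** `Re (P⁻¹ Q) = M⁻¹ Im Q` solves the mixed boundary value problem with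
constants on the slits. These constants form the triangular matrix `slitMatrix`, which does not
depend on the marked points; its inverse produces the harmonic measures
(`isReflectedHarmonicMeasure_slitMeasure`) and, being constant, preserves the drift relation.
Uniqueness is the maximum principle `nonpos_of_mixed_boundary`: subtracting a small multiple of the
function `barrier` makes the difference of two solutions nonpositive near infinity and strictly
increasing in the inner normal direction on the free arcs, so that a positive maximum can be
attained nowhere.
-/

noncomputable section

open Set Filter MeasureTheory ComplexConjugate Asymptotics

namespace USTDrift

variable {g : ℕ} {x : Fin (2 * g + 2) → ℝ}

/-! ### The density `ω'` -/

lemma mem_closedUpper {z : ℂ} : z ∈ closedUpper ↔ 0 ≤ z.im := Iff.rfl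

lemma ofReal_mem_closedUpper (s : ℝ) : (s : ℂ) ∈ closedUpper := by simp [closedUpper]

/-- The principal power is continuous from above across the negative real axis. -/
lemma continuousOn_cpow_closedUpper {a : ℂ} (ha : 0 < a.re) :
    ContinuousOn (fun z : ℂ => z ^ a) closedUpper := by
  intro z hz
  by_cases h : 0 ≤ z.re ∨ z.im ≠ 0
  · exact (Complex.continuousAt_cpow_const_of_re_pos h ha).continuousWithinAt
  · push Not at h
    have hne : ∀ w : ℂ, w.re < 0 → w ≠ 0 := by
      rintro w hw rfl; simp at hw
    have h1 : ContinuousWithinAt (fun w : ℂ => Complex.exp (Complex.log w * a)) closedUpper z :=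
      ((Complex.continuousWithinAt_log_of_re_neg_of_im_zero h.1 h.2).mul_const a).cexp
    refine h1.congr_of_eventuallyEq ?_ (Complex.cpow_def_of_ne_zero (hne z h.1) a)
    have : ∀ᶠ w : ℂ in 𝓝 z, w.re < 0 :=
      (Complex.continuous_re.tendsto z).eventually (gt_mem_nhds h.1)
    filter_upwards [mem_nhdsWithin_of_mem_nhds this] with w hw
    exact Complex.cpow_def_of_ne_zero (hne w hw) a

lemma sub_ofReal_mem_closedUpper {u : ℂ} (hu : u ∈ closedUpper) (s : ℝ) :
    u - (s : ℂ) ∈ closedUpper := by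
  simpa [closedUpper] using hu

lemma prod_cpow_ne_zero {u : ℂ} (hu : ∀ j, u ≠ (x j : ℂ)) :
    ∏ j, (u - (x j : ℂ)) ^ (1 / 2 : ℂ) ≠ 0 := by
  refine Finset.prod_ne_zero_iff.2 fun j _ => ?_
  rw [Complex.cpow_ne_zero_iff_of_exponent_ne_zero (by norm_num)]
  exact sub_ne_zero.2 (hu j)

lemma continuousWithinAt_omega' (i : Fin g) {u : ℂ} (hu : u ∈ closedUpper)
    (hx : ∀ j, u ≠ (x j : ℂ)) : ContinuousWithinAt (omega' x i) closedUpper u := by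
  refine ContinuousWithinAt.div (by fun_prop) ?_ (prod_cpow_ne_zero hx)
  refine tendsto_finsetProd _ fun j _ => ?_
  have h1 := continuousOn_cpow_closedUpper (a := (1 / 2 : ℂ)) (by norm_num)
    _ (sub_ofReal_mem_closedUpper hu (x j))
  exact ContinuousWithinAt.comp (t := closedUpper) (f := fun u : ℂ => u - (x j : ℂ)) h1
    (by fun_prop) fun w hw => sub_ofReal_mem_closedUpper hw _

lemma norm_sqrt_cpow (u : ℂ) : ‖u ^ (1 / 2 : ℂ)‖ = Real.sqrt ‖u‖ := by
  have := Complex.norm_cpow_real u (1 / 2)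
  rw [Real.sqrt_eq_rpow, ← this]; norm_num

lemma norm_omega' (x : Fin (2 * g + 2) → ℝ) (i : Fin g) (u : ℂ) :
    ‖omega' x i u‖ = ‖u - (x 0 : ℂ)‖ ^ (i : ℕ) / ∏ j, Real.sqrt ‖u - (x j : ℂ)‖ := by
  simp only [omega', norm_div, norm_pow, norm_prod, norm_sqrt_cpow]

lemma omega'_conj (x : Fin (2 * g + 2) → ℝ) (i : Fin g) {u : ℂ} (hu : u.im ≠ 0) :
    omega' x i (conj u) = conj (omega' x i u) := by
  have key : ∀ j, (conj u - (x j : ℂ)) ^ (1 / 2 : ℂ) = conj ((u - (x j : ℂ)) ^ (1 / 2 : ℂ)) := by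
    intro j
    have : conj u - (x j : ℂ) = conj (u - (x j : ℂ)) := by simp
    rw [this, Complex.conj_cpow]
    · congr 2; simp [map_ofNat]
    · rw [Ne, Complex.arg_eq_pi_iff]; simp [hu]
  simp only [omega', key]
  simp

lemma hasDerivAt_omega' (i : Fin g) {u : ℂ} (hu : 0 < u.im) :
    HasDerivAt (omega' x i) (omega' x i u *
      ((i : ℕ) / (u - (x 0 : ℂ)) - ∑ j, 1 / (2 * (u - (x j : ℂ))))) u := by
  have hne : ∀ j, u - (x j : ℂ) ≠ 0 := by
    intro j h
    have := congrArg Complex.im h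
    simp at this; linarith
  have hsl : ∀ j, u - (x j : ℂ) ∈ Complex.slitPlane := by
    intro j; right; simp; exact hu.ne'
  have hden : ∀ j, HasDerivAt (fun u : ℂ => (u - (x j : ℂ)) ^ (1 / 2 : ℂ))
      ((u - (x j : ℂ)) ^ (1 / 2 : ℂ) * (1 / (2 * (u - (x j : ℂ))))) u := by
    intro j
    have := ((hasDerivAt_id u).sub_const (x j : ℂ)).cpow_const (c := (1 / 2 : ℂ)) (hsl j)
    refine this.congr_deriv ?_
    have h2 := hne j
    simp only [id]
    rw [Complex.cpow_sub _ _ h2, Complex.cpow_one]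
    field_simp
  have hprod := HasDerivAt.fun_finsetProd (u := Finset.univ) fun j _ => hden j
  have hnum := ((hasDerivAt_id u).sub_const (x 0 : ℂ)).pow (i : ℕ)
  have hP : ∏ j, (u - (x j : ℂ)) ^ (1 / 2 : ℂ) ≠ 0 :=
    prod_cpow_ne_zero fun j => sub_ne_zero.1 (hne j)
  have := hnum.div hprod hP
  refine HasDerivAt.congr_deriv (f := omega' x i) this ?_
  have e1 : ∑ j, (∏ k ∈ Finset.univ.erase j, (u - (x k : ℂ)) ^ (1 / 2 : ℂ)) •
      ((u - (x j : ℂ)) ^ (1 / 2 : ℂ) * (1 / (2 * (u - (x j : ℂ))))) =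
      (∏ j, (u - (x j : ℂ)) ^ (1 / 2 : ℂ)) * ∑ j, 1 / (2 * (u - (x j : ℂ))) := by
    rw [Finset.mul_sum]
    refine Finset.sum_congr rfl fun j _ => ?_
    rw [smul_eq_mul, ← mul_assoc, Finset.prod_erase_mul _ _ (Finset.mem_univ j)]
  rw [e1]
  simp only [omega', id, Pi.pow_apply]
  set S := ∑ j, 1 / (2 * (u - (x j : ℂ)))
  have h0 := hne 0
  rcases Nat.eq_zero_or_pos (i : ℕ) with hi | hi
  · simp [hi]; field_simp
  · obtain ⟨m, hm⟩ := Nat.exists_eq_add_of_lt hi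
    simp only [zero_add] at hm
    rw [hm]; simp only [Nat.add_sub_cancel, pow_succ]
    field_simp

lemma measurable_omega' (x : Fin (2 * g + 2) → ℝ) (i : Fin g) : Measurable (omega' x i) := by
  unfold omega'
  refine Measurable.div (by fun_prop) ?_
  exact Finset.measurable_fun_prod _ fun j _ => by fun_prop

/-- With at most one marked point near `u`, the product of singular factors is dominated by
their sum. -/
lemma exists_prod_inv_sqrt_le (hx : StrictMono x) :
    ∃ K : ℝ, 0 < K ∧ ∀ u : ℂ, (∏ j, Real.sqrt ‖u - (x j : ℂ)‖)⁻¹ ≤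
      K * ∑ j, (Real.sqrt ‖u - (x j : ℂ)‖)⁻¹ := by
  obtain ⟨d, hd, hdist⟩ : ∃ d : ℝ, 0 < d ∧ ∀ i j, i ≠ j → d ≤ |x i - x j| := by
    have hfin : ({p : Fin (2 * g + 2) × Fin (2 * g + 2) | p.1 ≠ p.2}).Finite := toFinite _
    have hne : ({p : Fin (2 * g + 2) × Fin (2 * g + 2) | p.1 ≠ p.2}).Nonempty :=
      ⟨(0, 1), by simp⟩
    obtain ⟨p, hp, hmin⟩ := exists_min_image _ (fun p => |x p.1 - x p.2|) hfin hne
    exact ⟨|x p.1 - x p.2|, abs_pos.2 (sub_ne_zero.2 (hx.injective.ne hp)),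
      fun i j hij => hmin (i, j) hij⟩
  refine ⟨((Real.sqrt (d / 2)) ^ (2 * g + 1))⁻¹, by positivity, fun u => ?_⟩
  -- only the marked point nearest to `u` can be closer than `d / 2`
  obtain ⟨k, -, hk⟩ := Finset.exists_min_image Finset.univ (fun j => ‖u - (x j : ℂ)‖)
    Finset.univ_nonempty
  have hfar : ∀ j ∈ Finset.univ.erase k, Real.sqrt (d / 2) ≤ Real.sqrt ‖u - (x j : ℂ)‖ := by
    intro j hj
    refine Real.sqrt_le_sqrt ?_
    have h1 := hdist k j (Finset.ne_of_mem_erase hj).symm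
    have h2 := hk j (Finset.mem_univ j)
    have h3 : |x k - x j| ≤ ‖u - (x j : ℂ)‖ + ‖u - (x k : ℂ)‖ := by
      rw [← Real.norm_eq_abs, ← Complex.norm_real]
      have : ((x k - x j : ℝ) : ℂ) = (u - (x j : ℂ)) - (u - (x k : ℂ)) := by push_cast; ring
      rw [this]; exact norm_sub_le _ _
    linarith
  have hcard : (Finset.univ.erase k : Finset (Fin (2 * g + 2))).card = 2 * g + 1 := by
    rw [Finset.card_erase_of_mem (Finset.mem_univ k)]; simp
  have hpow : Real.sqrt (d / 2) ^ (2 * g + 1) ≤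
      ∏ j ∈ Finset.univ.erase k, Real.sqrt ‖u - (x j : ℂ)‖ := by
    rw [← hcard, ← Finset.prod_const]
    exact Finset.prod_le_prod (fun _ _ => by positivity) hfar
  rw [← Finset.prod_erase_mul _ _ (Finset.mem_univ k), mul_inv]
  refine mul_le_mul ?_ ?_ (by positivity) (by positivity)
  · exact inv_anti₀ (by positivity) hpow
  · exact Finset.single_le_sum (f := fun j => (Real.sqrt ‖u - (x j : ℂ)‖)⁻¹)
      (fun _ _ => by positivity) (Finset.mem_univ k)

/-- The density decays quadratically at infinity, so that `∞` is an ordinary point. -/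
lemma exists_norm_omega'_le_of_large (x : Fin (2 * g + 2) → ℝ) : ∃ M C : ℝ, 1 ≤ M ∧ 0 < C ∧
    ∀ (i : Fin g) (u : ℂ), M ≤ ‖u - (x 0 : ℂ)‖ → ‖omega' x i u‖ ≤ C / ‖u - (x 0 : ℂ)‖ ^ 2 := by
  obtain ⟨B, hB⟩ : ∃ B : ℝ, ∀ j, |x j - x 0| ≤ B := by
    obtain ⟨B, hB⟩ := (Set.finite_range fun j => |x j - x 0|).bddAbove
    exact ⟨B, fun j => hB ⟨j, rfl⟩⟩
  refine ⟨max 1 (2 * B), 2 ^ (g + 1), le_max_left _ _, by positivity, fun i u hu => ?_⟩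
  set r := ‖u - (x 0 : ℂ)‖ with hr
  have hr1 : 1 ≤ r := (le_max_left _ _).trans hu
  have hr2 : 2 * B ≤ r := (le_max_right _ _).trans hu
  have hfar : ∀ j, r / 2 ≤ ‖u - (x j : ℂ)‖ := by
    intro j
    have h3 : r ≤ ‖u - (x j : ℂ)‖ + |x j - x 0| := by
      rw [← Real.norm_eq_abs, ← Complex.norm_real, hr]
      have : u - (x 0 : ℂ) = (u - (x j : ℂ)) + ((x j - x 0 : ℝ) : ℂ) := by push_cast; ring
      rw [this]; exact norm_add_le _ _
    linarith [hB j]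
  have hden : (r / 2) ^ (g + 1) ≤ ∏ j, Real.sqrt ‖u - (x j : ℂ)‖ := by
    have : (r / 2) ^ (g + 1) = ∏ _j : Fin (2 * g + 2), Real.sqrt (r / 2) := by
      rw [Finset.prod_const, Finset.card_univ, Fintype.card_fin,
        show 2 * g + 2 = 2 * (g + 1) by ring, pow_mul, Real.sq_sqrt (by linarith)]
    rw [this]
    exact Finset.prod_le_prod (fun _ _ => by positivity) fun j _ => Real.sqrt_le_sqrt (hfar j)
  rw [norm_omega']
  have hrpos : 0 < r := by linarith
  calc r ^ (i : ℕ) / ∏ j, Real.sqrt ‖u - (x j : ℂ)‖ ≤ r ^ (g - 1) / (r / 2) ^ (g + 1) := by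
        refine div_le_div₀ (by positivity) (pow_le_pow_right₀ hr1 (by omega)) (by positivity) hden
    _ = 2 ^ (g + 1) / r ^ 2 := by
        have hg : g = (g - 1) + 1 := by have := i.2; omega
        have : r ^ (g + 1) = r ^ (g - 1) * r ^ 2 := by
          rw [← pow_add]; congr 1; omega
        rw [div_pow, this]
        field_simp

/-! ### Integrability of the density -/

lemma intervalIntegrable_inv_sqrt_abs (c a b : ℝ) :
    IntervalIntegrable (fun s : ℝ => (Real.sqrt |s - c|)⁻¹) volume a b := by
  have h0 : ∀ a b : ℝ, IntervalIntegrable (fun s : ℝ => (Real.sqrt |s|)⁻¹) volume a b := by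
    intro a b
    refine intervalIntegrable_of_even (fun s => by simp) fun t ht => ?_
    refine (intervalIntegral.intervalIntegrable_rpow' (r := -(1 / 2)) (by norm_num)).congr ?_
    intro s hs
    rw [uIoc_of_le ht.le] at hs
    simp only
    rw [abs_of_pos hs.1, Real.rpow_neg hs.1.le, Real.sqrt_eq_rpow]
  simpa using (h0 (a - c) (b - c)).comp_sub_right c

lemma ae_forall_ne (x : Fin (2 * g + 2) → ℝ) : ∀ᵐ s : ℝ, ∀ j, s ≠ x j := by
  have h : (Set.range x).Countable := (Set.finite_range x).countable
  filter_upwards [h.ae_notMem volume] with s hs j hj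
  exact hs ⟨j, hj.symm⟩

/-- A bound for the density in terms of the real part of the variable only. -/
lemma exists_norm_omega'_le_re (hx : StrictMono x) : ∃ K : ℝ, 0 < K ∧ ∀ (i : Fin g) (u : ℂ),
    (∀ j, u.re ≠ x j) →
    ‖omega' x i u‖ ≤ ‖u - (x 0 : ℂ)‖ ^ (i : ℕ) * (K * ∑ j, (Real.sqrt |u.re - x j|)⁻¹) := by
  obtain ⟨K, hK, hle⟩ := exists_prod_inv_sqrt_le hx
  refine ⟨K, hK, fun i u hu => ?_⟩
  rw [norm_omega', div_eq_mul_inv]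
  refine mul_le_mul_of_nonneg_left ((hle u).trans ?_) (by positivity)
  refine mul_le_mul_of_nonneg_left (Finset.sum_le_sum fun j _ => ?_) hK.le
  have h1 : 0 < |u.re - x j| := abs_pos.2 (sub_ne_zero.2 (hu j))
  refine inv_anti₀ (Real.sqrt_pos.2 h1) (Real.sqrt_le_sqrt ?_)
  simpa using Complex.abs_re_le_norm (u - (x j : ℂ))

lemma intervalIntegrable_sum_inv_sqrt (x : Fin (2 * g + 2) → ℝ) (K a b : ℝ) :
    IntervalIntegrable (fun s : ℝ => K * ∑ j, (Real.sqrt |s - x j|)⁻¹) volume a b := by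
  refine IntervalIntegrable.const_mul ?_ K
  have := IntervalIntegrable.sum (μ := volume) (a := a) (b := b) Finset.univ
    (f := fun j (s : ℝ) => (Real.sqrt |s - x j|)⁻¹)
    fun j _ => intervalIntegrable_inv_sqrt_abs (x j) a b
  have e : (∑ j, fun s : ℝ => (Real.sqrt |s - x j|)⁻¹) =
      fun s : ℝ => ∑ j, (Real.sqrt |s - x j|)⁻¹ := by
    ext s; simp
  rwa [e] at this

lemma intervalIntegrable_omega' (hx : StrictMono x) (i : Fin g) (a b : ℝ) :
    IntervalIntegrable (fun s : ℝ => omega' x i (s : ℂ)) volume a b := by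
  obtain ⟨K, hK, hle⟩ := exists_norm_omega'_le_re hx
  obtain ⟨L, hL⟩ := (isCompact_uIcc (a := a) (b := b)).exists_bound_of_continuousOn
    (f := fun s : ℝ => ‖(s : ℂ) - (x 0 : ℂ)‖ ^ (i : ℕ)) (by fun_prop)
  refine IntervalIntegrable.mono_fun' (intervalIntegrable_sum_inv_sqrt x (L * K) a b)
    ((measurable_omega' x i).comp Complex.measurable_ofReal).aestronglyMeasurable ?_
  filter_upwards [ae_restrict_of_ae (ae_forall_ne x), ae_restrict_mem measurableSet_uIoc]
    with s hs hmem
  refine (hle i s (by simpa using hs)).trans ?_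
  have := hL s (uIoc_subset_uIcc hmem)
  rw [Real.norm_of_nonneg (by positivity)] at this
  rw [mul_assoc]
  simp only [Complex.ofReal_re]
  exact mul_le_mul_of_nonneg_right this (by positivity)

/-! ### The abelian integral `Q` -/

lemma Q_ofReal (x : Fin (2 * g + 2) → ℝ) (i : Fin g) (b : ℝ) :
    Q x (b : ℂ) i = ∫ s in (x 0)..b, omega' x i (s : ℂ) := by
  unfold Q
  rcases eq_or_ne b (x 0) with h | h
  · simp [h]
  have h' : b - x 0 ≠ 0 := sub_ne_zero.2 h
  have := intervalIntegral.integral_comp_add_mul (a := 0) (b := 1)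
    (fun s : ℝ => omega' x i (s : ℂ)) h' (x 0)
  have e1 : ∀ t : ℝ, omega' x i ((x 0 : ℂ) + (t : ℂ) * ((b : ℂ) - (x 0 : ℂ))) =
      omega' x i (((x 0 + (b - x 0) * t : ℝ)) : ℂ) := by
    intro t; congr 1; push_cast; ring
  simp only [e1]
  rw [this]
  simp only [mul_zero, add_zero, mul_one, add_sub_cancel]
  rw [Complex.real_smul]
  push_cast
  have : (b : ℂ) - (x 0 : ℂ) ≠ 0 := by exact_mod_cast h'
  field_simp

lemma Q_sub_Q (hx : StrictMono x) (i : Fin g) (a b : ℝ) :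
    Q x (b : ℂ) i - Q x (a : ℂ) i = ∫ s in a..b, omega' x i (s : ℂ) := by
  rw [Q_ofReal, Q_ofReal, intervalIntegral.integral_interval_sub_left]
  all_goals exact intervalIntegrable_omega' hx i _ _

lemma norm_omega'_le_inv_sqrt (i : Fin g) {u : ℂ} {m M : ℝ} (hm : 0 < m)
    (hu : ∀ j, j ≠ 0 → m ≤ ‖u - (x j : ℂ)‖) (hM : ‖u - (x 0 : ℂ)‖ ≤ M) :
    ‖omega' x i u‖ ≤ M ^ (i : ℕ) / Real.sqrt m ^ (2 * g + 1) * (Real.sqrt ‖u - (x 0 : ℂ)‖)⁻¹ := by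
  rw [norm_omega', ← Finset.mul_prod_erase _ _ (Finset.mem_univ (0 : Fin (2 * g + 2)))]
  have hcard : (Finset.univ.erase 0 : Finset (Fin (2 * g + 2))).card = 2 * g + 1 := by
    rw [Finset.card_erase_of_mem (Finset.mem_univ _)]; simp
  have hpow : Real.sqrt m ^ (2 * g + 1) ≤
      ∏ j ∈ Finset.univ.erase 0, Real.sqrt ‖u - (x j : ℂ)‖ := by
    rw [← hcard, ← Finset.prod_const]
    exact Finset.prod_le_prod (fun _ _ => by positivity) fun j hj =>
      Real.sqrt_le_sqrt (hu j (Finset.ne_of_mem_erase hj))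
  have h0 : 0 ≤ M := (norm_nonneg _).trans hM
  rw [mul_comm (Real.sqrt _), ← div_div, div_eq_mul_inv _ (Real.sqrt ‖u - _‖)]
  refine mul_le_mul_of_nonneg_right ?_ (by positivity)
  exact div_le_div₀ (by positivity) (pow_le_pow_left₀ (norm_nonneg _) hM _) (by positivity) hpow

/-- Segments from `x_1` to points near `z₀` keep a positive distance from the other marked points
if the segment to `z₀` avoids them. -/
lemma exists_segment_far {z₀ : ℂ}
    (h : ∀ j, j ≠ 0 → ∀ t ∈ Icc (0 : ℝ) 1, (x 0 : ℂ) + (t : ℂ) * (z₀ - (x 0 : ℂ)) ≠ (x j : ℂ)) :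
    ∃ m : ℝ, 0 < m ∧ ∀ z : ℂ, ‖z - z₀‖ < m → ∀ t ∈ Icc (0 : ℝ) 1, ∀ j, j ≠ 0 →
      m ≤ ‖(x 0 : ℂ) + (t : ℂ) * (z - (x 0 : ℂ)) - (x j : ℂ)‖ := by
  have h1 : ∀ j, ∃ m : ℝ, 0 < m ∧ (j ≠ 0 → ∀ t ∈ Icc (0 : ℝ) 1,
      m ≤ ‖(x 0 : ℂ) + (t : ℂ) * (z₀ - (x 0 : ℂ)) - (x j : ℂ)‖) := by
    intro j
    by_cases hj : j = 0
    · exact ⟨1, one_pos, fun h => absurd hj h⟩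
    obtain ⟨t, ht, hmin⟩ := (isCompact_Icc (a := (0 : ℝ)) (b := 1)).exists_isMinOn
      ⟨0, by simp⟩ (f := fun t : ℝ => ‖(x 0 : ℂ) + (t : ℂ) * (z₀ - (x 0 : ℂ)) - (x j : ℂ)‖)
      (by fun_prop)
    exact ⟨_, norm_pos_iff.2 (sub_ne_zero.2 (h j hj t ht)), fun _ s hs => hmin hs⟩
  choose m hm hle using h1
  obtain ⟨k, -, hk⟩ := Finset.exists_min_image Finset.univ m Finset.univ_nonempty
  refine ⟨m k / 2, half_pos (hm k), fun z hz t ht j hj => ?_⟩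
  have h2 := (hk j (Finset.mem_univ j)).trans (hle j hj t ht)
  have h3 : ‖(t : ℂ) * (z - z₀)‖ ≤ m k / 2 := by
    rw [norm_mul, Complex.norm_real, Real.norm_of_nonneg ht.1]
    nlinarith [ht.1, ht.2, norm_nonneg (z - z₀)]
  have h4 : (x 0 : ℂ) + (t : ℂ) * (z₀ - (x 0 : ℂ)) - (x j : ℂ) =
      ((x 0 : ℂ) + (t : ℂ) * (z - (x 0 : ℂ)) - (x j : ℂ)) - (t : ℂ) * (z - z₀) := by ring
  have h5 := norm_sub_le ((x 0 : ℂ) + (t : ℂ) * (z - (x 0 : ℂ)) - (x j : ℂ)) ((t : ℂ) * (z - z₀))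
  rw [← h4] at h5
  linarith

lemma segment_ne_of_im_pos {z₀ : ℂ} (hz : 0 < z₀.im) (hx : StrictMono x) (j : Fin (2 * g + 2))
    (hj : j ≠ 0) (t : ℝ) : (x 0 : ℂ) + (t : ℂ) * (z₀ - (x 0 : ℂ)) ≠ (x j : ℂ) := by
  intro h
  have him := congrArg Complex.im h
  simp [hz.ne'] at him
  subst him
  simp at h
  exact hj (hx.injective h).symm

lemma aestronglyMeasurable_omega'_segment (i : Fin g) (z : ℂ) (μ : Measure ℝ) :
    AEStronglyMeasurable
      (fun t : ℝ => omega' x i ((x 0 : ℂ) + (t : ℂ) * (z - (x 0 : ℂ)))) μ :=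
  ((measurable_omega' x i).comp (by fun_prop)).aestronglyMeasurable

/-- On the open half-plane `Q` is a primitive of `ω'`; the integrand along the segment is
integrable in spite of its singular end point. -/
lemma hasDerivAt_Q_and_integrable (hx : StrictMono x) (i : Fin g) {z₀ : ℂ} (hz : 0 < z₀.im) :
    IntervalIntegrable (fun t : ℝ => omega' x i ((x 0 : ℂ) + (t : ℂ) * (z₀ - (x 0 : ℂ))))
      volume 0 1 ∧ HasDerivAt (fun z => Q x z i) (omega' x i z₀) z₀ := by
  obtain ⟨m, hm, hfar⟩ := exists_segment_far (x := x) (z₀ := z₀)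
    fun j hj t _ => segment_ne_of_im_pos hz hx j hj t
  set ρ := min m (z₀.im / 2) with hρ
  have hρ0 : 0 < ρ := lt_min hm (half_pos hz)
  set M := ‖z₀ - (x 0 : ℂ)‖ + ρ with hM
  have him : ∀ z ∈ Metric.ball z₀ ρ, z₀.im / 2 < z.im := by
    intro z hz'
    have h1 : |z.im - z₀.im| < z₀.im / 2 := by
      have := Complex.abs_im_le_norm (z - z₀)
      rw [mem_ball_iff_norm] at hz'
      have := min_le_right m (z₀.im / 2)
      simp only [Complex.sub_im] at *
      linarith
    have := (abs_lt.1 h1).1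
    linarith
  have hlow : ∀ z ∈ Metric.ball z₀ ρ, z₀.im / 2 ≤ ‖z - (x 0 : ℂ)‖ := by
    intro z hz'
    have := (Complex.abs_im_le_norm (z - (x 0 : ℂ)))
    simp only [Complex.sub_im, Complex.ofReal_im, sub_zero] at this
    linarith [him z hz', le_abs_self z.im]
  have hupp : ∀ z ∈ Metric.ball z₀ ρ, ‖z - (x 0 : ℂ)‖ ≤ M := by
    intro z hz'
    rw [mem_ball_iff_norm] at hz'
    have : z - (x 0 : ℂ) = (z - z₀) + (z₀ - (x 0 : ℂ)) := by ring
    rw [this]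
    exact (norm_add_le _ _).trans (by linarith)
  have hM0 : 0 ≤ M := by positivity
  have hseg : ∀ (z : ℂ) (t : ℝ), 0 ≤ t →
      ‖(x 0 : ℂ) + (t : ℂ) * (z - (x 0 : ℂ)) - (x 0 : ℂ)‖ = t * ‖z - (x 0 : ℂ)‖ := by
    intro z t ht
    rw [add_sub_cancel_left, norm_mul, Complex.norm_real, Real.norm_of_nonneg ht]
  set C := M ^ (i : ℕ) / Real.sqrt m ^ (2 * g + 1) * (Real.sqrt (z₀.im / 2))⁻¹ with hC
  have hC0 : 0 ≤ C := by positivity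
  have hbound : ∀ z ∈ Metric.ball z₀ ρ, ∀ t ∈ Ioc (0 : ℝ) 1,
      ‖omega' x i ((x 0 : ℂ) + (t : ℂ) * (z - (x 0 : ℂ)))‖ ≤ C * (Real.sqrt |t - 0|)⁻¹ := by
    intro z hz' t ht
    have h1 := norm_omega'_le_inv_sqrt (x := x) i (M := M) hm
      (hfar z ((mem_ball_iff_norm.1 hz').trans_le (min_le_left _ _)) t ⟨ht.1.le, ht.2⟩) (by
        rw [hseg z t ht.1.le]
        have := hupp z hz'
        nlinarith [ht.1, ht.2, norm_nonneg (z - (x 0 : ℂ))])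
    refine h1.trans ?_
    rw [hC, mul_assoc, hseg z t ht.1.le, sub_zero, abs_of_pos ht.1, ← mul_inv,
      ← Real.sqrt_mul (by positivity)]
    refine mul_le_mul_of_nonneg_left ?_ (by positivity)
    refine inv_anti₀ (Real.sqrt_pos.2 (mul_pos (by linarith) ht.1)) (Real.sqrt_le_sqrt ?_)
    rw [mul_comm]
    exact mul_le_mul_of_nonneg_left (hlow z hz') ht.1.le
  -- `D` is the logarithmic derivative of the density, and `F' z t` the `z`-derivative of the
  -- integrand of `Q` at the parameter `t`
  set D : ℂ → ℂ := fun u =>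
    (i : ℕ) / (u - (x 0 : ℂ)) - ∑ j, 1 / (2 * (u - (x j : ℂ))) with hD
  set F' : ℂ → ℝ → ℂ := fun z t =>
    omega' x i ((x 0 : ℂ) + (t : ℂ) * (z - (x 0 : ℂ))) + (z - (x 0 : ℂ)) * (t *
      (omega' x i ((x 0 : ℂ) + (t : ℂ) * (z - (x 0 : ℂ))) *
        D ((x 0 : ℂ) + (t : ℂ) * (z - (x 0 : ℂ))))) with hF'
  set N := (i : ℝ) + (2 * g + 2) * (1 / 2 + M / (2 * m)) with hN
  -- the factor `t` absorbs the pole of `D` at `x_1`, so that `F'` is as singular as the density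
  have hDbound : ∀ z ∈ Metric.ball z₀ ρ, ∀ t ∈ Ioc (0 : ℝ) 1,
      ‖(z - (x 0 : ℂ)) * (t * D ((x 0 : ℂ) + (t : ℂ) * (z - (x 0 : ℂ))))‖ ≤ N := by
    intro z hz' t ht
    set w := z - (x 0 : ℂ) with hw
    set u := (x 0 : ℂ) + (t : ℂ) * w with hu
    have hwpos : 0 < ‖w‖ := lt_of_lt_of_le (half_pos hz) (hlow z hz')
    have hwu : ‖u - (x 0 : ℂ)‖ = t * ‖w‖ := hseg z t ht.1.le
    have hne : 0 < t * ‖w‖ := mul_pos ht.1 hwpos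
    have e : ∀ c : ℂ, ‖w * ((t : ℂ) * c)‖ = t * ‖w‖ * ‖c‖ := by
      intro c; rw [norm_mul, norm_mul, Complex.norm_real, Real.norm_of_nonneg ht.1.le]; ring
    rw [e]
    have h1 : ‖D u‖ ≤ i / (t * ‖w‖) + ∑ j, 1 / (2 * ‖u - (x j : ℂ)‖) := by
      refine (norm_sub_le _ _).trans (add_le_add ?_ ((norm_sum_le _ _).trans ?_))
      · rw [norm_div, hwu]; simp
      · refine Finset.sum_le_sum fun j _ => ?_
        simp
    refine (mul_le_mul_of_nonneg_left h1 hne.le).trans ?_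
    rw [mul_add, mul_div_cancel₀ _ hne.ne', hN]
    refine add_le_add le_rfl ?_
    rw [Finset.mul_sum]
    have h2 : ∀ j, t * ‖w‖ * (1 / (2 * ‖u - (x j : ℂ)‖)) ≤ 1 / 2 + M / (2 * m) := by
      intro j
      rcases eq_or_ne j 0 with rfl | hj
      · rw [hwu]
        have : t * ‖w‖ * (1 / (2 * (t * ‖w‖))) = 1 / 2 := by
          rw [mul_one_div, div_eq_div_iff (by positivity) two_ne_zero]; ring
        rw [this]
        have : 0 ≤ M / (2 * m) := by positivity
        linarith
      · have h3 := hfar z ((mem_ball_iff_norm.1 hz').trans_le (min_le_left _ _)) t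
          ⟨ht.1.le, ht.2⟩ j hj
        have h4 : t * ‖w‖ ≤ M := by
          have := hupp z hz'
          nlinarith [ht.1, ht.2]
        have h5 : t * ‖w‖ * (1 / (2 * ‖u - (x j : ℂ)‖)) ≤ M * (1 / (2 * m)) :=
          mul_le_mul h4 (one_div_le_one_div_of_le (by positivity) (by linarith))
            (by positivity) hM0
        rw [mul_one_div M] at h5
        linarith
    refine (Finset.sum_le_sum fun j _ => h2 j).trans ?_
    rw [Finset.sum_const, Finset.card_univ, Fintype.card_fin, nsmul_eq_mul]
    push_cast
    exact le_rfl
  have hF'bound : ∀ z ∈ Metric.ball z₀ ρ, ∀ t ∈ Ioc (0 : ℝ) 1,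
      ‖F' z t‖ ≤ (C * (1 + N)) * (Real.sqrt |t - 0|)⁻¹ := by
    intro z hz' t ht
    have h1 := hbound z hz' t ht
    have h2 := hDbound z hz' t ht
    set u := (x 0 : ℂ) + (t : ℂ) * (z - (x 0 : ℂ))
    have : F' z t = omega' x i u * (1 + (z - (x 0 : ℂ)) * (t * D u)) := by
      simp only [hF']; ring
    rw [this, norm_mul]
    have h3 : ‖1 + (z - (x 0 : ℂ)) * (t * D u)‖ ≤ 1 + N :=
      (norm_add_le _ _).trans (by rw [norm_one]; linarith)
    calc _ ≤ C * (Real.sqrt |t - 0|)⁻¹ * (1 + N) :=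
          mul_le_mul h1 h3 (norm_nonneg _) (by positivity)
      _ = _ := by ring
  have hsegim : ∀ z ∈ Metric.ball z₀ ρ, ∀ t : ℝ, 0 < t →
      0 < ((x 0 : ℂ) + (t : ℂ) * (z - (x 0 : ℂ))).im := by
    intro z hz' t ht
    have := him z hz'
    simp only [Complex.add_im, Complex.ofReal_im, Complex.mul_im, Complex.ofReal_re,
      Complex.sub_im, Complex.sub_re]
    have : 0 < t * z.im := mul_pos ht (by linarith)
    simpa using this
  have hint : IntervalIntegrable
      (fun t : ℝ => omega' x i ((x 0 : ℂ) + (t : ℂ) * (z₀ - (x 0 : ℂ)))) volume 0 1 := by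
    refine IntervalIntegrable.mono_fun' ((intervalIntegrable_inv_sqrt_abs 0 0 1).const_mul C)
      (aestronglyMeasurable_omega'_segment i z₀ _) ?_
    filter_upwards [ae_restrict_mem measurableSet_uIoc] with t ht
    rw [uIoc_of_le zero_le_one] at ht
    exact hbound z₀ (Metric.mem_ball_self hρ0) t ht
  have hmain := intervalIntegral.hasDerivAt_integral_of_dominated_loc_of_deriv_le
    (μ := volume) (a := 0) (b := 1) (x₀ := z₀) (s := Metric.ball z₀ ρ)
    (F := fun z (t : ℝ) =>
      (z - (x 0 : ℂ)) * omega' x i ((x 0 : ℂ) + (t : ℂ) * (z - (x 0 : ℂ))))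
    (F' := F') (bound := fun t => (C * (1 + N)) * (Real.sqrt |t - 0|)⁻¹)
    (Metric.ball_mem_nhds _ hρ0)
    (Eventually.of_forall fun z => (aestronglyMeasurable_omega'_segment i z _).const_mul _)
    (hint.const_mul _)
    (by
      have h1 : Measurable fun t : ℝ => (x 0 : ℂ) + (t : ℂ) * (z₀ - (x 0 : ℂ)) := by fun_prop
      have h2 := (measurable_omega' x i).comp h1
      refine Measurable.aestronglyMeasurable ?_
      simp only [hF', hD]
      exact h2.add (measurable_const.mul (Complex.measurable_ofReal.mul
        (h2.mul (by fun_prop)))))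
    (by
      refine Eventually.of_forall fun t ht z hz' => ?_
      rw [uIoc_of_le zero_le_one] at ht
      exact hF'bound z hz' t ht)
    ((intervalIntegrable_inv_sqrt_abs 0 0 1).const_mul _)
    (by
      refine Eventually.of_forall fun t ht z hz' => ?_
      rw [uIoc_of_le zero_le_one] at ht
      have h1 : HasDerivAt (fun z : ℂ => (x 0 : ℂ) + (t : ℂ) * (z - (x 0 : ℂ))) (t : ℂ) z := by
        simpa using (((hasDerivAt_id z).sub_const (x 0 : ℂ)).const_mul (t : ℂ)).const_add (x 0 : ℂ)
      have h2 := (hasDerivAt_omega' (x := x) i (hsegim z hz' t ht.1)).comp z h1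
      have h3 := ((hasDerivAt_id z).sub_const (x 0 : ℂ)).mul h2
      refine h3.congr_deriv ?_
      simp only [hF', hD, id, Function.comp]
      ring)
  refine ⟨hint, ?_⟩
  -- `F' z₀ t` is also the `t`-derivative of `t ω'(x_1 + t (z₀ - x_1))`, which tends to zero as
  -- `t → 0` because the density is `O(t^{-1/2})`
  have hftc : ∫ t in (0 : ℝ)..1, F' z₀ t = omega' x i z₀ := by
    have hcont : ContinuousOn (fun t : ℝ =>
        (t : ℂ) * omega' x i ((x 0 : ℂ) + (t : ℂ) * (z₀ - (x 0 : ℂ)))) (Icc 0 1) := by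
      intro t ht
      rcases eq_or_lt_of_le ht.1 with h0 | h0
      · subst h0
        have : Tendsto (fun t : ℝ => C * Real.sqrt t) (𝓝[Icc 0 1] 0) (𝓝 0) := by
          have : Continuous fun t : ℝ => C * Real.sqrt t := by fun_prop
          simpa using (this.tendsto 0).mono_left nhdsWithin_le_nhds
        rw [ContinuousWithinAt]
        simp only [Complex.ofReal_zero, zero_mul]
        refine squeeze_zero_norm' ?_ this
        filter_upwards [self_mem_nhdsWithin] with t ht
        rcases eq_or_lt_of_le ht.1 with h1 | h1
        · simp [← h1]
        · have h2 := hbound z₀ (Metric.mem_ball_self hρ0) t ⟨h1, ht.2⟩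
          rw [norm_mul, Complex.norm_real, Real.norm_of_nonneg ht.1]
          rw [sub_zero, abs_of_pos h1] at h2
          calc _ ≤ t * (C * (Real.sqrt t)⁻¹) := mul_le_mul_of_nonneg_left h2 ht.1
            _ = C * Real.sqrt t := by
              have := Real.mul_self_sqrt ht.1
              have h3 : Real.sqrt t ≠ 0 := (Real.sqrt_pos.2 h1).ne'
              field_simp
              rw [pow_two, this, mul_comm]
      · refine ContinuousAt.continuousWithinAt ?_
        refine (Complex.continuous_ofReal.continuousAt).mul ?_
        refine ContinuousAt.comp (g := omega' x i)
          (hasDerivAt_omega' i (hsegim z₀ (Metric.mem_ball_self hρ0) t h0)).continuousAt ?_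
        fun_prop
    have := intervalIntegral.integral_eq_sub_of_hasDerivAt_of_le zero_le_one hcont
      (f' := F' z₀) (by
        intro t ht
        have h1 : HasDerivAt (fun t : ℝ => (x 0 : ℂ) + (t : ℂ) * (z₀ - (x 0 : ℂ)))
            (z₀ - (x 0 : ℂ)) t := by
          simpa using ((Complex.ofRealCLM.hasDerivAt (x := t)).mul_const
            (z₀ - (x 0 : ℂ))).const_add (x 0 : ℂ)
        have h2 := (hasDerivAt_omega' (x := x) i
          (hsegim z₀ (Metric.mem_ball_self hρ0) t ht.1)).comp t h1
        have h3 := (Complex.ofRealCLM.hasDerivAt (x := t)).mul h2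
        refine h3.congr_deriv ?_
        simp only [hF', hD, Function.comp, Complex.ofRealCLM_apply, Complex.ofReal_one]
        ring) hmain.1
    rw [this]; simp
  have h2 := hmain.2
  rw [hftc] at h2
  refine h2.congr_of_eventuallyEq (Eventually.of_forall fun z => ?_)
  simp only [Q, intervalIntegral.integral_const_mul]

lemma hasDerivAt_Q (hx : StrictMono x) (i : Fin g) {z₀ : ℂ} (hz : 0 < z₀.im) :
    HasDerivAt (fun z => Q x z i) (omega' x i z₀) z₀ :=
  (hasDerivAt_Q_and_integrable hx i hz).2

/-! ### Boundary behaviour of `Q` -/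

/-- In fact `Q(z)` is `O(|z - x_1|^{1/2})`. -/
lemma continuousAt_Q_zero (hx : StrictMono x) (i : Fin g) :
    ContinuousAt (fun z => Q x z i) (x 0 : ℂ) := by
  obtain ⟨m, hm, hfar⟩ := exists_segment_far (x := x) (z₀ := (x 0 : ℂ)) (by
    intro j hj t _ h
    simp at h
    exact hj (hx.injective h).symm)
  set C := m ^ (i : ℕ) / Real.sqrt m ^ (2 * g + 1) with hC
  set J := ∫ t in (0 : ℝ)..1, (Real.sqrt |t - 0|)⁻¹ with hJ
  have hb : ∀ z : ℂ, ‖z - (x 0 : ℂ)‖ < m →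
      ‖Q x z i‖ ≤ C * J * Real.sqrt ‖z - (x 0 : ℂ)‖ := by
    intro z hz
    set r := ‖z - (x 0 : ℂ)‖ with hr
    have h1 : ‖∫ t in (0 : ℝ)..1, omega' x i ((x 0 : ℂ) + (t : ℂ) * (z - (x 0 : ℂ)))‖ ≤
        ∫ t in (0 : ℝ)..1, C * (Real.sqrt r)⁻¹ * (Real.sqrt |t - 0|)⁻¹ := by
      refine intervalIntegral.norm_integral_le_of_norm_le zero_le_one ?_
        ((intervalIntegrable_inv_sqrt_abs 0 0 1).const_mul _)
      refine Eventually.of_forall fun t ht => ?_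
      have hseg : ‖(x 0 : ℂ) + (t : ℂ) * (z - (x 0 : ℂ)) - (x 0 : ℂ)‖ = t * r := by
        rw [add_sub_cancel_left, norm_mul, Complex.norm_real, Real.norm_of_nonneg ht.1.le]
      have h2 := norm_omega'_le_inv_sqrt (x := x) i (M := m) hm (hfar z hz t ⟨ht.1.le, ht.2⟩) (by
        rw [hseg]
        nlinarith [ht.1, ht.2, norm_nonneg (z - (x 0 : ℂ))])
      rw [hseg, Real.sqrt_mul ht.1.le, mul_inv] at h2
      rw [sub_zero, abs_of_pos ht.1]
      exact h2.trans (le_of_eq (by ring))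
    rw [intervalIntegral.integral_const_mul] at h1
    have h3 : ‖Q x z i‖ ≤ r * (C * (Real.sqrt r)⁻¹ * J) := by
      simp only [Q, norm_mul]
      exact mul_le_mul_of_nonneg_left h1 (norm_nonneg _)
    refine h3.trans (le_of_eq ?_)
    rcases eq_or_lt_of_le (norm_nonneg (z - (x 0 : ℂ))) with h0 | h0
    · rw [← hr] at h0; simp [← h0]
    · rw [← hr] at h0
      have h4 := Real.mul_self_sqrt h0.le
      have h5 : Real.sqrt r ≠ 0 := (Real.sqrt_pos.2 h0).ne'
      nth_rewrite 1 [← h4]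
      field_simp
  have hQ0 : Q x (x 0 : ℂ) i = 0 := by simp [Q]
  rw [ContinuousAt, hQ0]
  have hlim : Tendsto (fun z : ℂ => C * J * Real.sqrt ‖z - (x 0 : ℂ)‖) (𝓝 (x 0 : ℂ)) (𝓝 0) := by
    have : Continuous fun z : ℂ => C * J * Real.sqrt ‖z - (x 0 : ℂ)‖ := by fun_prop
    simpa using this.tendsto (x 0 : ℂ)
  refine squeeze_zero_norm' ?_ hlim
  filter_upwards [Metric.ball_mem_nhds (x 0 : ℂ) hm] with z hz
  exact hb z (mem_ball_iff_norm.1 hz)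

/-- The segment from `x_1` to `z` is parametrized by the real part of its points, so that
the singularities stay at the marked points when `z` moves. -/
lemma Q_eq_parametric (i : Fin g) {z : ℂ} (hz : z ∈ closedUpper) (h : z.re ≠ x 0) :
    Q x z i = ((z - (x 0 : ℂ)) / ((z.re - x 0 : ℝ) : ℂ)) *
      ∫ s in (x 0)..z.re, omega' x i
        ((s : ℂ) + ((|z.im / (z.re - x 0)| * |s - x 0| : ℝ) : ℂ) * Complex.I) := by
  have h' : z.re - x 0 ≠ 0 := sub_ne_zero.2 h
  have hsub := intervalIntegral.integral_comp_add_mul (a := 0) (b := 1)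
    (fun s : ℝ => omega' x i
      ((s : ℂ) + ((|z.im / (z.re - x 0)| * |s - x 0| : ℝ) : ℂ) * Complex.I)) h' (x 0)
  simp only [mul_zero, add_zero, mul_one, add_sub_cancel] at hsub
  have e1 : (∫ t in (0 : ℝ)..1, omega' x i ((x 0 : ℂ) + (t : ℂ) * (z - (x 0 : ℂ)))) =
      (z.re - x 0)⁻¹ • ∫ s in (x 0)..z.re, omega' x i
        ((s : ℂ) + ((|z.im / (z.re - x 0)| * |s - x 0| : ℝ) : ℂ) * Complex.I) := by
    rw [← hsub]
    refine intervalIntegral.integral_congr fun t ht => ?_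
    rw [uIcc_of_le zero_le_one] at ht
    congr 1
    have e2 : |z.im / (z.re - x 0)| * |(x 0 + (z.re - x 0) * t) - x 0| = t * z.im := by
      rw [add_sub_cancel_left, abs_mul, abs_div, abs_of_nonneg ht.1,
        abs_of_nonneg (mem_closedUpper.1 hz)]
      have := abs_pos.2 h'
      field_simp
    rw [e2]
    apply Complex.ext <;> simp
    ring
  simp only [Q]
  rw [e1, Complex.real_smul]
  push_cast
  ring

/-- Dominated convergence for the integral `Q_eq_parametric` in its end point and in the slope `m` of
the segment; the absolute value of `m` keeps the path in the closed half-plane for every `m`. -/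
lemma continuousWithinAt_Q_real (hx : StrictMono x) (i : Fin g) {b : ℝ} (hb : b ≠ x 0) :
    ContinuousWithinAt (fun z => Q x z i) closedUpper (b : ℂ) := by
  set A := min (x 0) b - 1 with hA
  set B := max (x 0) b + 1 with hB
  obtain ⟨K, hK, hle⟩ := exists_norm_omega'_le_re hx
  set L := 2 * (B - A) with hL
  have hpar := intervalIntegral.continuousAt_parametric_primitive_of_dominated (μ := volume)
    (F := fun (m : ℝ) (s : ℝ) => omega' x i
      ((s : ℂ) + ((|m| * |s - x 0| : ℝ) : ℂ) * Complex.I)) (x₀ := (0 : ℝ))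
    (fun s => L ^ (i : ℕ) * K * ∑ j, (Real.sqrt |s - x j|)⁻¹) A B (a₀ := x 0) (b₀ := b)
    (fun m => ((measurable_omega' x i).comp (by fun_prop)).aestronglyMeasurable)
    (by
      filter_upwards [Metric.ball_mem_nhds (0 : ℝ) one_pos] with m hm
      filter_upwards [ae_restrict_of_ae (ae_forall_ne x), ae_restrict_mem measurableSet_uIoc]
        with s hs hmem
      have hAB : A ≤ B := by
        have := min_le_left (x 0) b
        have := le_max_left (x 0) b
        linarith
      rw [uIoc_of_le hAB] at hmem
      refine (hle i _ (by simpa using hs)).trans ?_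
      rw [mul_assoc]
      have hre : ((s : ℂ) + ((|m| * |s - x 0| : ℝ) : ℂ) * Complex.I).re = s := by simp
      rw [hre]
      refine mul_le_mul_of_nonneg_right (pow_le_pow_left₀ (norm_nonneg _) ?_ _) (by positivity)
      have e : (s : ℂ) + ((|m| * |s - x 0| : ℝ) : ℂ) * Complex.I - (x 0 : ℂ) =
          ((s - x 0 : ℝ) : ℂ) + ((|m| * |s - x 0| : ℝ) : ℂ) * Complex.I := by push_cast; ring
      rw [e]
      refine (norm_add_le _ _).trans ?_
      rw [norm_mul, Complex.norm_I, Complex.norm_real, Complex.norm_real, Real.norm_eq_abs,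
        Real.norm_eq_abs, abs_mul, abs_abs, abs_abs, mul_one]
      have h1 : |s - x 0| ≤ B - A := by
        have := min_le_left (x 0) b
        have := le_max_left (x 0) b
        rw [abs_le]; constructor <;> linarith [hmem.1, hmem.2]
      have h2 : |m| ≤ 1 := by
        rw [mem_ball_iff_norm, sub_zero, Real.norm_eq_abs] at hm
        exact hm.le
      nlinarith [abs_nonneg m, abs_nonneg (s - x 0)])
    (intervalIntegrable_sum_inv_sqrt x _ _ _)
    (by
      filter_upwards [ae_restrict_of_ae (ae_forall_ne x)] with s hs
      have h1 := continuousWithinAt_omega' (x := x) i (ofReal_mem_closedUpper s)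
        (fun j => by exact_mod_cast hs j)
      have h2 : ContinuousWithinAt (fun m : ℝ => (s : ℂ) + ((|m| * |s - x 0| : ℝ) : ℂ) *
          Complex.I) univ 0 := by fun_prop
      rw [← continuousWithinAt_univ]
      refine ContinuousWithinAt.comp (t := closedUpper) (g := omega' x i) ?_ h2 ?_
      · simpa using h1
      · intro m _
        have : 0 ≤ |m| * |s - x 0| := by positivity
        simpa [closedUpper] using this)
    ⟨by have := min_le_left (x 0) b; linarith, by have := le_max_left (x 0) b; linarith⟩
    ⟨by have := min_le_right (x 0) b; linarith, by have := le_max_right (x 0) b; linarith⟩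
    (by simp)
  have hb' : b - x 0 ≠ 0 := sub_ne_zero.2 hb
  have hcomp : ContinuousAt (fun z : ℂ => ((z - (x 0 : ℂ)) / ((z.re - x 0 : ℝ) : ℂ)) *
      ∫ s in (x 0)..z.re, omega' x i
        ((s : ℂ) + ((|z.im / (z.re - x 0)| * |s - x 0| : ℝ) : ℂ) * Complex.I)) (b : ℂ) := by
    refine ContinuousAt.mul ?_ ?_
    · refine ContinuousAt.div (by fun_prop) (by fun_prop) ?_
      rw [Complex.ofReal_re]
      exact_mod_cast hb'
    · have h3 : ContinuousAt (fun z : ℂ => (z.im / (z.re - x 0), z.re)) (b : ℂ) := by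
        refine ContinuousAt.prodMk ?_ (by fun_prop)
        exact ContinuousAt.div (by fun_prop) (by fun_prop) (by simpa using hb')
      refine ContinuousAt.comp (f := fun z : ℂ => (z.im / (z.re - x 0), z.re)) (g := fun p : ℝ × ℝ =>
        ∫ s in (x 0)..p.2, omega' x i
          ((s : ℂ) + ((|p.1| * |s - x 0| : ℝ) : ℂ) * Complex.I)) ?_ h3
      simpa using hpar
  refine hcomp.continuousWithinAt.congr_of_eventuallyEq ?_
    (Q_eq_parametric i (ofReal_mem_closedUpper b) (by simpa using hb))
  have : ∀ᶠ z : ℂ in 𝓝 (b : ℂ), z.re ≠ x 0 :=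
    (Complex.continuous_re.continuousAt).eventually_ne (by simpa using hb)
  filter_upwards [mem_nhdsWithin_of_mem_nhds this, self_mem_nhdsWithin] with z hz hz'
  exact Q_eq_parametric i hz' hz

lemma continuousOn_Q (hx : StrictMono x) (i : Fin g) :
    ContinuousOn (fun z => Q x z i) closedUpper := by
  intro z hz
  rcases lt_or_eq_of_le (mem_closedUpper.1 hz) with h | h
  · exact (hasDerivAt_Q hx i h).continuousAt.continuousWithinAt
  · obtain ⟨b, rfl⟩ : ∃ b : ℝ, z = b := ⟨z.re, Complex.ext rfl (by simp [← h])⟩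
    rcases eq_or_ne b (x 0) with rfl | hb
    · exact (continuousAt_Q_zero hx i).continuousWithinAt
    · exact continuousWithinAt_Q_real hx i hb

/-- The boundary value of the density determines the normal derivatives of `Re Q` and `Im Q`. -/
lemma hasDerivWithinAt_Q_vertical (hx : StrictMono x) (i : Fin g) {s : ℝ} (hs : ∀ j, s ≠ x j) :
    HasDerivWithinAt (fun y : ℝ => Q x ((s : ℂ) + (y : ℂ) * Complex.I) i)
      (omega' x i (s : ℂ) * Complex.I) (Ici 0) 0 := by
  have hline : ∀ y : ℝ, 0 ≤ y → (s : ℂ) + (y : ℂ) * Complex.I ∈ closedUpper := by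
    intro y hy; simpa [closedUpper] using hy
  have hd : ∀ y : ℝ, 0 < y → HasDerivAt (fun y : ℝ => Q x ((s : ℂ) + (y : ℂ) * Complex.I) i)
      (omega' x i ((s : ℂ) + (y : ℂ) * Complex.I) * Complex.I) y := by
    intro y hy
    have h1 : HasDerivAt (fun y : ℝ => (s : ℂ) + (y : ℂ) * Complex.I) Complex.I y := by
      simpa using ((Complex.ofRealCLM.hasDerivAt (x := y)).mul_const Complex.I).const_add (s : ℂ)
    have h2 := hasDerivAt_Q hx i (z₀ := (s : ℂ) + (y : ℂ) * Complex.I) (by simpa using hy)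
    exact h2.comp y h1
  have hlim : ∀ f : ℂ → ℂ, ContinuousWithinAt f closedUpper (s : ℂ) →
      Tendsto (fun y : ℝ => f ((s : ℂ) + (y : ℂ) * Complex.I)) (𝓝[>] 0) (𝓝 (f s)) := by
    intro f hf
    refine hf.tendsto.comp (tendsto_nhdsWithin_iff.2 ⟨?_, ?_⟩)
    · have : Continuous fun y : ℝ => (s : ℂ) + (y : ℂ) * Complex.I := by fun_prop
      simpa using (this.tendsto 0).mono_left nhdsWithin_le_nhds
    · filter_upwards [self_mem_nhdsWithin] with y hy
      exact hline y (le_of_lt hy)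
  refine hasDerivWithinAt_Ici_of_tendsto_deriv (s := Ioi 0)
    (fun y hy => (hd y hy).differentiableAt.differentiableWithinAt) ?_ self_mem_nhdsWithin ?_
  · have := hlim _ (continuousOn_Q hx i (s : ℂ) (ofReal_mem_closedUpper s))
    simpa [ContinuousWithinAt] using this
  · have h3 := (hlim _ (continuousWithinAt_omega' (x := x) i (ofReal_mem_closedUpper s)
      fun j => by exact_mod_cast hs j)).mul_const Complex.I
    refine h3.congr' ?_
    filter_upwards [self_mem_nhdsWithin] with y hy
    exact (hd y hy).deriv.symm

/-- The part of the segment at distance at most `M` from `x_1` is controlled by compactness, and the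
remaining part contributes at most `C / M` by the quadratic decay of the density. -/
lemma exists_norm_Q_le (hx : StrictMono x) (i : Fin g) :
    ∃ B : ℝ, ∀ z ∈ closedUpper, ‖Q x z i‖ ≤ B := by
  obtain ⟨M, C, hM, hC, hdecay⟩ := exists_norm_omega'_le_of_large (g := g) x
  have hclosed : IsClosed closedUpper := isClosed_le continuous_const Complex.continuous_im
  obtain ⟨B, hB⟩ := ((isCompact_closedBall (x 0 : ℂ) M).inter_left
    hclosed).exists_bound_of_continuousOn ((continuousOn_Q hx i).mono inter_subset_left)
  have hopen : ∀ z : ℂ, 0 < z.im → ‖Q x z i‖ ≤ max B (B + C / M) := by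
    intro z hz
    set r := ‖z - (x 0 : ℂ)‖ with hr
    rcases le_or_gt r M with h | h
    · exact (hB z ⟨hz.le, mem_closedBall_iff_norm.2 h⟩).trans (le_max_left _ _)
    refine le_trans ?_ (le_max_right _ _)
    have hM0 : 0 < M := by linarith
    have hr0 : 0 < r := by linarith
    set t₀ := M / r with ht₀
    have ht0 : 0 < t₀ := by positivity
    have ht1 : t₀ ≤ 1 := (div_le_one hr0).2 h.le
    set f : ℝ → ℂ := fun t => omega' x i ((x 0 : ℂ) + (t : ℂ) * (z - (x 0 : ℂ))) with hf
    have hint : IntervalIntegrable f volume 0 1 := (hasDerivAt_Q_and_integrable hx i hz).1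
    have hsplit : Q x z i = (z - (x 0 : ℂ)) * (∫ t in (0 : ℝ)..t₀, f t) +
        (z - (x 0 : ℂ)) * ∫ t in t₀..1, f t := by
      rw [← mul_add, intervalIntegral.integral_add_adjacent_intervals]
      · rfl
      · exact hint.mono_set (by
          rw [uIcc_of_le ht0.le, uIcc_of_le zero_le_one]; exact Icc_subset_Icc le_rfl ht1)
      · exact hint.mono_set (by
          rw [uIcc_of_le ht1, uIcc_of_le zero_le_one]; exact Icc_subset_Icc ht0.le le_rfl)
    set w := (x 0 : ℂ) + (t₀ : ℂ) * (z - (x 0 : ℂ)) with hw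
    have hfirst : (z - (x 0 : ℂ)) * (∫ t in (0 : ℝ)..t₀, f t) = Q x w i := by
      have h1 := intervalIntegral.smul_integral_comp_mul_left (a := 0) (b := 1) f t₀
      rw [mul_zero, mul_one] at h1
      rw [← h1, Complex.real_smul]
      simp only [Q, hf, hw, add_sub_cancel_left]
      have : ∀ t : ℝ, (x 0 : ℂ) + ((t₀ * t : ℝ) : ℂ) * (z - (x 0 : ℂ)) =
          (x 0 : ℂ) + (t : ℂ) * ((t₀ : ℂ) * (z - (x 0 : ℂ))) := by
        intro t; push_cast; ring
      simp only [this]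
      ring
    have hwB : ‖Q x w i‖ ≤ B := by
      refine hB w ⟨?_, ?_⟩
      · have : 0 ≤ t₀ * z.im := by positivity
        simpa [closedUpper, hw] using this
      · rw [mem_closedBall_iff_norm, hw, add_sub_cancel_left, norm_mul, Complex.norm_real,
          Real.norm_of_nonneg ht0.le, ← hr, ht₀, div_mul_cancel₀ _ hr0.ne']
    have hsecond : ‖∫ t in t₀..1, f t‖ ≤ ∫ t in t₀..1, C / r ^ 2 * t ^ (-2 : ℤ) := by
      have hnot : (0 : ℝ) ∉ uIcc t₀ 1 := by
        rw [uIcc_of_le ht1]; intro h0; linarith [h0.1]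
      refine intervalIntegral.norm_integral_le_of_norm_le ht1 ?_
        ((intervalIntegral.intervalIntegrable_zpow (Or.inr hnot)).const_mul _)
      refine Eventually.of_forall fun t ht => ?_
      have htp : 0 < t := ht0.trans ht.1
      have e : ‖(x 0 : ℂ) + (t : ℂ) * (z - (x 0 : ℂ)) - (x 0 : ℂ)‖ = t * r := by
        rw [add_sub_cancel_left, norm_mul, Complex.norm_real, Real.norm_of_nonneg htp.le]
      have h2 := hdecay i ((x 0 : ℂ) + (t : ℂ) * (z - (x 0 : ℂ))) (by
        rw [e]
        have := mul_le_mul_of_nonneg_right ht.1.le hr0.le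
        rwa [ht₀, div_mul_cancel₀ _ hr0.ne'] at this)
      rw [e] at h2
      refine h2.trans (le_of_eq ?_)
      rw [zpow_neg, zpow_ofNat, mul_pow]
      field_simp
    rw [intervalIntegral.integral_const_mul, integral_zpow (Or.inr ⟨by norm_num, by
        rw [uIcc_of_le ht1]; intro h0; linarith [h0.1]⟩)] at hsecond
    rw [hsplit, hfirst]
    refine (norm_add_le _ _).trans (add_le_add hwB ?_)
    rw [norm_mul, ← hr]
    refine (mul_le_mul_of_nonneg_left hsecond hr0.le).trans ?_
    have e2 : r * (C / r ^ 2 * ((1 ^ (-2 + 1 : ℤ) - t₀ ^ (-2 + 1 : ℤ)) / ((-2 : ℤ) + 1))) =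
        C / M - C / r := by
      norm_num
      rw [ht₀]
      field_simp
      ring
    have e3 : 0 ≤ C / r := by positivity
    have e4 : r * (C / r ^ 2 * ((1 ^ (-2 + 1 : ℤ) - t₀ ^ (-2 + 1 : ℤ)) / (((-2 : ℤ) : ℝ) + 1))) ≤
        C / M := by rw [e2]; linarith
    exact e4
  refine ⟨max B (B + C / M), fun z hz => ?_⟩
  have hz' : z ∈ closure {w : ℂ | 0 < w.im} := by
    rw [Complex.closure_setOfPred_lt_im]; exact hz
  have hne : (𝓝[{w : ℂ | 0 < w.im}] z).NeBot := mem_closure_iff_nhdsWithin_neBot.1 hz'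
  have ht : Tendsto (fun w => ‖Q x w i‖) (𝓝[{w : ℂ | 0 < w.im}] z) (𝓝 ‖Q x z i‖) :=
    ((continuousOn_Q hx i z hz).mono fun w (hw : 0 < w.im) => hw.le).norm
  exact le_of_tendsto ht (by filter_upwards [self_mem_nhdsWithin] with w hw using hopen w hw)

/-- The integral of `ω'` along an upper half-circle is an increment of `Q`. -/
lemma integral_half_circle (hx : StrictMono x) (i : Fin g) {c R : ℝ} (hR : 0 < R)
    (hc : ∀ j, |x j - c| ≠ R) :
    IntervalIntegrable (fun θ : ℝ => deriv (circleMap (c : ℂ) R) θ *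
      omega' x i (circleMap (c : ℂ) R θ)) volume 0 Real.pi ∧
    ∫ θ in (0 : ℝ)..Real.pi, deriv (circleMap (c : ℂ) R) θ * omega' x i (circleMap (c : ℂ) R θ) =
      Q x ((c - R : ℝ) : ℂ) i - Q x ((c + R : ℝ) : ℂ) i := by
  have hmaps : MapsTo (circleMap (c : ℂ) R) (Icc 0 Real.pi) closedUpper := by
    intro θ hθ
    have := Real.sin_nonneg_of_nonneg_of_le_pi hθ.1 hθ.2
    simp only [closedUpper, mem_ofPred_eq, circleMap]
    have : 0 ≤ R * Real.sin θ := by positivity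
    simpa [Complex.exp_ofReal_mul_I_im] using this
  have hcirc : Continuous (circleMap (c : ℂ) R) := continuous_circleMap _ _
  have hcont : ContinuousOn (fun θ : ℝ => deriv (circleMap (c : ℂ) R) θ *
      omega' x i (circleMap (c : ℂ) R θ)) (Icc 0 Real.pi) := by
    refine ContinuousOn.mul ?_ ?_
    · rw [funext (deriv_circleMap (c : ℂ) R)]
      exact ((continuous_circleMap 0 R).mul_const _).continuousOn
    · intro θ hθ
      refine ContinuousWithinAt.comp (t := closedUpper) (continuousWithinAt_omega' i (hmaps hθ) ?_)
        hcirc.continuousWithinAt hmaps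
      intro j hj
      have h1 : ‖circleMap (c : ℂ) R θ - c‖ = R := by simp [circleMap_sub_center, abs_of_pos hR]
      rw [hj, ← Complex.ofReal_sub, Complex.norm_real] at h1
      exact hc j h1
  have hint := hcont.intervalIntegrable_of_Icc (μ := volume) Real.pi_pos.le
  refine ⟨hint, ?_⟩
  have := intervalIntegral.integral_eq_sub_of_hasDerivAt_of_le Real.pi_pos.le
    (f := fun θ => Q x (circleMap (c : ℂ) R θ) i)
    ((continuousOn_Q hx i).comp hcirc.continuousOn hmaps) (by
      intro θ hθ
      have him : 0 < (circleMap (c : ℂ) R θ).im := by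
        have : 0 < R * Real.sin θ := mul_pos hR (Real.sin_pos_of_pos_of_lt_pi hθ.1 hθ.2)
        simpa [circleMap, Complex.exp_ofReal_mul_I_im] using this
      have h1 := (hasDerivAt_Q hx i him).comp θ (hasDerivAt_circleMap (c : ℂ) R θ)
      refine h1.congr_deriv ?_
      rw [deriv_circleMap, mul_comm]) hint
  rw [this]
  simp [circleMap, sub_eq_add_neg]

/-! ### The density on the real line and the imaginary part of `Q` -/

/-- The modulus `∏_j |s - x_j|^{-1/2}` of the algebraic factor of the density on the real line. -/
def weight (x : Fin (2 * g + 2) → ℝ) (s : ℝ) : ℝ := (∏ j, Real.sqrt |s - x j|)⁻¹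

lemma weight_pos {s : ℝ} (hs : ∀ j, s ≠ x j) : 0 < weight x s :=
  inv_pos.2 (Finset.prod_pos fun j _ => Real.sqrt_pos.2 (abs_pos.2 (sub_ne_zero.2 (hs j))))

lemma ofReal_cpow_half (r : ℝ) :
    (r : ℂ) ^ (1 / 2 : ℂ) = (if r < 0 then Complex.I else 1) * (Real.sqrt |r| : ℂ) := by
  have hpos : ∀ t : ℝ, 0 ≤ t → (t : ℂ) ^ (1 / 2 : ℂ) = (Real.sqrt t : ℂ) := by
    intro t ht
    rw [Real.sqrt_eq_rpow, Complex.ofReal_cpow ht]; norm_num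
  split_ifs with h
  · rw [Complex.ofReal_cpow_of_nonpos h.le, ← Complex.ofReal_neg, hpos _ (by linarith),
      abs_of_neg h, mul_comm]
    congr 1
    rw [show (Real.pi : ℂ) * Complex.I * (1 / 2) = Real.pi / 2 * Complex.I by ring,
      Complex.exp_pi_div_two_mul_I]
  · rw [hpos r (not_lt.1 h), abs_of_nonneg (not_lt.1 h), one_mul]

/-- On the real line each marked point to the right of `s` contributes a factor `i`. -/
lemma omega'_ofReal (i : Fin g) {s : ℝ} {k : ℕ} (hs : ∀ j : Fin (2 * g + 2), s < x j ↔ k ≤ j) :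
    omega' x i s = (Complex.I ^ (2 * g + 2 - k))⁻¹ *
      (((s - x 0) ^ (i : ℕ) * weight x s : ℝ) : ℂ) := by
  have hprod : ∏ j, ((s : ℂ) - (x j : ℂ)) ^ (1 / 2 : ℂ) =
      Complex.I ^ (2 * g + 2 - k) * ((∏ j, Real.sqrt |s - x j| : ℝ) : ℂ) := by
    have h1 : ∀ j, ((s : ℂ) - (x j : ℂ)) ^ (1 / 2 : ℂ) =
        (if k ≤ (j : ℕ) then Complex.I else 1) * (Real.sqrt |s - x j| : ℂ) := by
      intro j
      rw [← Complex.ofReal_sub, ofReal_cpow_half]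
      simp only [sub_neg, hs j]
    simp only [h1]
    rw [Finset.prod_mul_distrib, Fin.prod_univ_eq_prod_range
      (fun j => if k ≤ j then Complex.I else 1) (2 * g + 2), Finset.prod_ite]
    push_cast
    congr 1
    have : (Finset.range (2 * g + 2)).filter (fun j => k ≤ j) = Finset.Ico k (2 * g + 2) := by
      ext j; simp [and_comm]
    rw [this]; simp
  simp only [omega']
  rw [hprod, weight]
  push_cast
  rw [div_eq_mul_inv, mul_inv]
  ring

/-- The density is real on the wired arcs, where an even number of marked points lies to the
right. -/
lemma omega'_im_eq_zero (i : Fin g) {s : ℝ} {k : ℕ}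
    (hs : ∀ j : Fin (2 * g + 2), s < x j ↔ 2 * k ≤ j) (hk : k ≤ g + 1) :
    (omega' x i s).im = 0 := by
  rw [omega'_ofReal i hs, show 2 * g + 2 - 2 * k = 2 * (g + 1 - k) by omega, pow_mul,
    Complex.I_sq, Complex.im_mul_ofReal]
  have : ((-1 : ℂ) ^ (g + 1 - k))⁻¹ = (((-1 : ℝ) ^ (g + 1 - k))⁻¹ : ℝ) := by push_cast; rfl
  rw [this, Complex.ofReal_im, zero_mul]

/-- The density is imaginary on the `j`-th free arc, of constant sign up to its polynomial factor. -/
lemma omega'_free (i : Fin g) {s : ℝ} (j : Fin (g + 1))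
    (hs : ∀ k : Fin (2 * g + 2), s < x k ↔ 2 * (j : ℕ) + 1 ≤ k) :
    omega' x i s =
      ((-(-1) ^ (g - (j : ℕ)) * ((s - x 0) ^ (i : ℕ) * weight x s) : ℝ) : ℂ) * Complex.I := by
  have hj := j.2
  rw [omega'_ofReal i hs,
    show 2 * g + 2 - (2 * (j : ℕ) + 1) = 2 * (g - (j : ℕ)) + 1 by omega, pow_succ, pow_mul,
    Complex.I_sq, mul_inv, Complex.inv_I]
  have : ((-1 : ℂ) ^ (g - (j : ℕ)))⁻¹ = (-1) ^ (g - (j : ℕ)) := by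
    rw [← inv_pow]; norm_num
  rw [this]
  push_cast
  ring

lemma lt_iff_of_mem (hx : StrictMono x) {s : ℝ} {a : ℕ} (ha : a + 1 < 2 * g + 2)
    (hne : ∀ j, s ≠ x j) (h1 : x ⟨a, by omega⟩ ≤ s) (h2 : s ≤ x ⟨a + 1, ha⟩)
    (j : Fin (2 * g + 2)) : s < x j ↔ a + 1 ≤ j := by
  constructor
  · intro h
    by_contra hcon
    have : x j ≤ x ⟨a, by omega⟩ := hx.monotone (Fin.le_def.2 (by simp; omega))
    linarith
  · intro h
    have : x ⟨a + 1, ha⟩ ≤ x j := hx.monotone (Fin.le_def.2 (by simpa using h))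
    exact lt_of_le_of_ne (h2.trans this) (hne j)

lemma im_Q_sub (hx : StrictMono x) (i : Fin g) (a b : ℝ) :
    (Q x (b : ℂ) i).im - (Q x (a : ℂ) i).im = ∫ s in a..b, (omega' x i (s : ℂ)).im := by
  rw [← Complex.sub_im, Q_sub_Q hx]
  exact (Complex.imCLM.intervalIntegral_comp_comm (intervalIntegrable_omega' hx i a b)).symm

lemma im_Q_eq (hx : StrictMono x) (i : Fin g) {a b : ℝ}
    (h : ∀ s, a ≤ s → s ≤ b → (∀ j, s ≠ x j) → (omega' x i (s : ℂ)).im = 0) (hab : a ≤ b) :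
    (Q x (b : ℂ) i).im = (Q x (a : ℂ) i).im := by
  rw [← sub_eq_zero, im_Q_sub hx]
  refine intervalIntegral.integral_zero_ae ?_
  filter_upwards [ae_forall_ne x] with s hs hmem
  rw [uIoc_of_le hab] at hmem
  exact h s hmem.1.le hmem.2 hs

lemma im_Q_slit (hx : StrictMono x) (i k : Fin g) {s : ℝ}
    (hs : s ∈ Icc (x (slitL k)) (x (slitR k))) :
    (Q x (s : ℂ) i).im = (Q x (x (slitL k) : ℂ) i).im := by
  refine im_Q_eq hx i (fun t h1 h2 hne => ?_) hs.1
  have hk := k.2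
  exact omega'_im_eq_zero (k := (k : ℕ) + 1) i (lt_iff_of_mem hx (a := 2 * (k : ℕ) + 1) (by omega) hne h1
    (h2.trans hs.2)) (by omega)

lemma im_Q_left (hx : StrictMono x) (i : Fin g) {s : ℝ} (hs : s ≤ x 0) :
    (Q x (s : ℂ) i).im = 0 := by
  rw [← im_Q_eq hx i (fun t h1 h2 hne => ?_) hs]
  · simp [Q]
  · refine omega'_im_eq_zero (k := 0) i (fun j => ⟨fun _ => by simp, fun _ => ?_⟩) (by omega)
    exact lt_of_le_of_ne (h2.trans (hx.monotone (Fin.zero_le j))) (hne j)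

lemma im_Q_right_const (hx : StrictMono x) (i : Fin g) {s t : ℝ}
    (hs : x (Fin.last (2 * g + 1)) ≤ s) (hst : s ≤ t) :
    (Q x (t : ℂ) i).im = (Q x (s : ℂ) i).im := by
  refine im_Q_eq hx i (fun r h1 h2 _ => ?_) hst
  refine omega'_im_eq_zero (k := g + 1) i (fun j => ⟨fun h => ?_, fun h => ?_⟩) le_rfl
  · exact absurd h (not_lt.2 ((hx.monotone (Fin.le_last j)).trans (hs.trans h1)))
  · have := j.2; omega

/-- The imaginary part of `Q` returns to zero on the right of the marked points, because `ω'`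
has no residue at infinity. -/
lemma im_Q_right (hx : StrictMono x) (i : Fin g) {s : ℝ} (hs : x (Fin.last (2 * g + 1)) ≤ s) :
    (Q x (s : ℂ) i).im = 0 := by
  obtain ⟨M, C, hM, hC, hdecay⟩ := exists_norm_omega'_le_of_large (g := g) x
  have hbound : ∀ᶠ R : ℝ in atTop, |(Q x (s : ℂ) i).im| ≤ Real.pi * C / R := by
    filter_upwards [eventually_ge_atTop M, eventually_ge_atTop (s - x 0),
      eventually_gt_atTop (x (Fin.last (2 * g + 1)) - x 0)] with R h1 h2 h3
    have hR : 0 < R := by linarith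
    have hc : ∀ j, |x j - x 0| ≠ R := by
      intro j
      rw [abs_of_nonneg (sub_nonneg.2 (hx.monotone (Fin.zero_le j)))]
      have := hx.monotone (Fin.le_last j)
      intro h; linarith
    have hint := (integral_half_circle hx i hR hc).2
    have hnorm : ‖∫ θ in (0 : ℝ)..Real.pi, deriv (circleMap (x 0 : ℂ) R) θ *
        omega' x i (circleMap (x 0 : ℂ) R θ)‖ ≤ C / R * |Real.pi - 0| := by
      refine intervalIntegral.norm_integral_le_of_norm_le_const fun θ _ => ?_
      have hr : ‖circleMap (x 0 : ℂ) R θ - (x 0 : ℂ)‖ = R := by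
        simp [circleMap_sub_center, abs_of_pos hR]
      have := hdecay i (circleMap (x 0 : ℂ) R θ) (by rw [hr]; exact h1)
      rw [hr] at this
      rw [norm_mul, deriv_circleMap]
      have h4 : ‖circleMap 0 R θ * Complex.I‖ = R := by simp [abs_of_pos hR]
      rw [h4]
      refine (mul_le_mul_of_nonneg_left this hR.le).trans (le_of_eq ?_)
      field_simp
    rw [hint] at hnorm
    have him := (Complex.abs_im_le_norm _).trans hnorm
    rw [Complex.sub_im, im_Q_left hx i (by linarith : x 0 - R ≤ x 0), zero_sub, abs_neg,
      im_Q_right_const hx i hs (by linarith : s ≤ x 0 + R), sub_zero,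
      abs_of_pos Real.pi_pos] at him
    refine him.trans (le_of_eq (by ring))
  have hlim : Tendsto (fun R : ℝ => Real.pi * C / R) atTop (𝓝 0) :=
    tendsto_const_nhds.div_atTop tendsto_id
  exact abs_nonpos_iff.1 (ge_of_tendsto hlim hbound)

/-! ### The period matrix -/

/-- The real matrix `-i P`: each period is twice the integral of the upper boundary value of the
form over the free arc inside the cycle. -/
def imPeriod (x : Fin (2 * g + 2) → ℝ) : Matrix (Fin g) (Fin g) ℝ :=
  Matrix.of fun i j => 2 * ∫ s in x (freeL j.castSucc)..x (freeR j.castSucc),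
    (omega' x i (s : ℂ)).im

/-- Only the free arcs contribute to the increments of `Im Q`. -/
lemma im_Q_slitL (hx : StrictMono x) (i : Fin g) (k : Fin g) :
    (Q x (x (slitL k) : ℂ) i).im = ∑ j ∈ Finset.Iic k, imPeriod x i j / 2 := by
  obtain ⟨n, hn⟩ := k
  induction n with
  | zero =>
    have : (Finset.Iic (⟨0, hn⟩ : Fin g)) = {⟨0, hn⟩} := by
      ext j; simp [Fin.le_def, Fin.ext_iff]
    have h0 : (Q x (x 0 : ℂ) i).im = 0 := by simp [Q]
    rw [this, Finset.sum_singleton, ← sub_zero (Q x _ i).im, ← h0, im_Q_sub hx]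
    simp only [imPeriod, Matrix.of_apply, mul_div_cancel_left₀ _ (two_ne_zero' ℝ)]
    rfl
  | succ n ih =>
    have hn' : n < g := by omega
    have : (Finset.Iic (⟨n + 1, hn⟩ : Fin g)) =
        insert ⟨n + 1, hn⟩ (Finset.Iic (⟨n, hn'⟩ : Fin g)) := by
      ext j; simp [Fin.le_def, Fin.ext_iff]; omega
    rw [this, Finset.sum_insert (by simp), ← ih hn', ← sub_eq_iff_eq_add,
      ← im_Q_slit hx i ⟨n, hn'⟩ (s := x (slitR ⟨n, hn'⟩))
        ⟨hx.monotone (by simp [slitL, slitR]), le_rfl⟩, im_Q_sub hx]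
    simp only [imPeriod, Matrix.of_apply, mul_div_cancel_left₀ _ (two_ne_zero' ℝ)]
    rfl

/-- In the counterclockwise parametrization the integral over the lower half-circle is minus the
complex conjugate of the one over the upper half-circle, an increment of `Q`; hence only the
imaginary part of that increment survives. -/
lemma circleIntegral_omega' (hx : StrictMono x) (i : Fin g) {c R : ℝ} (hR : 0 < R)
    (hc : ∀ j, |x j - c| ≠ R) :
    -(∮ u in C((c : ℂ), R), omega' x i u) =
      ((2 * ((Q x ((c + R : ℝ) : ℂ) i).im - (Q x ((c - R : ℝ) : ℂ) i).im) : ℝ) : ℂ) *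
        Complex.I := by
  set f : ℝ → ℂ := fun θ => deriv (circleMap (c : ℂ) R) θ * omega' x i (circleMap (c : ℂ) R θ)
    with hf
  obtain ⟨hint, hval⟩ := integral_half_circle hx i hR hc
  have hrefl : ∀ θ ∈ Ioo 0 Real.pi, f (2 * Real.pi - θ) = -conj (f θ) := by
    intro θ hθ
    have h0 : ∀ c' : ℝ, circleMap (c' : ℂ) R (2 * Real.pi - θ) = conj (circleMap (c' : ℂ) R θ) := by
      intro c'
      simp only [circleMap, map_add, map_mul, Complex.conj_ofReal, ← Complex.exp_conj,
        Complex.conj_I]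
      congr 2
      rw [show ((2 * Real.pi - θ : ℝ) : ℂ) * Complex.I =
        (θ : ℂ) * -Complex.I + 2 * Real.pi * Complex.I by push_cast; ring,
        Complex.exp_add, Complex.exp_two_pi_mul_I, mul_one]
    have him : (circleMap (c : ℂ) R θ).im ≠ 0 := by
      have : 0 < R * Real.sin θ := mul_pos hR (Real.sin_pos_of_pos_of_lt_pi hθ.1 hθ.2)
      simpa [circleMap, Complex.exp_ofReal_mul_I_im] using this.ne'
    have h00 := h0 0
    simp only [Complex.ofReal_zero] at h00
    simp only [hf, deriv_circleMap, h0, h00, omega'_conj x i him, map_mul, Complex.conj_I]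
    ring
  have hae : ∀ᵐ θ ∂volume, θ ∈ uIoc 0 Real.pi → f (2 * Real.pi - θ) = -conj (f θ) := by
    filter_upwards [(Set.countable_singleton Real.pi).ae_notMem volume] with θ hθ hmem
    rw [uIoc_of_le Real.pi_pos.le] at hmem
    exact hrefl θ ⟨hmem.1, lt_of_le_of_ne hmem.2 hθ⟩
  have hconj : IntervalIntegrable (fun θ => -conj (f θ)) volume 0 Real.pi :=
    IntervalIntegrable.neg ⟨Complex.conjCLE.toContinuousLinearMap.integrable_comp hint.1,
      Complex.conjCLE.toContinuousLinearMap.integrable_comp hint.2⟩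
  have hint2 : IntervalIntegrable (fun θ => f (2 * Real.pi - θ)) volume 0 Real.pi :=
    hconj.congr_ae ((ae_restrict_iff' measurableSet_uIoc).2 (by
      filter_upwards [hae] with θ hθ hmem using (hθ hmem).symm))
  have hint3 : IntervalIntegrable f volume Real.pi (2 * Real.pi) := by
    have := (hint2.comp_sub_left (2 * Real.pi)).symm
    simpa [sub_sub_cancel, two_mul] using this
  have hlow : ∫ θ in Real.pi..(2 * Real.pi), f θ = -conj (∫ θ in (0 : ℝ)..Real.pi, f θ) := by
    have h1 := intervalIntegral.integral_comp_sub_left (a := 0) (b := Real.pi) f (2 * Real.pi)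
    rw [show 2 * Real.pi - Real.pi = Real.pi by ring, sub_zero] at h1
    rw [← h1, intervalIntegral.integral_congr_ae hae, intervalIntegral.integral_neg,
      intervalIntegral.integral_of_le Real.pi_pos.le, intervalIntegral.integral_of_le
        Real.pi_pos.le, integral_conj]
  have hsum : (∮ u in C((c : ℂ), R), omega' x i u) =
      (∫ θ in (0 : ℝ)..Real.pi, f θ) + ∫ θ in Real.pi..(2 * Real.pi), f θ :=
    (intervalIntegral.integral_add_adjacent_intervals hint hint3).symm
  rw [hsum, hlow]
  have hval' : (∫ θ in (0 : ℝ)..Real.pi, f θ) =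
    Q x ((c - R : ℝ) : ℂ) i - Q x ((c + R : ℝ) : ℂ) i := hval
  rw [hval']
  apply Complex.ext
  · simp
  · simp; ring

/-- The end points of the upper half-circle lie in the wired arcs next to the encircled free arc.
On the left this is the slit with number `j - 1`, or the unbounded arc if `j` is the first index. -/
lemma Encircles.bounds (hx : StrictMono x) {j : Fin g} {c R : ℝ} (h : Encircles x j c R) :
    0 < R ∧ (∀ k, |x k - c| ≠ R) ∧ c - R < x (freeL j.castSucc) ∧ x (slitL j) < c + R ∧
      c + R < x (slitR j) ∧ (∀ k : Fin g, (k : ℕ) + 1 = j → x (slitR k) = x (freeL j.castSucc) ∧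
        x (slitL k) < c - R) := by
  have hj := j.2
  have hL := (h (freeL j.castSucc)).1 (by simp [freeL])
  have hR := (h (slitL j)).1 (by simp [slitL]; omega)
  have hS := (h (slitR j)).2 (by simp [slitR])
  have hlt : x (slitL j) < x (slitR j) := hx (by simp [slitL, slitR])
  have hlt2 : x (freeL j.castSucc) < x (slitL j) := hx (by simp [slitL, freeL])
  rw [abs_lt] at hL hR
  rw [lt_abs] at hS
  refine ⟨by linarith [hL.1, hL.2], fun k => ?_, by linarith [hL.1], by linarith [hR.2], ?_, ?_⟩
  · by_cases hk : (k : ℕ) / 2 = j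
    · exact ((h k).1 hk).ne
    · exact ((h k).2 hk).ne'
  · rcases hS with hS | hS <;> linarith [hR.1]
  · intro k hk
    have hkk : slitR k = freeL j.castSucc := by
      simp [slitR, freeL, Fin.ext_iff]; omega
    refine ⟨by rw [hkk], ?_⟩
    have hS := (h (slitL k)).2 (by simp [slitL]; omega)
    have hlt3 : x (slitL k) < x (freeL j.castSucc) := hx (by
      rw [← hkk]; simp [slitL, slitR])
    rw [lt_abs] at hS
    rcases hS with hS | hS <;> linarith [hL.2]

/-- The periods do not depend on the circles. -/
lemma neg_circleIntegral_eq_imPeriod (hx : StrictMono x) (i j : Fin g) {c R : ℝ}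
    (h : Encircles x j c R) :
    -(∮ u in C((c : ℂ), R), omega' x i u) = (imPeriod x i j : ℂ) * Complex.I := by
  obtain ⟨hR, hc, h1, h2, h3, h4⟩ := h.bounds hx
  rw [circleIntegral_omega' hx i hR hc]
  congr 2
  rw [im_Q_slit hx i j ⟨h2.le, h3.le⟩, im_Q_slitL hx]
  have hj := j.2
  rcases Nat.eq_zero_or_pos (j : ℕ) with h0 | h0
  · have e1 : freeL j.castSucc = 0 := by simp [freeL, h0]
    rw [e1] at h1
    have e2 : Finset.Iic j = {j} := by
      ext k; simp [Fin.le_def, Fin.ext_iff, h0]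
    rw [im_Q_left hx i h1.le, e2, Finset.sum_singleton]
    ring
  · set k : Fin g := ⟨j - 1, by omega⟩ with hk
    obtain ⟨h5, h6⟩ := h4 k (by simp [hk]; omega)
    have e2 : Finset.Iic j = insert j (Finset.Iic k) := by
      ext l
      rw [Finset.mem_insert, Finset.mem_Iic, Finset.mem_Iic, Fin.le_def, Fin.le_def, Fin.ext_iff]
      simp only [hk]; omega
    rw [im_Q_slit hx i k ⟨h6.le, by rw [h5]; exact h1.le⟩, im_Q_slitL hx, e2,
      Finset.sum_insert (by rw [Finset.mem_Iic, Fin.le_def]; simp only [hk]; omega)]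
    ring

lemma periodMatrix_apply {c R : (Fin (2 * g + 2) → ℝ) → Fin g → ℝ}
    (hC : ∀ x : Fin (2 * g + 2) → ℝ, StrictMono x → ∀ j : Fin g, Encircles x j (c x j) (R x j))
    (hx : StrictMono x) (i j : Fin g) :
    periodMatrix c R x i j = (imPeriod x i j : ℂ) * Complex.I :=
  neg_circleIntegral_eq_imPeriod hx i j (hC x hx j)

/-- A real combination of the forms with vanishing periods has a zero on each of `g` free arcs,
while its numerator has degree less than `g`. -/
lemma det_imPeriod_ne_zero (hx : StrictMono x) : (imPeriod x).det ≠ 0 := by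
  intro hdet
  obtain ⟨v, hv, hvA⟩ := Matrix.exists_vecMul_eq_zero_iff.2 hdet
  set p : Polynomial ℝ := ∑ i : Fin g, Polynomial.monomial (i : ℕ) (v i) with hp
  have hpe : ∀ s : ℝ, p.eval s = ∑ i, v i * s ^ (i : ℕ) := by
    intro s; simp [hp, Polynomial.eval_finsetSum]
  have hroot : ∀ j : Fin g, ∃ s ∈ Ioo (x (freeL j.castSucc)) (x (freeR j.castSucc)),
      p.eval (s - x 0) = 0 := by
    intro j
    have hj := j.2
    by_contra hno
    push Not at hno
    set ε : ℝ := -(-1) ^ (g - (j : ℕ)) with hε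
    set f : ℝ → ℝ := fun s => ε * p.eval (s - x 0) with hf
    have hεne : ε ≠ 0 := by rw [hε]; simp
    have hfcont : Continuous f := continuous_const.mul (p.continuous.comp (by fun_prop))
    have hlt : x (freeL j.castSucc) < x (freeR j.castSucc) := hx (by simp [freeL, freeR])
    set q : ℝ → ℝ := fun s => ∑ i, v i * (omega' x i (s : ℂ)).im with hq
    have himint : ∀ i, IntervalIntegrable (fun s : ℝ => (omega' x i (s : ℂ)).im) volume
        (x (freeL j.castSucc)) (x (freeR j.castSucc)) := fun i =>
      ⟨Complex.imCLM.integrable_comp (intervalIntegrable_omega' hx i _ _).1,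
        Complex.imCLM.integrable_comp (intervalIntegrable_omega' hx i _ _).2⟩
    have hqint : IntervalIntegrable q volume (x (freeL j.castSucc)) (x (freeR j.castSucc)) := by
      have := IntervalIntegrable.sum (μ := volume) Finset.univ
        (f := fun i (s : ℝ) => v i * (omega' x i (s : ℂ)).im) fun i _ => (himint i).const_mul (v i)
      have e : (∑ i, fun s : ℝ => v i * (omega' x i (s : ℂ)).im) = q := by
        ext s; simp [hq]
      rwa [e] at this
    have hq0 : ∫ s in x (freeL j.castSucc)..x (freeR j.castSucc), q s = 0 := by
      rw [intervalIntegral.integral_finsetSum fun i _ => (himint i).const_mul (v i)]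
      simp only [intervalIntegral.integral_const_mul]
      have := congrFun hvA j
      simp only [Matrix.vecMul, dotProduct, imPeriod, Matrix.of_apply, Pi.zero_apply] at this
      have h2 : (2 : ℝ) * ∑ i, v i * ∫ s in x (freeL j.castSucc)..x (freeR j.castSucc),
          (omega' x i (s : ℂ)).im = 0 := by
        rw [← this, Finset.mul_sum]
        exact Finset.sum_congr rfl fun i _ => by ring
      simpa using h2
    have hne : ∀ s ∈ Ioo (x (freeL j.castSucc)) (x (freeR j.castSucc)), ∀ k, s ≠ x k := by
      rintro s hs k rfl
      have a1 := hx.lt_iff_lt.1 hs.1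
      have a2 := hx.lt_iff_lt.1 hs.2
      rw [Fin.lt_def] at a1 a2
      simp only [freeL, freeR, Fin.val_castSucc] at a1 a2
      omega
    -- the polynomial `f` has constant sign on the arc, and the weight is positive
    have hqf : ∀ s ∈ Ioo (x (freeL j.castSucc)) (x (freeR j.castSucc)),
        q s = f s * weight x s := by
      intro s hs
      have hcount := lt_iff_of_mem hx (a := 2 * (j : ℕ)) (by omega) (hne s hs) hs.1.le hs.2.le
      simp only [hq, hf, hpe, Finset.mul_sum, Finset.sum_mul]
      refine Finset.sum_congr rfl fun i _ => ?_
      have := omega'_free (x := x) i j.castSucc hcount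
      rw [this, Complex.im_ofReal_mul, Complex.I_im, mul_one]
      simp only [hε, Fin.val_castSucc]
      ring
    have hsign : (∀ s ∈ Ioo (x (freeL j.castSucc)) (x (freeR j.castSucc)), 0 < f s) ∨
        ∀ s ∈ Ioo (x (freeL j.castSucc)) (x (freeR j.castSucc)), f s < 0 := by
      by_contra hcon
      push Not at hcon
      obtain ⟨⟨a, ha, ha'⟩, b, hb, hb'⟩ := hcon
      obtain ⟨s, hs, hs0⟩ := isPreconnected_Ioo.intermediate_value ha hb hfcont.continuousOn
        ⟨ha', hb'⟩
      exact hno s hs ((mul_eq_zero.1 hs0).resolve_left hεne)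
    rcases hsign with hs | hs
    · have := intervalIntegral.intervalIntegral_pos_of_pos_on hqint (fun s hs' => by
        rw [hqf s hs']; exact mul_pos (hs s hs') (weight_pos (hne s hs'))) hlt
      linarith
    · have := intervalIntegral.intervalIntegral_pos_of_pos_on hqint.neg (fun s hs' => by
        rw [Pi.neg_apply, hqf s hs', ← neg_mul]
        exact mul_pos (neg_pos.2 (hs s hs')) (weight_pos (hne s hs'))) hlt
      simp only [Pi.neg_apply, intervalIntegral.integral_neg] at this
      linarith
  choose y hy hy0 using hroot
  have hyinj : Function.Injective fun j => y j - x 0 := by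
    have hmono : StrictMono y := by
      intro j k hjk
      have : x (freeR j.castSucc) < x (freeL k.castSucc) := hx (by
        rw [Fin.lt_def] at hjk ⊢; simp only [freeL, freeR, Fin.val_castSucc]; omega)
      linarith [(hy j).2, (hy k).1]
    intro j k hjk
    exact hmono.injective (sub_left_injective hjk)
  have hdeg : p.natDegree < Fintype.card (Fin g) := by
    have hg : 0 < g := by
      obtain ⟨i, -⟩ := Function.ne_iff.1 hv
      exact i.pos
    rw [Fintype.card_fin]
    refine lt_of_le_of_lt (Polynomial.natDegree_sum_le_of_forall_le (n := g - 1) _ _ fun i _ => ?_)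
      (by omega)
    exact (Polynomial.natDegree_monomial_le _).trans (by have := i.2; omega)
  have hp0 := Polynomial.eq_zero_of_natDegree_lt_card_of_eval_eq_zero p hyinj hy0 hdeg
  apply hv
  ext i
  have := congrArg (fun r => Polynomial.coeff r (i : ℕ)) hp0
  simpa [hp, Polynomial.finsetSum_coeff, Polynomial.coeff_monomial, Fin.val_inj] using this

/-! ### Derivatives of determinants and inverse matrices -/

section MatrixCalculus

variable {n : Type*} [Fintype n] [DecidableEq n]

/-- Jacobi's formula. -/
lemma hasDerivAt_det {M : ℝ → Matrix n n ℝ} {M' : Matrix n n ℝ} {t : ℝ}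
    (h : ∀ i j, HasDerivAt (fun s => M s i j) (M' i j) t) :
    HasDerivAt (fun s => (M s).det) (M' * (M t).adjugate).trace t := by
  let D : ContinuousMultilinearMap ℝ (fun _ : n => n → ℝ) ℝ :=
    { (Matrix.detRowAlternating (n := n) (R := ℝ)).toMultilinearMap with
      cont := Continuous.matrix_det continuous_id }
  have hD : ∀ A : Matrix n n ℝ, D A = A.det := fun A => rfl
  have hM : HasDerivAt (fun s => (M s : n → n → ℝ)) M' t :=
    hasDerivAt_pi.2 fun i => hasDerivAt_pi.2 fun j => h i j
  have hcomp := (D.hasFDerivAt (M t)).comp_hasDerivAt t hM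
  refine HasDerivAt.congr_deriv (f := fun s => (M s).det) hcomp ?_
  refine (ContinuousMultilinearMap.linearDeriv_apply D (M t) M').trans ?_
  rw [Matrix.trace]
  refine Finset.sum_congr rfl fun i _ => ?_
  have h1 : D (Function.update (M t) i (M' i)) = ((M t).updateRow i (M' i)).det := rfl
  rw [h1, ← Matrix.cramer_transpose_apply, Matrix.cramer_eq_adjugate_mulVec,
    ← Matrix.adjugate_transpose]
  simp [Matrix.mulVec, dotProduct, Matrix.mul_apply, mul_comm]

lemma differentiableAt_inv_apply {M : ℝ → Matrix n n ℝ} {M' : Matrix n n ℝ} {t : ℝ}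
    (h : ∀ i j, HasDerivAt (fun s => M s i j) (M' i j) t) (hdet : (M t).det ≠ 0) (i j : n) :
    DifferentiableAt ℝ (fun s => (M s)⁻¹ i j) t := by
  have e : (fun s => (M s)⁻¹ i j) =
      fun s => ((M s).det)⁻¹ * ((M s).updateRow j (Pi.single i 1)).det := by
    ext s
    rw [Matrix.inv_def, Matrix.smul_apply, Ring.inverse_eq_inv', smul_eq_mul,
      Matrix.adjugate_apply]
  rw [e]
  refine ((hasDerivAt_det h).differentiableAt.inv hdet).mul ?_
  refine (hasDerivAt_det (M' := M'.updateRow j 0) fun k l => ?_).differentiableAt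
  by_cases hk : k = j
  · subst hk
    simpa using hasDerivAt_const t _
  · simpa [Matrix.updateRow_ne hk] using h k l

lemma hasDerivAt_inv_apply {M : ℝ → Matrix n n ℝ} {M' : Matrix n n ℝ} {t : ℝ}
    (h : ∀ i j, HasDerivAt (fun s => M s i j) (M' i j) t) (hdet : (M t).det ≠ 0) (i j : n) :
    HasDerivAt (fun s => (M s)⁻¹ i j) ((-((M t)⁻¹ * M' * (M t)⁻¹)) i j) t := by
  set N' : Matrix n n ℝ := Matrix.of fun i j => deriv (fun s => (M s)⁻¹ i j) t with hN'
  have hN : ∀ i j, HasDerivAt (fun s => (M s)⁻¹ i j) (N' i j) t := fun i j =>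
    (differentiableAt_inv_apply h hdet i j).hasDerivAt
  have hu : IsUnit (M t).det := isUnit_iff_ne_zero.2 hdet
  -- differentiate `M M⁻¹ = 1`
  have key : M' * (M t)⁻¹ + M t * N' = 0 := by
    ext k l
    have h1 : HasDerivAt (fun s => (M s * (M s)⁻¹) k l) ((M' * (M t)⁻¹ + M t * N') k l) t := by
      simp only [Matrix.mul_apply, Matrix.add_apply, ← Finset.sum_add_distrib]
      exact HasDerivAt.fun_sum fun m _ => (h k m).mul (hN m l)
    have h2 : HasDerivAt (fun s => (M s * (M s)⁻¹) k l) 0 t := by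
      refine (hasDerivAt_const t ((1 : Matrix n n ℝ) k l)).congr_of_eventuallyEq ?_
      filter_upwards [(hasDerivAt_det h).continuousAt.eventually_ne hdet] with s hs
      rw [Matrix.mul_nonsing_inv _ (isUnit_iff_ne_zero.2 hs)]
    exact h1.unique h2
  have : N' = -((M t)⁻¹ * M' * (M t)⁻¹) := by
    have h3 : M t * N' = -(M' * (M t)⁻¹) := by rw [← add_eq_zero_iff_eq_neg', key]
    rw [← Matrix.nonsing_inv_mul_cancel_left _ N' hu, h3, mul_neg, Matrix.mul_assoc]
  rw [← this]
  exact hN i j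

end MatrixCalculus

/-! ### Dependence of the periods on `x_1` -/

lemma update_zero_succ (s : ℝ) (j : Fin (2 * g + 1)) :
    Function.update x 0 s j.succ = x j.succ :=
  Function.update_of_ne (Fin.succ_ne_zero j) _ _

lemma strictMono_update (hx : StrictMono x) {s : ℝ} (hs : s < x 1) :
    StrictMono (Function.update x 0 s) := by
  intro i j hij
  have hj : j ≠ 0 := (lt_of_le_of_lt (Fin.zero_le i) hij).ne'
  rw [Function.update_of_ne hj]
  rcases eq_or_ne i 0 with rfl | hi
  · rw [Function.update_self]
    refine hs.trans_le (hx.monotone ?_)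
    rw [Fin.le_def, Fin.val_one]
    have : 0 < (j : ℕ) := Nat.pos_of_ne_zero fun h => hj (Fin.ext h)
    exact this
  · rw [Function.update_of_ne hi]
    exact hx hij

lemma eventually_strictMono_update (hx : StrictMono x) :
    ∀ᶠ s in 𝓝 (x 0), StrictMono (Function.update x 0 s) := by
  filter_upwards [gt_mem_nhds (hx (show (0 : Fin (2 * g + 2)) < 1 by simp))] with s hs
  exact strictMono_update hx hs

lemma Encircles.eventually_update {j : Fin g} {c R : ℝ} (h : Encircles x j c R) :
    ∀ᶠ s in 𝓝 (x 0), Encircles (Function.update x 0 s) j c R := by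
  refine eventually_all.2 fun k => ?_
  rcases eq_or_ne k 0 with rfl | hk
  · simp only [Function.update_self]
    have hcont : ContinuousAt (fun s : ℝ => |s - c|) (x 0) := by fun_prop
    refine Eventually.and ?_ ?_
    · by_cases hc : ((0 : Fin (2 * g + 2)) : ℕ) / 2 = (j : ℕ)
      · filter_upwards [hcont.eventually (gt_mem_nhds ((h 0).1 hc))] with s hs _ using hs
      · exact Eventually.of_forall fun s hs => absurd hs hc
    · by_cases hc : ((0 : Fin (2 * g + 2)) : ℕ) / 2 = (j : ℕ)
      · exact Eventually.of_forall fun s hs => absurd hc hs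
      · filter_upwards [hcont.eventually (lt_mem_nhds ((h 0).2 hc))] with s hs _ using hs
  · simp only [Function.update_of_ne hk]
    exact Eventually.of_forall fun _ => h k

/-- Only the factor `(u - x_1)^{i - 3/2}` of `ω'_i` depends on `x_1`. -/
lemma hasDerivAt_omega'_update (x : Fin (2 * g + 2) → ℝ) (i : Fin g) (s : ℝ) {u : ℂ}
    (hu : u.im ≠ 0) :
    HasDerivAt (fun s : ℝ => omega' (Function.update x 0 s) i u)
      ((1 / 2 - (i : ℕ)) * (omega' (Function.update x 0 s) i u / (u - (s : ℂ)))) s := by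
  set B : ℂ := ∏ j : Fin (2 * g + 1), (u - (x j.succ : ℂ)) ^ (1 / 2 : ℂ) with hB
  have e : ∀ s : ℝ, omega' (Function.update x 0 s) i u =
      (u - (s : ℂ)) ^ (i : ℕ) / ((u - (s : ℂ)) ^ (1 / 2 : ℂ) * B) := by
    intro s
    rw [omega', Fin.prod_univ_succ]
    simp only [Function.update_self, update_zero_succ, hB]
  have hne : ∀ r : ℝ, u - (r : ℂ) ≠ 0 := by
    intro r h
    apply hu
    simpa using congrArg Complex.im h
  have hcp : ∀ r : ℝ, (u - (r : ℂ)) ^ (1 / 2 : ℂ) ≠ 0 := fun r =>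
    (Complex.cpow_ne_zero_iff_of_exponent_ne_zero (by norm_num)).2 (hne r)
  have hB0 : B ≠ 0 := Finset.prod_ne_zero_iff.2 fun j _ => hcp _
  have hsl : u - (s : ℂ) ∈ Complex.slitPlane := by right; simpa using hu
  have h0 : HasDerivAt (fun w : ℂ => u - w) (-1) (s : ℂ) := by
    simpa using (hasDerivAt_id (s : ℂ)).const_sub u
  have hden := (h0.cpow_const (c := (1 / 2 : ℂ)) hsl).mul_const B
  have hquot := ((h0.pow (i : ℕ)).div hden (mul_ne_zero (hcp s) hB0)).comp_ofReal
  simp only [e]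
  refine hquot.congr_deriv ?_
  simp only [Pi.pow_apply]
  rw [Complex.cpow_sub _ _ (hne s), Complex.cpow_one]
  have h1 := hne s
  have h2 := hcp s
  rcases Nat.eq_zero_or_pos (i : ℕ) with hi | hi
  · simp [hi]; field_simp
  · obtain ⟨m, hm⟩ := Nat.exists_eq_add_of_lt hi
    simp only [zero_add] at hm
    rw [hm]; simp only [Nat.add_sub_cancel, pow_succ]
    push_cast
    field_simp
    ring

lemma hasDerivAt_circleIntegral_omega' (i : Fin g) {c R : ℝ} (hR : 0 < R)
    (hc : ∀ j, |x j - c| ≠ R) :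
    HasDerivAt (fun s : ℝ => ∮ u in C((c : ℂ), R), omega' (Function.update x 0 s) i u)
      (∮ u in C((c : ℂ), R), (1 / 2 - (i : ℕ)) * (omega' x i u / (u - (x 0 : ℂ)))) (x 0) := by
  -- `ρ` is half the distance of the circle from the marked points, so that `x_1` may move by `ρ`
  obtain ⟨k, -, hk⟩ := Finset.exists_min_image Finset.univ (fun j => |(|x j - c| - R)|)
    Finset.univ_nonempty
  set ρ := |(|x k - c| - R)| / 2 with hρ
  have hρ0 : 0 < ρ := half_pos (abs_pos.2 (sub_ne_zero.2 (hc k)))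
  set u : ℝ → ℂ := circleMap (c : ℂ) R with hu
  have hur : ∀ θ, ‖u θ - c‖ = R := fun θ => by simp [hu, circleMap_sub_center, abs_of_pos hR]
  have hdist : ∀ (θ t : ℝ), |(|t - c| - R)| ≤ ‖u θ - (t : ℂ)‖ := by
    intro θ t
    have h1 := abs_norm_sub_norm_le ((t : ℂ) - c) (u θ - c)
    rw [hur, ← Complex.ofReal_sub, Complex.norm_real, Real.norm_eq_abs, Complex.ofReal_sub,
      sub_sub_sub_cancel_right, norm_sub_rev] at h1
    exact h1
  have hfar : ∀ θ, ∀ s ∈ Metric.ball (x 0) ρ, ∀ j, ρ ≤ ‖u θ - (Function.update x 0 s j : ℂ)‖ := by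
    intro θ s hs j
    have hj : 2 * ρ ≤ |(|x j - c| - R)| := by
      have := hk j (Finset.mem_univ j)
      rw [hρ]; linarith
    rcases eq_or_ne j 0 with rfl | hj0
    · rw [Function.update_self]
      refine le_trans ?_ (hdist θ s)
      rw [mem_ball_iff_norm, Real.norm_eq_abs] at hs
      have h2 : |(|x 0 - c| - R)| ≤ |(|s - c| - R)| + |s - x 0| := by
        have h3 : |x 0 - c| - R = (|s - c| - R) + (|x 0 - c| - |s - c|) := by ring
        rw [h3]
        refine (abs_add_le _ _).trans (add_le_add le_rfl ?_)
        refine (abs_abs_sub_abs_le_abs_sub _ _).trans (le_of_eq ?_)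
        rw [sub_sub_sub_cancel_right, abs_sub_comm]
      linarith
    · rw [Function.update_of_ne hj0]
      linarith [hdist θ (x j)]
  set M := R + |x 0 - c| + ρ with hM
  have hupp : ∀ θ, ∀ s ∈ Metric.ball (x 0) ρ, ‖u θ - (s : ℂ)‖ ≤ M := by
    intro θ s hs
    rw [mem_ball_iff_norm, Real.norm_eq_abs] at hs
    have e : u θ - (s : ℂ) = (u θ - c) - ((x 0 - c : ℝ) : ℂ) - ((s - x 0 : ℝ) : ℂ) := by
      push_cast; ring
    rw [e]
    refine (norm_sub_le _ _).trans (add_le_add ((norm_sub_le _ _).trans (add_le_add ?_ ?_)) ?_)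
    · rw [hur]
    · rw [Complex.norm_real, Real.norm_eq_abs]
    · rw [Complex.norm_real, Real.norm_eq_abs]; exact hs.le
  set K := M ^ (i : ℕ) / Real.sqrt ρ ^ (2 * g + 1) * (Real.sqrt ρ)⁻¹ with hK
  have hM0 : 0 ≤ M := by positivity
  have hK0 : 0 ≤ K := by positivity
  have hbound : ∀ θ, ∀ s ∈ Metric.ball (x 0) ρ, ‖omega' (Function.update x 0 s) i (u θ)‖ ≤ K := by
    intro θ s hs
    have h1 := norm_omega'_le_inv_sqrt (x := Function.update x 0 s) i (M := M) hρ0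
      (fun j _ => hfar θ s hs j) (by rw [Function.update_self]; exact hupp θ s hs)
    refine h1.trans ?_
    rw [hK]
    refine mul_le_mul_of_nonneg_left ?_ (by positivity)
    exact inv_anti₀ (Real.sqrt_pos.2 hρ0) (Real.sqrt_le_sqrt (hfar θ s hs 0))
  have hderiv : ∀ θ, ‖deriv u θ‖ = R := fun θ => by
    rw [hu, deriv_circleMap]; simp [abs_of_pos hR]
  have hucont : Continuous u := continuous_circleMap _ _
  have hdmeas : Measurable (deriv u) := measurable_deriv u
  set F : ℝ → ℝ → ℂ := fun s θ => deriv u θ * omega' (Function.update x 0 s) i (u θ) with hF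
  set F' : ℝ → ℝ → ℂ := fun s θ => deriv u θ * ((1 / 2 - ((i : ℕ) : ℂ)) *
      (omega' (Function.update x 0 s) i (u θ) / (u θ - (s : ℂ)))) with hF'
  have hFmeas : ∀ s, Measurable (F s) := fun s =>
    hdmeas.mul ((measurable_omega' _ i).comp hucont.measurable)
  have hF'meas : ∀ s, Measurable (F' s) := fun s =>
    hdmeas.mul (measurable_const.mul (((measurable_omega' _ i).comp hucont.measurable).div
      (hucont.measurable.sub_const _)))
  have hFbound : ∀ θ, ‖F (x 0) θ‖ ≤ R * K := by
    intro θ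
    simp only [hF, norm_mul, hderiv]
    exact mul_le_mul_of_nonneg_left (hbound θ (x 0) (Metric.mem_ball_self hρ0)) hR.le
  have hF'bound : ∀ θ, ∀ s ∈ Metric.ball (x 0) ρ,
      ‖F' s θ‖ ≤ R * (‖(1 / 2 - ((i : ℕ) : ℂ))‖ * (K / ρ)) := by
    intro θ s hs
    have h1 := hfar θ s hs 0
    rw [Function.update_self] at h1
    have h2 := div_le_div₀ hK0 (hbound θ s hs) hρ0 h1
    simp only [hF']
    rw [norm_mul, hderiv, norm_mul (1 / 2 - ((i : ℕ) : ℂ)), norm_div]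
    exact mul_le_mul_of_nonneg_left (mul_le_mul_of_nonneg_left h2 (norm_nonneg _)) hR.le
  -- the branch cuts lie in the real axis, which the circle meets only at the angles in `π ℤ`
  have hFderiv : ∀ᵐ θ : ℝ, ∀ s, HasDerivAt (fun s => F s θ) (F' s θ) s := by
    have hcount : (Set.range fun n : ℤ => (n : ℝ) * Real.pi).Countable := countable_range _
    filter_upwards [hcount.ae_notMem volume] with θ hθ s
    have hsin : Real.sin θ ≠ 0 := fun h => hθ (Real.sin_eq_zero_iff.1 h)
    have him : (u θ).im ≠ 0 := by
      simpa [hu, circleMap, Complex.exp_ofReal_mul_I_im] using ⟨hR.ne', hsin⟩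
    exact (hasDerivAt_omega'_update x i s him).const_mul (deriv u θ)
  have hint : IntervalIntegrable (F (x 0)) volume 0 (2 * Real.pi) :=
    (intervalIntegrable_const (c := R * K)).mono_fun' (hFmeas _).aestronglyMeasurable
      (Eventually.of_forall hFbound)
  have hmain := intervalIntegral.hasDerivAt_integral_of_dominated_loc_of_deriv_le
    (F := F) (F' := F') (Metric.ball_mem_nhds _ hρ0)
    (Eventually.of_forall fun s => (hFmeas s).aestronglyMeasurable) hint
    (hF'meas _).aestronglyMeasurable
    (Eventually.of_forall fun θ _ s hs => hF'bound θ s hs)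
    (intervalIntegrable_const (c := R * (‖(1 / 2 - ((i : ℕ) : ℂ))‖ * (K / ρ))))
    (hFderiv.mono fun θ hθ _ s _ => hθ s)
  simp only [hF, hF'] at hmain
  have h2 := hmain.2
  simp only [Function.update_eq_self] at h2
  simpa only [circleIntegral, smul_eq_mul] using h2

/-- The derivative of the period matrix: the rows below the first one are multiples of the
preceding rows of the period matrix itself. -/
lemma exists_hasDerivAt_imPeriod (hx : StrictMono x) {c R : Fin g → ℝ}
    (hC : ∀ j, Encircles x j (c j) (R j)) :
    ∃ A' : Matrix (Fin g) (Fin g) ℝ,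
      (∀ i j, HasDerivAt (fun s => imPeriod (Function.update x 0 s) i j) (A' i j) (x 0)) ∧
      ∀ i k : Fin g, (i : ℕ) = k + 1 → ∀ j, A' i j = (1 / 2 - (i : ℝ)) * imPeriod x k j := by
  have hval : ∀ i j, HasDerivAt (fun s => imPeriod (Function.update x 0 s) i j)
      (-(∮ u in C((c j : ℂ), R j), (1 / 2 - ((i : ℕ) : ℂ)) *
        (omega' x i u / (u - (x 0 : ℂ))))).im (x 0) := by
    intro i j
    obtain ⟨hR, hc, -⟩ := (hC j).bounds hx
    have h1 := (hasDerivAt_circleIntegral_omega' i hR hc).neg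
    have h2 := (Complex.imCLM.hasFDerivAt.comp_hasDerivAt (x 0) h1)
    refine h2.congr_of_eventuallyEq ?_
    filter_upwards [eventually_strictMono_update hx, (hC j).eventually_update] with s hs hs'
    simp only [Function.comp, Pi.neg_apply, Complex.imCLM_apply,
      neg_circleIntegral_eq_imPeriod hs i j hs', Complex.im_ofReal_mul, Complex.I_im, mul_one]
  refine ⟨Matrix.of fun i j => (-(∮ u in C((c j : ℂ), R j), (1 / 2 - ((i : ℕ) : ℂ)) *
        (omega' x i u / (u - (x 0 : ℂ))))).im, hval, fun i k hik j => ?_⟩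
  obtain ⟨hR, hc, -⟩ := (hC j).bounds hx
  have hcongr : (∮ u in C((c j : ℂ), R j), (1 / 2 - ((i : ℕ) : ℂ)) *
      (omega' x i u / (u - (x 0 : ℂ)))) =
      (1 / 2 - ((i : ℕ) : ℂ)) * ∮ u in C((c j : ℂ), R j), omega' x k u := by
    rw [← circleIntegral.integral_const_mul]
    refine circleIntegral.integral_congr hR.le fun u hu => ?_
    have hne : u - (x 0 : ℂ) ≠ 0 := by
      intro h
      rw [sub_eq_zero] at h
      rw [h, mem_sphere_iff_norm, ← Complex.ofReal_sub, Complex.norm_real] at hu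
      exact hc 0 hu
    simp only [omega', hik, pow_succ]
    field_simp
  rw [Matrix.of_apply, hcongr, ← mul_neg, neg_circleIntegral_eq_imPeriod hx k j (hC j)]
  have : (1 / 2 - ((i : ℕ) : ℂ)) = ((1 / 2 - (i : ℝ) : ℝ) : ℂ) := by push_cast; rfl
  rw [this, ← mul_assoc, ← Complex.ofReal_mul, Complex.im_ofReal_mul, Complex.I_im, mul_one]

/-! ### Half-integer expansions at `x_1` -/

lemma HasHalfIntegerExpansion.clm {E F : Type*} [NormedAddCommGroup E] [NormedSpace ℝ E]
    [NormedAddCommGroup F] [NormedSpace ℝ F] {f : ℝ → E} {t : ℝ} {a b : E}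
    (h : HasHalfIntegerExpansion f t a b) (L : E →L[ℝ] F) :
    HasHalfIntegerExpansion (fun z => L (f z)) t (L a) (L b) := by
  refine ((L.isBigO_comp _ _).trans h).congr_left fun z => ?_
  simp only [map_sub, map_add, map_smul]

lemma HasHalfIntegerExpansion.congr {E : Type*} [NormedAddCommGroup E] [NormedSpace ℝ E]
    {f f' : ℝ → E} {t : ℝ} {a b : E} (h : HasHalfIntegerExpansion f t a b)
    (hf : f =ᶠ[𝓝[>] t] f') : HasHalfIntegerExpansion f' t a b :=
  IsBigO.congr' h (hf.mono fun z hz => by simp only [hz]) EventuallyEq.rfl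

/-- Integration against `r^{-1/2}` of a function with a first order Taylor expansion. -/
lemma isBigO_integral_rpow_neg_half_mul {q : ℝ → ℝ} {q₀ q₁ : ℝ}
    (hq : (fun r => q r - (q₀ + q₁ * r)) =O[𝓝[>] 0] fun r => r ^ 2)
    (hint : ∀ᶠ v in 𝓝[>] (0 : ℝ), IntervalIntegrable (fun r => r ^ (-(1 / 2) : ℝ) * q r) volume 0 v) :
    (fun v : ℝ => (∫ r in (0 : ℝ)..v, r ^ (-(1 / 2) : ℝ) * q r) -
      (v ^ (1 / 2 : ℝ) * (2 * q₀) + v ^ (3 / 2 : ℝ) * (2 / 3 * q₁)))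
      =O[𝓝[>] 0] fun v => v ^ (5 / 2 : ℝ) := by
  obtain ⟨C, hC⟩ := hq.bound
  obtain ⟨δ, hδ, hδC⟩ := mem_nhdsGT_iff_exists_Ioc_subset.1 hC
  refine IsBigO.of_bound (C * (2 / 5)) ?_
  filter_upwards [hint, Ioo_mem_nhdsGT (show (0 : ℝ) < δ from hδ)] with v hv hvδ
  have hv0 : 0 < v := hvδ.1
  have i1 : IntervalIntegrable (fun r : ℝ => r ^ (-(1 / 2) : ℝ) * q₀) volume 0 v :=
    (intervalIntegral.intervalIntegrable_rpow' (by norm_num)).mul_const _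
  have i2 : IntervalIntegrable (fun r : ℝ => r ^ (1 / 2 : ℝ) * q₁) volume 0 v :=
    (intervalIntegral.intervalIntegrable_rpow' (by norm_num)).mul_const _
  have e1 : ∫ r in (0 : ℝ)..v, r ^ (-(1 / 2) : ℝ) * q₀ = v ^ (1 / 2 : ℝ) * (2 * q₀) := by
    rw [intervalIntegral.integral_mul_const, integral_rpow (Or.inl (by norm_num)),
      Real.zero_rpow (by norm_num)]
    norm_num
    ring
  have e2 : ∫ r in (0 : ℝ)..v, r ^ (1 / 2 : ℝ) * q₁ = v ^ (3 / 2 : ℝ) * (2 / 3 * q₁) := by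
    rw [intervalIntegral.integral_mul_const, integral_rpow (Or.inl (by norm_num)),
      Real.zero_rpow (by norm_num)]
    norm_num
    ring
  rw [← e1, ← e2, ← intervalIntegral.integral_add i1 i2,
    ← intervalIntegral.integral_sub hv (i1.add i2)]
  have i3 : IntervalIntegrable (fun r : ℝ => C * r ^ (3 / 2 : ℝ)) volume 0 v :=
    (intervalIntegral.intervalIntegrable_rpow' (by norm_num)).const_mul _
  refine (intervalIntegral.norm_integral_le_of_norm_le hv0.le
    (g := fun r : ℝ => C * r ^ (3 / 2 : ℝ)) (Eventually.of_forall fun r hr => ?_) i3).trans ?_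
  · have h1 : ‖q r - (q₀ + q₁ * r)‖ ≤ C * ‖r ^ 2‖ := hδC ⟨hr.1, hr.2.trans hvδ.2.le⟩
    have h2 : r ^ (1 / 2 : ℝ) = r ^ (-(1 / 2) : ℝ) * r := by
      nth_rewrite 3 [← Real.rpow_one r]
      rw [← Real.rpow_add hr.1]; norm_num
    have h3 : r ^ (3 / 2 : ℝ) = r ^ (-(1 / 2) : ℝ) * r ^ 2 := by
      rw [← Real.rpow_natCast r 2, ← Real.rpow_add hr.1]; norm_num
    have h4 : r ^ (-(1 / 2) : ℝ) * q r - (r ^ (-(1 / 2) : ℝ) * q₀ + r ^ (1 / 2 : ℝ) * q₁) =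
        r ^ (-(1 / 2) : ℝ) * (q r - (q₀ + q₁ * r)) := by rw [h2]; ring
    have h5 : 0 ≤ r ^ (-(1 / 2) : ℝ) := Real.rpow_nonneg hr.1.le _
    rw [h4, h3, norm_mul, Real.norm_of_nonneg h5]
    rw [Real.norm_of_nonneg (sq_nonneg r)] at h1
    calc _ ≤ r ^ (-(1 / 2) : ℝ) * (C * r ^ 2) := mul_le_mul_of_nonneg_left h1 h5
      _ = _ := by ring
  · rw [intervalIntegral.integral_const_mul, integral_rpow (Or.inl (by norm_num)),
      Real.zero_rpow (by norm_num), Real.norm_of_nonneg (Real.rpow_nonneg hv0.le _)]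
    norm_num
    exact le_of_eq (by ring)

/-- The regular factor `∏_{j ≥ 2} (x_j - s)^{-1/2}` of the density at `x_1`. -/
def edge (x : Fin (2 * g + 2) → ℝ) (s : ℝ) : ℝ :=
  ∏ j : Fin (2 * g + 1), (Real.sqrt (x j.succ - s))⁻¹

/-- The sum `∑_{j ≥ 2} (x_j - x_1)⁻¹`. -/
def edgeSum (x : Fin (2 * g + 2) → ℝ) : ℝ := ∑ j : Fin (2 * g + 1), (x j.succ - x 0)⁻¹

lemma edge_update (x : Fin (2 * g + 2) → ℝ) (s : ℝ) :
    edge (Function.update x 0 s) = edge x := by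
  ext t
  simp only [edge, update_zero_succ]

lemma analyticAt_edge (hx : StrictMono x) : AnalyticAt ℝ (edge x) (x 0) := by
  have h : ContDiffAt ℝ ⊤ (edge x) (x 0) := by
    refine contDiffAt_prod fun j _ => ?_
    have hpos : 0 < x j.succ - x 0 := sub_pos.2 (hx (Fin.succ_pos j))
    refine ContDiffAt.inv ?_ (Real.sqrt_pos.2 hpos).ne'
    exact (contDiffAt_const.sub contDiffAt_id).sqrt hpos.ne'
  exact h.analyticAt

lemma hasDerivAt_edge (hx : StrictMono x) :
    HasDerivAt (edge x) (edgeSum x / 2 * edge x (x 0)) (x 0) := by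
  have hfac : ∀ j : Fin (2 * g + 1), HasDerivAt (fun s => (Real.sqrt (x j.succ - s))⁻¹)
      ((Real.sqrt (x j.succ - x 0))⁻¹ * ((x j.succ - x 0)⁻¹ / 2)) (x 0) := by
    intro j
    have hpos : 0 < x j.succ - x 0 := sub_pos.2 (hx (Fin.succ_pos j))
    have h1 : HasDerivAt (fun s => x j.succ - s) (-1) (x 0) := by
      simpa using (hasDerivAt_id (x 0)).const_sub (x j.succ)
    refine ((h1.sqrt hpos.ne').inv (Real.sqrt_pos.2 hpos).ne').congr_deriv ?_
    have h2 := (Real.sqrt_pos.2 hpos).ne'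
    rw [Real.sq_sqrt hpos.le]
    field_simp
  have := HasDerivAt.fun_finsetProd (u := Finset.univ) fun j _ => hfac j
  refine this.congr_deriv ?_
  simp only [smul_eq_mul, ← mul_assoc, Finset.prod_erase_mul _ _ (Finset.mem_univ _)]
  rw [← Finset.mul_sum, edgeSum, edge, Finset.sum_div, mul_comm]

lemma edge_taylor (hx : StrictMono x) :
    (fun r => edge x (x 0 + r) - (edge x (x 0) + edgeSum x / 2 * edge x (x 0) * r))
      =O[𝓝 0] fun r => r ^ 2 := by
  obtain ⟨p, hp⟩ := analyticAt_edge hx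
  have h := hp.isBigO_sub_partialSum_pow 2
  have h0 : p 0 (fun _ => 1) = edge x (x 0) := hp.coeff_zero _
  have h1 : p 1 (fun _ => 1) = edgeSum x / 2 * edge x (x 0) := by
    rw [← hp.deriv, (hasDerivAt_edge hx).deriv]
  refine (h.congr_left fun r => ?_).trans (IsBigO.of_bound 1 (Eventually.of_forall fun r => ?_))
  · rw [FormalMultilinearSeries.partialSum, Finset.sum_range_succ, Finset.sum_range_one,
      FormalMultilinearSeries.apply_eq_pow_smul_coeff,
      FormalMultilinearSeries.apply_eq_pow_smul_coeff, FormalMultilinearSeries.coeff,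
      FormalMultilinearSeries.coeff]
    have h0' : p 0 1 = edge x (x 0) := h0
    have h1' : p 1 1 = edgeSum x / 2 * edge x (x 0) := h1
    rw [h0', h1']
    simp [mul_comm]
  · simp

/-- The real standard basis vectors, numbered from one as in `e`. -/
def eReal (g m : ℕ) : Fin g → ℝ := fun i => if (i : ℕ) + 1 = m then 1 else 0

lemma pow_mul_edge_taylor (hx : StrictMono x) (i : Fin g) :
    (fun r => r ^ (i : ℕ) * edge x (x 0 + r) -
      (edge x (x 0) * eReal g 1 i + (edgeSum x / 2 * edge x (x 0) * eReal g 1 i +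
        edge x (x 0) * eReal g 2 i) * r)) =O[𝓝 0] fun r => r ^ 2 := by
  have h := edge_taylor hx
  have hcont : Tendsto (fun r => edge x (x 0 + r)) (𝓝 0) (𝓝 (edge x (x 0))) := by
    have h1 : ContinuousAt (edge x) (x 0 + 0) := by
      rw [add_zero]; exact (analyticAt_edge hx).continuousAt
    have := h1.tendsto.comp ((continuous_const.add continuous_id).tendsto (0 : ℝ))
    simpa [Function.comp_def] using this
  have hbdd : (fun r => edge x (x 0 + r)) =O[𝓝 0] fun _ => (1 : ℝ) := hcont.isBigO_one ℝ
  obtain ⟨n, hn⟩ := i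
  match n with
  | 0 => simpa [eReal] using h
  | 1 =>
    have hlin : (fun r => edge x (x 0 + r) - edge x (x 0)) =O[𝓝 0] fun r : ℝ => r := by
      have h2 : (fun r : ℝ => r ^ 2) =O[𝓝 0] fun r : ℝ => r := by
        have h4 : (fun r : ℝ => r) =O[𝓝 0] fun _ => (1 : ℝ) := tendsto_id.isBigO_one ℝ
        exact ((isBigO_refl (fun r : ℝ => r) (𝓝 0)).mul h4).congr (fun r => by ring)
          fun r => by ring
      have h3 : (fun r : ℝ => edgeSum x / 2 * edge x (x 0) * r) =O[𝓝 0] fun r : ℝ => r :=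
        isBigO_const_mul_self _ _ _
      exact ((h.trans h2).add h3).congr_left fun r => by ring
    have := (isBigO_refl (fun r : ℝ => r) (𝓝 0)).mul hlin
    refine (this.congr_left fun r => ?_).congr_right fun r => by ring
    simp [eReal]; ring
  | n + 2 =>
    have h2 : (fun r : ℝ => r ^ n) =O[𝓝 0] fun _ => (1 : ℝ) :=
      ((continuous_pow n).tendsto (0 : ℝ)).isBigO_one ℝ
    have := ((isBigO_refl (fun r : ℝ => r ^ 2) (𝓝 0)).mul h2).mul hbdd
    refine (this.congr_left fun r => ?_).congr_right fun r => by ring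
    have e1 : eReal g 1 ⟨n + 2, hn⟩ = 0 := by simp [eReal]
    have e2 : eReal g 2 ⟨n + 2, hn⟩ = 0 := by simp [eReal]
    rw [e1, e2]
    ring

/-- The sign `-(-1)^{n-1}` of the imaginary part of the density on the first free arc. -/
def arcSign (g : ℕ) : ℝ := -(-1) ^ g

lemma weight_eq {s : ℝ} (h0 : x 0 < s) (h1 : ∀ j : Fin (2 * g + 1), s < x j.succ) :
    weight x s = (s - x 0) ^ (-(1 / 2) : ℝ) * edge x s := by
  rw [weight, Fin.prod_univ_succ, mul_inv, edge, Finset.prod_inv_distrib,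
    abs_of_pos (sub_pos.2 h0), Real.rpow_neg (sub_pos.2 h0).le, ← Real.sqrt_eq_rpow]
  congr 2
  refine Finset.prod_congr rfl fun j _ => ?_
  rw [abs_sub_comm, abs_of_pos (sub_pos.2 (h1 j))]

lemma lt_succ_of_lt_one (hx : StrictMono x) {s : ℝ} (h : s < x 1) (j : Fin (2 * g + 1)) :
    s < x j.succ := by
  refine h.trans_le (hx.monotone ?_)
  rw [Fin.le_def, Fin.val_one]
  simp

lemma omega'_first_arc (hx : StrictMono x) (i : Fin g) {s : ℝ} (h0 : x 0 < s) (h1 : s < x 1) :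
    omega' x i s = ((arcSign g * ((s - x 0) ^ (-(1 / 2) : ℝ) *
      ((s - x 0) ^ (i : ℕ) * edge x s)) : ℝ) : ℂ) * Complex.I := by
  have hlt := lt_succ_of_lt_one hx h1
  have hcount : ∀ k : Fin (2 * g + 2), s < x k ↔ 2 * ((0 : Fin (g + 1)) : ℕ) + 1 ≤ k := by
    intro k
    refine Fin.cases ?_ (fun j => ?_) k
    · simp [h0.le]
    · simp [hlt j]
  rw [omega'_free i 0 hcount, weight_eq h0 hlt]
  simp only [arcSign, Fin.val_zero, Nat.sub_zero]
  congr 2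
  ring

lemma re_Q_first_arc (hx : StrictMono x) (i : Fin g) {s : ℝ} (h0 : x 0 ≤ s) (h1 : s < x 1) :
    (Q x (s : ℂ) i).re = 0 := by
  have hre : (Q x (s : ℂ) i).re = ∫ t in (x 0)..s, (omega' x i (t : ℂ)).re := by
    rw [Q_ofReal]
    exact (Complex.reCLM.intervalIntegral_comp_comm (intervalIntegrable_omega' hx i _ _)).symm
  rw [hre]
  refine intervalIntegral.integral_zero_ae (Eventually.of_forall fun t ht => ?_)
  rw [uIoc_of_le h0] at ht
  rw [omega'_first_arc hx i ht.1 (ht.2.trans_lt h1), Complex.re_ofReal_mul, Complex.I_re, mul_zero]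

lemma hasHalfIntegerExpansion_im_Q (hx : StrictMono x) :
    HasHalfIntegerExpansion (fun (z : ℝ) (i : Fin g) => (Q x (z : ℂ) i).im) (x 0)
      ((2 * arcSign g * edge x (x 0)) • eReal g 1)
      ((2 / 3 * arcSign g * edge x (x 0)) • ((edgeSum x / 2) • eReal g 1 + eReal g 2)) := by
  refine isBigO_pi.2 fun i => ?_
  set q : ℝ → ℝ := fun r => arcSign g * (r ^ (i : ℕ) * edge x (x 0 + r)) with hq
  have hx1 : 0 < x 1 - x 0 := sub_pos.2 (hx (by simp))
  have him : ∀ r ∈ Ioo 0 (x 1 - x 0), (omega' x i ((x 0 + r : ℝ) : ℂ)).im =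
      r ^ (-(1 / 2) : ℝ) * q r := by
    intro r hr
    rw [omega'_first_arc hx i (by linarith [hr.1]) (by linarith [hr.2]), Complex.im_ofReal_mul,
      Complex.I_im, mul_one, add_sub_cancel_left]
    simp only [hq]; ring
  have hae : ∀ v ∈ Ioo 0 (x 1 - x 0), ∀ r ∈ uIoc 0 v, (omega' x i ((x 0 + r : ℝ) : ℂ)).im =
      r ^ (-(1 / 2) : ℝ) * q r := by
    intro v hv r hr
    rw [uIoc_of_le hv.1.le] at hr
    exact him r ⟨hr.1, hr.2.trans_lt hv.2⟩
  have hexp := isBigO_integral_rpow_neg_half_mul (q := q)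
    (q₀ := arcSign g * (edge x (x 0) * eReal g 1 i))
    (q₁ := arcSign g * (edgeSum x / 2 * edge x (x 0) * eReal g 1 i + edge x (x 0) * eReal g 2 i))
    (by
      refine (((pow_mul_edge_taylor hx i).const_mul_left (arcSign g)).mono
        nhdsWithin_le_nhds).congr_left fun r => ?_
      simp only [hq]; ring)
    (by
      filter_upwards [Ioo_mem_nhdsGT hx1] with v hv
      have h1 : IntervalIntegrable (fun s : ℝ => (omega' x i (s : ℂ)).im) volume (x 0 + 0)
          (x 0 + v) :=
        ⟨Complex.imCLM.integrable_comp (intervalIntegrable_omega' hx i _ _).1,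
          Complex.imCLM.integrable_comp (intervalIntegrable_omega' hx i _ _).2⟩
      have h2 := h1.comp_add_left (x 0)
      simp only [add_sub_cancel_left] at h2
      exact h2.congr (fun r hr => hae v hv r hr))
  have htend : Tendsto (fun z : ℝ => z - x 0) (𝓝[>] (x 0)) (𝓝[>] 0) := by
    refine tendsto_nhdsWithin_iff.2 ⟨?_, ?_⟩
    · have : Continuous fun z : ℝ => z - x 0 := by fun_prop
      simpa using (this.tendsto (x 0)).mono_left nhdsWithin_le_nhds
    · filter_upwards [self_mem_nhdsWithin] with z hz
      exact mem_Ioi.2 (sub_pos.2 (mem_Ioi.1 hz))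
  have hcomp := hexp.comp_tendsto htend
  refine IsBigO.congr' hcomp ?_ EventuallyEq.rfl
  filter_upwards [htend (Ioo_mem_nhdsGT hx1)] with z hz
  have hval : (Q x (z : ℂ) i).im = ∫ r in (0 : ℝ)..(z - x 0), r ^ (-(1 / 2) : ℝ) * q r := by
    have h0 : (Q x (x 0 : ℂ) i).im = 0 := by simp [Q]
    have hsub := im_Q_sub hx i (x 0) z
    rw [h0, sub_zero] at hsub
    rw [hsub]
    have h1 := intervalIntegral.integral_comp_add_left (a := 0) (b := z - x 0)
      (fun s : ℝ => (omega' x i (s : ℂ)).im) (x 0)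
    rw [add_zero, add_sub_cancel] at h1
    rw [← h1]
    exact intervalIntegral.integral_congr_ae (Eventually.of_forall fun r hr => hae _ hz r hr)
  simp only [Function.comp, Pi.sub_apply, Pi.add_apply, Pi.smul_apply, smul_eq_mul, hval]
  ring

/-! ### The drift relation for real period matrices -/

/-- `HasDerivX1Rows x A'` says that `A'` is the derivative in `x_1` of the real period matrix and
that its rows below the first are multiples of the preceding rows of that matrix. -/
structure HasDerivX1Rows (x : Fin (2 * g + 2) → ℝ) (A' : Matrix (Fin g) (Fin g) ℝ) : Prop where
  hasDerivAt : ∀ i j, HasDerivAt (fun s => imPeriod (Function.update x 0 s) i j) (A' i j) (x 0)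
  row : ∀ i k : Fin g, (i : ℕ) = k + 1 → ∀ j, A' i j = (1 / 2 - (i : ℝ)) * imPeriod x k j

variable {A' : Matrix (Fin g) (Fin g) ℝ}

lemma isUnit_det_imPeriod (hx : StrictMono x) : IsUnit (imPeriod x).det :=
  isUnit_iff_ne_zero.2 (det_imPeriod_ne_zero hx)

/-- Below the first row, `A' (imPeriod x)⁻¹` has its only nonzero entries on the subdiagonal, so
that its trace is its upper left entry. -/
lemma trace_smul_sub_mulVec (hx : StrictMono x) (h : HasDerivX1Rows x A') :
    ((imPeriod x)⁻¹ * A').trace • eReal g 1 - (A' * (imPeriod x)⁻¹) *ᵥ eReal g 1 =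
      (1 / 2 : ℝ) • eReal g 2 := by
  set N := A' * (imPeriod x)⁻¹ with hN
  have hrow : ∀ i k : Fin g, (i : ℕ) = k + 1 → ∀ j,
      N i j = (1 / 2 - (i : ℝ)) * (1 : Matrix (Fin g) (Fin g) ℝ) k j := by
    intro i k hik j
    rw [← Matrix.mul_nonsing_inv _ (isUnit_det_imPeriod hx), hN, Matrix.mul_apply,
      Matrix.mul_apply, Finset.mul_sum]
    exact Finset.sum_congr rfl fun l _ => by rw [h.row i k hik]; ring
  rw [Matrix.trace_mul_comm, ← hN]
  ext i
  have hg : 0 < g := i.pos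
  set o : Fin g := ⟨0, hg⟩ with ho
  have he : eReal g 1 = Pi.single o 1 := by
    ext j; simp [eReal, Pi.single_apply, ho, Fin.ext_iff]
  have htr : N.trace = N o o := by
    rw [Matrix.trace]
    refine Finset.sum_eq_single o (fun k _ hk => ?_) (by simp)
    have hk0 : (k : ℕ) ≠ 0 := fun h0 => hk (Fin.ext h0)
    have hkk := k.2
    have hne : (⟨(k : ℕ) - 1, by omega⟩ : Fin g) ≠ k := by
      intro h0
      have := congrArg Fin.val h0
      simp only at this
      omega
    rw [Matrix.diag_apply, hrow k ⟨(k : ℕ) - 1, by omega⟩ (by simp only; omega) k,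
      Matrix.one_apply_ne hne, mul_zero]
  rw [htr, he, Matrix.mulVec_single_one]
  simp only [Pi.sub_apply, Pi.smul_apply, smul_eq_mul, Matrix.col_apply]
  obtain ⟨n, hn⟩ := i
  match n with
  | 0 =>
    have : (⟨0, hn⟩ : Fin g) = o := rfl
    rw [this]
    simp [eReal, ho]
  | 1 =>
    rw [hrow ⟨1, hn⟩ o rfl o, Matrix.one_apply_eq]
    simp [eReal, ho]
    norm_num
  | n + 2 =>
    have hne : (⟨n + 1, by omega⟩ : Fin g) ≠ o := by simp [ho]
    rw [hrow ⟨n + 2, hn⟩ ⟨n + 1, by omega⟩ rfl o, Matrix.one_apply_ne hne]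
    simp [eReal, ho]

/-- The coefficient of `(z - x_1)^{1/2}` in the expansion of `P⁻¹ Q`. -/
def coeffA (x : Fin (2 * g + 2) → ℝ) : Fin g → ℝ :=
  (2 * arcSign g * edge x (x 0)) • ((imPeriod x)⁻¹ *ᵥ eReal g 1)

/-- The coefficient of `(z - x_1)^{3/2}` in the expansion of `P⁻¹ Q`. -/
def coeffB (x : Fin (2 * g + 2) → ℝ) : Fin g → ℝ :=
  (2 / 3 * arcSign g * edge x (x 0)) •
    ((imPeriod x)⁻¹ *ᵥ ((edgeSum x / 2) • eReal g 1 + eReal g 2))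

lemma hasHalfIntegerExpansion_inv_mulVec_im_Q (hx : StrictMono x) :
    HasHalfIntegerExpansion
      (fun z : ℝ => (imPeriod x)⁻¹ *ᵥ fun i => (Q x (z : ℂ) i).im) (x 0) (coeffA x) (coeffB x) := by
  have h := (hasHalfIntegerExpansion_im_Q hx).clm
    ((imPeriod x)⁻¹.mulVecLin.toContinuousLinearMap)
  simp only [map_smul, LinearMap.coe_toContinuousLinearMap', Matrix.mulVecLin_apply] at h
  exact h

/-- The logarithmic derivative of the partition function in `x_1`, if `A'` is the derivative of the
real period matrix. -/
def logDerivPsi (x : Fin (2 * g + 2) → ℝ) (A' : Matrix (Fin g) (Fin g) ℝ) : ℝ :=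
  ((imPeriod x)⁻¹ * A').trace - edgeSum x / 4

/-- The derivative of `coeffA` in `x_1`, if `A'` is the derivative of the real period matrix. -/
def coeffADeriv (x : Fin (2 * g + 2) → ℝ) (A' : Matrix (Fin g) (Fin g) ℝ) : Fin g → ℝ :=
  (arcSign g * edgeSum x * edge x (x 0)) • ((imPeriod x)⁻¹ *ᵥ eReal g 1) -
    (2 * arcSign g * edge x (x 0)) •
      ((imPeriod x)⁻¹ *ᵥ ((A' * (imPeriod x)⁻¹) *ᵥ eReal g 1))

lemma hasDerivAt_coeffA (hx : StrictMono x) (h : HasDerivX1Rows x A') :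
    HasDerivAt (fun s => coeffA (Function.update x 0 s)) (coeffADeriv x A') (x 0) := by
  refine hasDerivAt_pi.2 fun k => ?_
  have hdet : (imPeriod (Function.update x 0 (x 0))).det ≠ 0 := by
    rw [Function.update_eq_self]; exact det_imPeriod_ne_zero hx
  have hinv := hasDerivAt_inv_apply (M := fun s => imPeriod (Function.update x 0 s)) (t := x 0)
    h.hasDerivAt hdet
  have hvec : HasDerivAt (fun s => ((imPeriod (Function.update x 0 s))⁻¹ *ᵥ eReal g 1) k)
      (-((((imPeriod x)⁻¹ * A' * (imPeriod x)⁻¹) *ᵥ eReal g 1) k)) (x 0) := by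
    have := HasDerivAt.fun_sum (u := Finset.univ) fun j _ => (hinv k j).mul_const (eReal g 1 j)
    rw [Function.update_eq_self] at this
    refine this.congr_deriv ?_
    simp only [Matrix.neg_apply, neg_mul, Finset.sum_neg_distrib]
    rfl
  have := (((hasDerivAt_edge hx).const_mul (2 * arcSign g)).mul hvec)
  simp only [Function.update_eq_self] at this
  have e : (fun s => coeffA (Function.update x 0 s) k) = fun s =>
      2 * arcSign g * edge x s * ((imPeriod (Function.update x 0 s))⁻¹ *ᵥ eReal g 1) k := by
    ext s
    simp only [coeffA, edge_update, Function.update_self, Pi.smul_apply, smul_eq_mul]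
  rw [e]
  refine HasDerivAt.congr_deriv this ?_
  simp only [coeffADeriv, Pi.sub_apply, Pi.smul_apply, smul_eq_mul, Matrix.mulVec_mulVec,
    Matrix.mul_assoc]
  ring

/-- By `trace_smul_sub_mulVec` the terms with `A'` reduce to a multiple of the image of the second
basis vector; the terms in the first one match by themselves. -/
lemma drift_relation (hx : StrictMono x) (h : HasDerivX1Rows x A') :
    (4 * logDerivPsi x A') • coeffA x + (4 : ℝ) • coeffADeriv x A' = (6 : ℝ) • coeffB x := by
  have h1 : (A' * (imPeriod x)⁻¹) *ᵥ eReal g 1 =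
      ((imPeriod x)⁻¹ * A').trace • eReal g 1 - (1 / 2 : ℝ) • eReal g 2 := by
    rw [← trace_smul_sub_mulVec hx h]; abel
  rw [coeffADeriv, h1, coeffB, coeffA, logDerivPsi]
  simp only [Matrix.mulVec_sub, Matrix.mulVec_add, Matrix.mulVec_smul]
  ext k
  simp only [Pi.add_apply, Pi.sub_apply, Pi.smul_apply, smul_eq_mul]
  ring

/-! ### The partition function -/

/-- The partition function up to the constant phase `i^{n-1}`. -/
def psiReal (x : Fin (2 * g + 2) → ℝ) : ℝ :=
  (∏ i, ∏ j ∈ Finset.Ioi i, (x j - x i) ^ (1 / 4 : ℝ)) * (imPeriod x).det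

lemma psiReal_ne_zero (hx : StrictMono x) : psiReal x ≠ 0 := by
  refine mul_ne_zero (Finset.prod_ne_zero_iff.2 fun i _ => Finset.prod_ne_zero_iff.2 fun j hj => ?_)
    (det_imPeriod_ne_zero hx)
  exact (Real.rpow_pos_of_pos (sub_pos.2 (hx (Finset.mem_Ioi.1 hj))) _).ne'

lemma hasDerivAt_psiReal (hx : StrictMono x) (h : HasDerivX1Rows x A') :
    HasDerivAt (fun s => psiReal (Function.update x 0 s)) (logDerivPsi x A' * psiReal x) (x 0) := by
  have hdet := hasDerivAt_det h.hasDerivAt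
  rw [Function.update_eq_self] at hdet
  set B : ℝ := ∏ i : Fin (2 * g + 1), ∏ j ∈ Finset.Ioi i,
    (x j.succ - x i.succ) ^ (1 / 4 : ℝ) with hB
  have hvand : ∀ s, (∏ i, ∏ j ∈ Finset.Ioi i,
      (Function.update x 0 s j - Function.update x 0 s i) ^ (1 / 4 : ℝ)) =
      (∏ j : Fin (2 * g + 1), (x j.succ - s) ^ (1 / 4 : ℝ)) * B := by
    intro s
    rw [Fin.prod_univ_succ, Fin.prod_Ioi_zero]
    simp only [Fin.prod_Ioi_succ, update_zero_succ, Function.update_self, hB]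
  have hfac : ∀ j : Fin (2 * g + 1), HasDerivAt (fun s => (x j.succ - s) ^ (1 / 4 : ℝ))
      ((x j.succ - x 0) ^ (1 / 4 : ℝ) * (-(x j.succ - x 0)⁻¹ / 4)) (x 0) := by
    intro j
    have hpos : 0 < x j.succ - x 0 := sub_pos.2 (hx (Fin.succ_pos j))
    have h1 : HasDerivAt (fun s => x j.succ - s) (-1) (x 0) := by
      simpa using (hasDerivAt_id (x 0)).const_sub (x j.succ)
    refine (h1.rpow_const (Or.inl hpos.ne')).congr_deriv ?_
    rw [Real.rpow_sub_one hpos.ne']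
    field_simp
  have hprod := HasDerivAt.fun_finsetProd (u := Finset.univ) fun j _ => hfac j
  have hall := (hprod.mul_const B).mul hdet
  rw [Function.update_eq_self] at hall
  refine HasDerivAt.congr_deriv (f := fun s => psiReal (Function.update x 0 s))
    (hall.congr_of_eventuallyEq (Eventually.of_forall fun s => ?_)) ?_
  · simp only [psiReal, hvand, Pi.mul_apply]
  · have hv0 := hvand (x 0)
    rw [Function.update_eq_self] at hv0
    simp only [smul_eq_mul, ← mul_assoc, Finset.prod_erase_mul _ _ (Finset.mem_univ _)]
    rw [← Finset.mul_sum, psiReal, hv0, logDerivPsi, edgeSum]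
    have htr : (A' * (imPeriod x).adjugate).trace =
        (imPeriod x).det * ((imPeriod x)⁻¹ * A').trace := by
      rw [Matrix.trace_mul_comm (imPeriod x)⁻¹, Matrix.inv_def, Ring.inverse_eq_inv',
        Matrix.mul_smul, Matrix.trace_smul, smul_eq_mul,
        mul_inv_cancel_left₀ (det_imPeriod_ne_zero hx)]
    rw [htr, ← Finset.sum_div, Finset.sum_neg_distrib]
    ring

/-! ### Passage to the complex period matrix -/

variable {c R : (Fin (2 * g + 2) → ℝ) → Fin g → ℝ}

lemma periodMatrix_eq
    (hC : ∀ x : Fin (2 * g + 2) → ℝ, StrictMono x → ∀ j : Fin g, Encircles x j (c x j) (R x j))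
    (hx : StrictMono x) :
    periodMatrix c R x = Complex.I • (imPeriod x).map Complex.ofRealHom := by
  ext i j
  rw [periodMatrix_apply hC hx, Matrix.smul_apply, Matrix.map_apply, smul_eq_mul, mul_comm]
  rfl

lemma periodMatrix_inv_eq
    (hC : ∀ x : Fin (2 * g + 2) → ℝ, StrictMono x → ∀ j : Fin g, Encircles x j (c x j) (R x j))
    (hx : StrictMono x) :
    (periodMatrix c R x)⁻¹ = (-Complex.I) • (imPeriod x)⁻¹.map Complex.ofRealHom := by
  refine Matrix.inv_eq_right_inv ?_
  rw [periodMatrix_eq hC hx, Matrix.smul_mul, Matrix.mul_smul, ← Matrix.map_mul,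
    Matrix.mul_nonsing_inv _ (isUnit_det_imPeriod hx), smul_smul]
  simp

lemma det_periodMatrix
    (hC : ∀ x : Fin (2 * g + 2) → ℝ, StrictMono x → ∀ j : Fin g, Encircles x j (c x j) (R x j))
    (hx : StrictMono x) :
    (periodMatrix c R x).det = Complex.I ^ g * ((imPeriod x).det : ℂ) := by
  rw [periodMatrix_eq hC hx, Matrix.det_smul, Fintype.card_fin]
  congr 1
  exact (RingHom.map_det Complex.ofRealHom (imPeriod x)).symm

lemma psi_eq
    (hC : ∀ x : Fin (2 * g + 2) → ℝ, StrictMono x → ∀ j : Fin g, Encircles x j (c x j) (R x j))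
    (hx : StrictMono x) : psi c R x = (psiReal x : ℂ) * Complex.I ^ g := by
  rw [psi, det_periodMatrix hC hx, psiReal]
  push_cast
  ring

lemma hasDerivAt_psi
    (hC : ∀ x : Fin (2 * g + 2) → ℝ, StrictMono x → ∀ j : Fin g, Encircles x j (c x j) (R x j))
    (hx : StrictMono x) (h : HasDerivX1Rows x A') :
    HasDerivAt (fun s => psi c R (Function.update x 0 s)) ((logDerivPsi x A' : ℂ) * psi c R x)
      (x 0) := by
  have h1 := ((hasDerivAt_psiReal hx h).ofReal_comp).mul_const (Complex.I ^ g)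
  refine (h1.congr_of_eventuallyEq ?_).congr_deriv ?_
  · filter_upwards [eventually_strictMono_update hx] with s hs using psi_eq hC hs
  · rw [psi_eq hC hx]; push_cast; ring

lemma psi_ne_zero
    (hC : ∀ x : Fin (2 * g + 2) → ℝ, StrictMono x → ∀ j : Fin g, Encircles x j (c x j) (R x j))
    (hx : StrictMono x) : psi c R x ≠ 0 := by
  rw [psi_eq hC hx]
  exact mul_ne_zero (Complex.ofReal_ne_zero.2 (psiReal_ne_zero hx)) (pow_ne_zero _ Complex.I_ne_zero)

lemma dX1_psi_div_psi
    (hC : ∀ x : Fin (2 * g + 2) → ℝ, StrictMono x → ∀ j : Fin g, Encircles x j (c x j) (R x j))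
    (hx : StrictMono x) (h : HasDerivX1Rows x A') :
    dX1 (psi c R) x / psi c R x = (logDerivPsi x A' : ℂ) := by
  rw [dX1, (hasDerivAt_psi hC hx h).deriv, mul_div_cancel_right₀ _ (psi_ne_zero hC hx)]

lemma hasDerivAt_periodMatrix
    (hC : ∀ x : Fin (2 * g + 2) → ℝ, StrictMono x → ∀ j : Fin g, Encircles x j (c x j) (R x j))
    (hx : StrictMono x) (h : HasDerivX1Rows x A') (i j : Fin g) :
    HasDerivAt (fun s => periodMatrix c R (Function.update x 0 s) i j)
      ((Complex.I • A'.map Complex.ofRealHom) i j) (x 0) := by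
  refine (((h.hasDerivAt i j).ofReal_comp).const_mul Complex.I).congr_of_eventuallyEq ?_
  filter_upwards [eventually_strictMono_update hx] with s hs
  rw [periodMatrix_eq hC hs]; rfl

lemma hasDerivAt_periodMatrix_inv
    (hC : ∀ x : Fin (2 * g + 2) → ℝ, StrictMono x → ∀ j : Fin g, Encircles x j (c x j) (R x j))
    (hx : StrictMono x) (h : HasDerivX1Rows x A') (i j : Fin g) :
    HasDerivAt (fun s => (periodMatrix c R (Function.update x 0 s))⁻¹ i j)
      ((Complex.I • ((imPeriod x)⁻¹ * A' * (imPeriod x)⁻¹).map Complex.ofRealHom) i j) (x 0) := by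
  have hdet : (imPeriod (Function.update x 0 (x 0))).det ≠ 0 := by
    rw [Function.update_eq_self]; exact det_imPeriod_ne_zero hx
  have hinv := hasDerivAt_inv_apply (M := fun s => imPeriod (Function.update x 0 s)) (t := x 0)
    h.hasDerivAt hdet i j
  refine ((hinv.ofReal_comp.const_mul (-Complex.I)).congr_of_eventuallyEq ?_).congr_deriv ?_
  · filter_upwards [eventually_strictMono_update hx] with s hs
    rw [periodMatrix_inv_eq hC hs]; rfl
  · rw [Function.update_eq_self]
    rw [Matrix.smul_apply, Matrix.map_apply, Matrix.neg_apply]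
    simp only [Complex.ofRealHom_eq_coe, smul_eq_mul, Complex.ofReal_neg, neg_mul_neg]

lemma period_identity
    (hC : ∀ x : Fin (2 * g + 2) → ℝ, StrictMono x → ∀ j : Fin g, Encircles x j (c x j) (R x j))
    (hx : StrictMono x) (h : HasDerivX1Rows x A') :
    (8 * Matrix.trace ((periodMatrix c R x)⁻¹ * dX1Matrix (periodMatrix c R) x)) • e g 1 +
      (8 : ℂ) • ((periodMatrix c R x * dX1Matrix (fun y => (periodMatrix c R y)⁻¹) x) *ᵥ e g 1) =
      (4 : ℂ) • e g 2 := by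
  have h1 : dX1Matrix (periodMatrix c R) x = Complex.I • A'.map Complex.ofRealHom := by
    ext i j; exact (hasDerivAt_periodMatrix hC hx h i j).deriv
  have h2 : dX1Matrix (fun y => (periodMatrix c R y)⁻¹) x =
      Complex.I • ((imPeriod x)⁻¹ * A' * (imPeriod x)⁻¹).map Complex.ofRealHom := by
    ext i j; exact (hasDerivAt_periodMatrix_inv hC hx h i j).deriv
  have he : ∀ m, e g m = Complex.ofRealHom ∘ eReal g m := by
    intro m; ext i; simp [e, eReal, apply_ite]
  have h3 : (periodMatrix c R x)⁻¹ * dX1Matrix (periodMatrix c R) x =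
      ((imPeriod x)⁻¹ * A').map Complex.ofRealHom := by
    rw [h1, periodMatrix_inv_eq hC hx, Matrix.smul_mul, Matrix.mul_smul, ← Matrix.map_mul,
      smul_smul]
    simp
  have h4 : periodMatrix c R x * dX1Matrix (fun y => (periodMatrix c R y)⁻¹) x =
      -(A' * (imPeriod x)⁻¹).map Complex.ofRealHom := by
    rw [h2, periodMatrix_eq hC hx, Matrix.smul_mul, Matrix.mul_smul, ← Matrix.map_mul,
      smul_smul, Matrix.mul_assoc, Matrix.mul_nonsing_inv_cancel_left _ _
        (isUnit_det_imPeriod hx), Complex.I_mul_I, neg_one_smul]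
  have h5 : (((imPeriod x)⁻¹ * A').map Complex.ofRealHom).trace =
      (((imPeriod x)⁻¹ * A').trace : ℂ) := by
    rw [Matrix.trace, Matrix.trace, Complex.ofReal_sum]; rfl
  have key := trace_smul_sub_mulVec hx h
  rw [h3, h4, h5]
  ext i
  have hk := congrArg (fun r : ℝ => (r : ℂ)) (congrFun key i)
  have h6 := RingHom.map_mulVec Complex.ofRealHom (A' * (imPeriod x)⁻¹) (eReal g 1) i
  rw [Matrix.neg_mulVec, he, he]
  simp only [Pi.add_apply, Pi.smul_apply, Pi.neg_apply, smul_eq_mul, Pi.sub_apply,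
    Function.comp_apply] at hk h6 ⊢
  rw [← h6]
  simp only [Complex.ofRealHom_eq_coe] at hk ⊢
  push_cast at hk
  linear_combination 8 * hk

lemma periodMatrix_inv_mulVec_re
    (hC : ∀ x : Fin (2 * g + 2) → ℝ, StrictMono x → ∀ j : Fin g, Encircles x j (c x j) (R x j))
    (hx : StrictMono x) (z : ℂ) (i : Fin g) :
    (((periodMatrix c R x)⁻¹ *ᵥ Q x z) i).re =
      ((imPeriod x)⁻¹ *ᵥ fun j => (Q x z j).im) i := by
  rw [periodMatrix_inv_eq hC hx]
  simp [Matrix.mulVec, dotProduct, Complex.re_sum]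

lemma periodMatrix_inv_mulVec_im
    (hC : ∀ x : Fin (2 * g + 2) → ℝ, StrictMono x → ∀ j : Fin g, Encircles x j (c x j) (R x j))
    (hx : StrictMono x) {s : ℝ} (h0 : x 0 ≤ s) (h1 : s < x 1) (i : Fin g) :
    (((periodMatrix c R x)⁻¹ *ᵥ Q x s) i).im = 0 := by
  rw [periodMatrix_inv_eq hC hx]
  simp [Matrix.mulVec, dotProduct, Complex.im_sum, re_Q_first_arc hx _ h0 h1]

/-- Entrywise embedding of real vectors into complex vectors. -/
def ofRealVec (g : ℕ) : (Fin g → ℝ) →L[ℝ] (Fin g → ℂ) :=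
  ContinuousLinearMap.pi fun i => Complex.ofRealCLM.comp (ContinuousLinearMap.proj i)

lemma ofRealVec_apply (v : Fin g → ℝ) (i : Fin g) : ofRealVec g v i = (v i : ℂ) := rfl

lemma hasHalfIntegerExpansion_inv_mulVec_Q
    (hC : ∀ x : Fin (2 * g + 2) → ℝ, StrictMono x → ∀ j : Fin g, Encircles x j (c x j) (R x j))
    (hx : StrictMono x) :
    HasHalfIntegerExpansion (fun z : ℝ => (periodMatrix c R x)⁻¹ *ᵥ Q x (z : ℂ)) (x 0)
      (ofRealVec g (coeffA x)) (ofRealVec g (coeffB x)) := by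
  refine ((hasHalfIntegerExpansion_inv_mulVec_im_Q hx).clm (ofRealVec g)).congr ?_
  filter_upwards [Ioo_mem_nhdsGT (hx (show (0 : Fin (2 * g + 2)) < 1 by simp))] with z hz
  ext i
  refine Complex.ext ?_ ?_
  · rw [periodMatrix_inv_mulVec_re hC hx, ofRealVec_apply, Complex.ofReal_re]
  · rw [periodMatrix_inv_mulVec_im hC hx hz.1.le hz.2, ofRealVec_apply, Complex.ofReal_im]

/-! ### Uniqueness in the mixed boundary value problem -/

/-- The strong maximum principle, from the maximum modulus principle for the exponential of a
holomorphic function with real part `u`. -/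
lemma eventually_eq_of_isLocalMax_of_harmonicOnNhd {u : ℂ → ℝ} {p : ℂ} {r : ℝ} (hr : 0 < r)
    (hu : InnerProductSpace.HarmonicOnNhd u (Metric.ball p r)) (hmax : IsLocalMax u p) :
    ∀ᶠ z in 𝓝 p, u z = u p := by
  obtain ⟨F, hF, hre⟩ := hu.exists_analyticOnNhd_ball_re_eq
  have hball := Metric.ball_mem_nhds p hr
  have hnorm : ∀ z ∈ Metric.ball p r, ‖Complex.exp (F z)‖ = Real.exp (u z) := by
    intro z hz
    rw [Complex.norm_exp]
    exact congrArg Real.exp (hre hz)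
  have hd : ∀ᶠ z in 𝓝 p, DifferentiableAt ℂ (fun z => Complex.exp (F z)) z := by
    filter_upwards [hball] with z hz
    exact (hF z hz).differentiableAt.cexp
  have hm : IsLocalMax (norm ∘ fun z => Complex.exp (F z)) p := by
    filter_upwards [hball, hmax] with z hz hz'
    simp only [Function.comp]
    rw [hnorm z hz, hnorm p (Metric.mem_ball_self hr)]
    exact Real.exp_le_exp.2 hz'
  filter_upwards [hball, Complex.eventually_eq_of_isLocalMax_norm hd hm] with z hz hz'
  have := congrArg norm hz'
  rw [hnorm z hz, hnorm p (Metric.mem_ball_self hr)] at this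
  exact Real.exp_injective this

/-- A positive harmonic function on the half-plane which tends to infinity at infinity and
decreases in the inner normal direction along the half-line on the right of `x_1`. The fourth root
has arguments in `[0, π / 4]`; the rotation by `π / 8` keeps the real part positive and makes the
normal derivative strictly negative. -/
def barrier (x : Fin (2 * g + 2) → ℝ) (z : ℂ) : ℝ :=
  ((z - (x 0 : ℂ)) ^ (1 / 4 : ℂ) * Complex.exp ((Real.pi / 8 : ℝ) * Complex.I)).re

lemma harmonicOnNhd_barrier (x : Fin (2 * g + 2) → ℝ) :
    InnerProductSpace.HarmonicOnNhd (barrier x) {z : ℂ | 0 < z.im} := by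
  intro z hz
  have hd : DifferentiableOn ℂ (fun z : ℂ => (z - (x 0 : ℂ)) ^ (1 / 4 : ℂ) *
      Complex.exp ((Real.pi / 8 : ℝ) * Complex.I)) {z : ℂ | 0 < z.im} := by
    intro w hw
    have hsl : w - (x 0 : ℂ) ∈ Complex.slitPlane := by
      right; simpa using (ne_of_gt (show 0 < w.im from hw))
    exact (((differentiableAt_id.sub_const _).cpow_const hsl).mul_const _).differentiableWithinAt
  exact (hd.analyticAt ((isOpen_lt continuous_const Complex.continuous_im).mem_nhds hz)).harmonicAt_re

lemma continuousOn_barrier (x : Fin (2 * g + 2) → ℝ) : ContinuousOn (barrier x) closedUpper := by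
  refine Complex.continuous_re.comp_continuousOn (ContinuousOn.mul ?_ continuousOn_const)
  exact (continuousOn_cpow_closedUpper (a := (1 / 4 : ℂ)) (by norm_num)).comp
    (f := fun z : ℂ => z - (x 0 : ℂ)) (by fun_prop) fun z hz => sub_ofReal_mem_closedUpper hz _

lemma le_barrier (x : Fin (2 * g + 2) → ℝ) {z : ℂ} (hz : z ∈ closedUpper) :
    Real.cos (3 * Real.pi / 8) * ‖z - (x 0 : ℂ)‖ ^ (1 / 4 : ℝ) ≤ barrier x z := by
  set w := z - (x 0 : ℂ) with hw
  have hwu : 0 ≤ w.im := sub_ofReal_mem_closedUpper hz _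
  rcases eq_or_ne w 0 with h0 | h0
  · simp only [barrier, ← hw, h0]
    rw [Complex.zero_cpow (by norm_num), norm_zero, Real.zero_rpow (by norm_num)]
    simp
  have hexp : w ^ (1 / 4 : ℂ) * Complex.exp ((Real.pi / 8 : ℝ) * Complex.I) =
      Complex.exp (((Real.log ‖w‖ * (1 / 4) : ℝ) : ℂ) +
        ((w.arg / 4 + Real.pi / 8 : ℝ) : ℂ) * Complex.I) := by
    rw [Complex.cpow_def_of_ne_zero h0, ← Complex.exp_add, Complex.log]
    congr 1
    push_cast
    ring
  have hre : barrier x z = ‖w‖ ^ (1 / 4 : ℝ) * Real.cos (w.arg / 4 + Real.pi / 8) := by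
    rw [barrier, ← hw, hexp, Complex.exp_re, Real.rpow_def_of_pos (norm_pos_iff.2 h0)]
    simp
  rw [hre, mul_comm]
  refine mul_le_mul_of_nonneg_left ?_ (Real.rpow_nonneg (norm_nonneg _) _)
  have h1 := Complex.arg_nonneg_iff.2 hwu
  have h2 := Complex.arg_le_pi w
  exact Real.cos_le_cos_of_nonneg_of_le_pi (by have := Real.pi_pos; positivity)
    (by linarith [Real.pi_pos]) (by linarith)

lemma cos_three_pi_div_eight_pos : 0 < Real.cos (3 * Real.pi / 8) :=
  Real.cos_pos_of_mem_Ioo ⟨by linarith [Real.pi_pos], by linarith [Real.pi_pos]⟩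

lemma barrier_nonneg (x : Fin (2 * g + 2) → ℝ) {z : ℂ} (hz : z ∈ closedUpper) :
    0 ≤ barrier x z :=
  (mul_nonneg cos_three_pi_div_eight_pos.le (Real.rpow_nonneg (norm_nonneg _) _)).trans
    (le_barrier x hz)

lemma exists_hasDerivWithinAt_barrier {s : ℝ} (hs : x 0 < s) : ∃ d : ℝ, d < 0 ∧
    HasDerivWithinAt (fun y : ℝ => barrier x ((s : ℂ) + (y : ℂ) * Complex.I)) d (Ici 0) 0 := by
  have hpos : 0 < s - x 0 := sub_pos.2 hs
  have hline : HasDerivAt (fun y : ℝ => (s : ℂ) + (y : ℂ) * Complex.I - (x 0 : ℂ)) Complex.I 0 := by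
    simpa using (((Complex.ofRealCLM.hasDerivAt (x := 0)).mul_const Complex.I).const_add
      (s : ℂ)).sub_const (x 0 : ℂ)
  have hsl : ((s - x 0 : ℝ) : ℂ) ∈ Complex.slitPlane := Complex.ofReal_mem_slitPlane.2 hpos
  have hcp : HasDerivAt (fun w : ℂ => w ^ (1 / 4 : ℂ))
      (((1 / 4 * (s - x 0) ^ (1 / 4 - 1 : ℝ) : ℝ)) : ℂ) ((s - x 0 : ℝ) : ℂ) := by
    refine ((hasDerivAt_id ((s - x 0 : ℝ) : ℂ)).cpow_const (c := (1 / 4 : ℂ)) hsl).congr_deriv ?_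
    rw [Complex.ofReal_mul, Complex.ofReal_cpow hpos.le]
    push_cast
    simp
  have hcp' : HasDerivAt (fun w : ℂ => w ^ (1 / 4 : ℂ))
      (((1 / 4 * (s - x 0) ^ (1 / 4 - 1 : ℝ) : ℝ)) : ℂ)
      ((s : ℂ) + ((0 : ℝ) : ℂ) * Complex.I - (x 0 : ℂ)) := by
    convert hcp using 1
    simp
  have h := (hcp'.comp (0 : ℝ) hline).mul_const (Complex.exp ((Real.pi / 8 : ℝ) * Complex.I))
  have h2 := (Complex.reCLM.hasFDerivAt.comp_hasDerivAt (0 : ℝ) h).hasDerivWithinAt (s := Ici 0)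
  refine ⟨_, ?_, h2⟩
  have hsin : 0 < Real.sin (Real.pi / 8) :=
    Real.sin_pos_of_pos_of_lt_pi (by linarith [Real.pi_pos]) (by linarith [Real.pi_pos])
  have hr : 0 < (s - x 0) ^ (1 / 4 - 1 : ℝ) := Real.rpow_pos_of_pos hpos _
  rw [Complex.reCLM_apply, mul_assoc, Complex.re_ofReal_mul, Complex.I_mul_re,
    Complex.exp_ofReal_mul_I_im]
  have := mul_pos (mul_pos (show (0 : ℝ) < 1 / 4 by norm_num) hr) hsin
  linarith

/-- The marked points cut the real line into wired and free parts. -/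
lemma wired_or_free (hx : StrictMono x) (s : ℝ) :
    (s ≤ x 0 ∨ x (Fin.last (2 * g + 1)) ≤ s) ∨
    (∃ j : Fin g, s ∈ Icc (x (slitL j)) (x (slitR j))) ∨
    ∃ j : Fin (g + 1), s ∈ Ioo (x (freeL j)) (x (freeR j)) := by
  by_cases h0 : s ≤ x 0
  · exact Or.inl (Or.inl h0)
  by_cases h1 : x (Fin.last (2 * g + 1)) ≤ s
  · exact Or.inl (Or.inr h1)
  push Not at h0 h1
  right
  obtain ⟨k, hk, hmax⟩ := Finset.exists_maximal
    (s := Finset.univ.filter fun k => x k ≤ s) ⟨0, by simpa using h0.le⟩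
  simp only [Finset.mem_filter, Finset.mem_univ, true_and] at hk hmax
  have hkl : (k : ℕ) < 2 * g + 1 := by
    have : k ≠ Fin.last (2 * g + 1) := by rintro rfl; linarith
    have := Fin.val_lt_last this
    simpa using this
  have hnext : s < x ⟨k + 1, by omega⟩ := by
    by_contra hcon
    have := hmax (not_lt.1 hcon) (Fin.le_def.2 (by simp))
    rw [Fin.le_def] at this
    simp at this
  rcases Nat.even_or_odd' (k : ℕ) with ⟨m, hm | hm⟩
  · have hkm : k = freeL ⟨m, by omega⟩ := Fin.ext hm
    have hkn : (⟨k + 1, by omega⟩ : Fin (2 * g + 2)) = freeR ⟨m, by omega⟩ :=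
      Fin.ext (by simp [freeR, hm])
    rcases eq_or_lt_of_le hk with hk' | hk'
    · left
      have hm0 : m ≠ 0 := by
        rintro rfl
        have : k = 0 := Fin.ext (by simpa using hm)
        rw [this] at hk'
        linarith
      have hkr : k = slitR ⟨m - 1, by omega⟩ := Fin.ext (by simp [slitR]; omega)
      refine ⟨⟨m - 1, by omega⟩, ?_, by rw [← hkr]; exact hk'.ge⟩
      rw [← hk']
      exact (hx (Fin.lt_def.2 (by simp only [slitL]; omega))).le
    · right
      exact ⟨⟨m, by omega⟩, by rw [← hkm]; exact hk', by rw [← hkn]; exact hnext⟩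
  · left
    have hkm : k = slitL ⟨m, by omega⟩ := Fin.ext hm
    have hkn : (⟨k + 1, by omega⟩ : Fin (2 * g + 2)) = slitR ⟨m, by omega⟩ :=
      Fin.ext (by simp [slitR, hm])
    exact ⟨⟨m, by omega⟩, by rw [← hkm]; exact hk, by rw [← hkn]; exact hnext.le⟩

/-- The maximum principle for the mixed problem: bounded solutions with zero boundary values on
the wired arcs are nonpositive. -/
lemma nonpos_of_mixed_boundary (hx : StrictMono x) {h : ℂ → ℝ}
    (harm : InnerProductSpace.HarmonicOnNhd h {z : ℂ | 0 < z.im})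
    {B : ℝ} (hB : ∀ z ∈ closedUpper, h z ≤ B) (hcont : ContinuousOn h closedUpper)
    (hslit : ∀ j : Fin g, ∀ s ∈ Icc (x (slitL j)) (x (slitR j)), h (s : ℂ) = 0)
    (houter : ∀ s : ℝ, s ≤ x 0 ∨ x (Fin.last (2 * g + 1)) ≤ s → h (s : ℂ) = 0)
    (hfree : ∀ j : Fin (g + 1), ∀ s ∈ Ioo (x (freeL j)) (x (freeR j)),
      HasDerivWithinAt (fun y : ℝ => h ((s : ℂ) + (y : ℂ) * Complex.I)) 0 (Ici 0) 0)
    {z : ℂ} (hz : z ∈ closedUpper) : h z ≤ 0 := by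
  have key : ∀ ε : ℝ, 0 < ε → h z - ε * barrier x z ≤ 0 := by
    intro ε hε
    by_contra! hpos
    set u : ℂ → ℝ := fun w => h w - ε * barrier x w with hu
    have hucont : ContinuousOn u closedUpper :=
      hcont.sub (continuousOn_const.mul (continuousOn_barrier x))
    -- far away the barrier dominates the bounded function
    obtain ⟨r, hr⟩ : ∃ r : ℝ, ∀ w ∈ closedUpper, r < ‖w - (x 0 : ℂ)‖ → u w ≤ 0 := by
      have hlim : Tendsto (fun t : ℝ => ε * (Real.cos (3 * Real.pi / 8) * t ^ (1 / 4 : ℝ))) atTop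
          atTop :=
        ((tendsto_rpow_atTop (by norm_num)).const_mul_atTop
          cos_three_pi_div_eight_pos).const_mul_atTop hε
      obtain ⟨r, hr⟩ := eventually_atTop.1 (hlim.eventually_ge_atTop B)
      refine ⟨r, fun w hw hrw => ?_⟩
      have h1 := hr _ hrw.le
      have h2 := mul_le_mul_of_nonneg_left (le_barrier x hw) hε.le
      have h3 := hB w hw
      simp only [hu]
      linarith
    have hclosed : IsClosed closedUpper := isClosed_le continuous_const Complex.continuous_im
    set S : Set ℂ := closedUpper ∩ Metric.closedBall (x 0 : ℂ) r with hS
    have hScomp : IsCompact S := (isCompact_closedBall _ _).inter_left hclosed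
    have hmemS : ∀ w ∈ closedUpper, 0 < u w → w ∈ S := by
      intro w hw hw'
      refine ⟨hw, mem_closedBall_iff_norm.2 (not_lt.1 fun hlt => ?_)⟩
      linarith [hr w hw hlt]
    obtain ⟨q, hqS, hq⟩ := hScomp.exists_isMaxOn ⟨z, hmemS z hz hpos⟩
      (hucont.mono inter_subset_left)
    have hM : 0 < u q := lt_of_lt_of_le hpos (hq (hmemS z hz hpos))
    have hglob : ∀ w ∈ closedUpper, u w ≤ u q := by
      intro w hw
      rcases le_or_gt (u w) 0 with h0 | h0
      · exact h0.trans hM.le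
      · exact hq (hmemS w hw h0)
    -- a lowest point among those where the maximum is attained is a boundary point: near an interior
    -- one the function is constant
    have hZcomp : IsCompact (S ∩ u ⁻¹' {u q}) :=
      hScomp.of_isClosed_subset
        ((hucont.mono inter_subset_left).preimage_isClosed_of_isClosed hScomp.isClosed
          isClosed_singleton) inter_subset_left
    obtain ⟨p, ⟨hpS, hpq⟩, hpmin⟩ := hZcomp.exists_isMinOn ⟨q, hqS, rfl⟩
      Complex.continuous_im.continuousOn
    have hpq' : u p = u q := hpq
    rcases lt_or_eq_of_le (mem_closedUpper.1 hpS.1) with him | him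
    · have hopen : IsOpen {w : ℂ | 0 < w.im} := isOpen_lt continuous_const Complex.continuous_im
      obtain ⟨ρ, hρ, hball⟩ := Metric.isOpen_iff.1 hopen p him
      have huharm : InnerProductSpace.HarmonicOnNhd u (Metric.ball p ρ) := by
        have := harm.sub ((harmonicOnNhd_barrier x).const_smul (c := ε))
        exact this.mono hball
      have hlocmax : IsLocalMax u p := by
        filter_upwards [hopen.mem_nhds him] with w hw
        rw [hpq']
        exact hglob w (le_of_lt hw)
      have hconst := eventually_eq_of_isLocalMax_of_harmonicOnNhd hρ huharm hlocmax
      have hdown : Tendsto (fun t : ℝ => p - (t : ℂ) * Complex.I) (𝓝[>] 0) (𝓝 p) := by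
        have : Continuous fun t : ℝ => p - (t : ℂ) * Complex.I := by fun_prop
        simpa using (this.tendsto 0).mono_left nhdsWithin_le_nhds
      obtain ⟨t, ⟨ht1, ht2⟩, ht3⟩ := ((hdown.eventually (hconst.and (hopen.mem_nhds him))).and
        self_mem_nhdsWithin).exists
      have hlow : p - (t : ℂ) * Complex.I ∈ S ∩ u ⁻¹' {u q} := by
        refine ⟨hmemS _ (le_of_lt ht2) ?_, ?_⟩
        · rw [ht1, hpq']; exact hM
        · rw [mem_preimage, mem_singleton_iff, ht1, hpq']
      have h1 := hpmin hlow
      have ht0 : (0 : ℝ) < t := ht3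
      simp at h1
      linarith
    · obtain ⟨s, rfl⟩ : ∃ s : ℝ, p = s := ⟨p.re, Complex.ext rfl (by simp [← him])⟩
      have hup : 0 < u (s : ℂ) := by rw [hpq']; exact hM
      have hwired : h (s : ℂ) = 0 → False := by
        intro h0
        have h1 := mul_nonneg hε.le (barrier_nonneg x (ofReal_mem_closedUpper s))
        simp only [hu, h0] at hup
        linarith
      rcases wired_or_free hx s with hs | ⟨j, hs⟩ | ⟨j, hs⟩
      · exact hwired (houter s hs)
      · exact hwired (hslit j s hs)
      · -- at a free point the inner normal derivative would be positive
        have hs0 : x 0 < s := lt_of_le_of_lt (hx.monotone (Fin.zero_le _)) hs.1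
        obtain ⟨d, hd, hbar⟩ := exists_hasDerivWithinAt_barrier (x := x) hs0
        have hder := (hfree j s hs).sub (hbar.const_mul ε)
        rw [hasDerivWithinAt_iff_tendsto_slope, Ici_sdiff_left] at hder
        have hle : 0 - ε * d ≤ 0 := by
          refine le_of_tendsto hder ?_
          filter_upwards [self_mem_nhdsWithin] with y hy
          have hy0 : (0 : ℝ) < y := hy
          have h1 := hglob ((s : ℂ) + (y : ℂ) * Complex.I) (by
            simpa [closedUpper] using hy0.le)
          rw [slope_def_field, sub_zero]
          refine div_nonpos_of_nonpos_of_nonneg ?_ hy0.le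
          rw [← hpq'] at h1
          simp only [hu] at h1
          simp only [Pi.sub_apply, Complex.ofReal_zero, zero_mul, add_zero]
          linarith
        nlinarith
  by_contra! hpos
  have hb := barrier_nonneg x hz
  -- this multiple of the barrier is at most `h z / 2`
  have := key (h z / (2 * (barrier x z + 1))) (by positivity)
  have h2 : h z / (2 * (barrier x z + 1)) * barrier x z ≤ h z / 2 := by
    rw [div_mul_eq_mul_div, div_le_div_iff₀ (by positivity) two_pos]
    nlinarith
  linarith

lemma IsReflectedHarmonicMeasure.le (hx : StrictMono x) {k : Fin g} {h₁ h₂ : ℂ → ℝ}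
    (H₁ : IsReflectedHarmonicMeasure x k h₁) (H₂ : IsReflectedHarmonicMeasure x k h₂)
    {z : ℂ} (hz : z ∈ closedUpper) : h₁ z ≤ h₂ z := by
  obtain ⟨B₁, hB₁⟩ := H₁.bounded
  obtain ⟨B₂, hB₂⟩ := H₂.bounded
  have := nonpos_of_mixed_boundary hx (h := fun z => h₁ z - h₂ z) (B := B₁ + B₂)
    (H₁.harmonic.sub H₂.harmonic)
    (fun w hw => by
      have h1 := (abs_le.1 (hB₁ w hw)).2
      have h2 := (abs_le.1 (hB₂ w hw)).1
      linarith)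
    (H₁.continuous.sub H₂.continuous)
    (fun j s hs => by simp only [H₁.slits j s hs, H₂.slits j s hs, sub_self])
    (fun s hs => by simp only [H₁.outer s hs, H₂.outer s hs, sub_self])
    (fun j s hs => by
      have := (H₁.free j s hs).sub (H₂.free j s hs)
      rw [sub_zero] at this
      exact this) hz
  linarith

/-! ### Existence of the reflected harmonic measures -/

/-- The matrix which expresses `Re (P⁻¹ Q)` through the harmonic measures of the slits: on the
slit `K_k` the first `k` entries of `Re (P⁻¹ Q)` are `1 / 2`, and the others vanish. -/
def slitMatrix (g : ℕ) : Matrix (Fin g) (Fin g) ℝ := Matrix.of fun i k => if i ≤ k then 1 / 2 else 0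

lemma blockTriangular_slitMatrix (g : ℕ) : (slitMatrix g).BlockTriangular id := by
  intro i k hik
  exact if_neg (not_le.2 hik)

lemma isUnit_det_slitMatrix (g : ℕ) : IsUnit (slitMatrix g).det := by
  rw [Matrix.det_of_isUpperTriangular (blockTriangular_slitMatrix g)]
  simp [slitMatrix]

/-- The vector of the reflected harmonic measures of the slits. -/
def slitMeasure (x : Fin (2 * g + 2) → ℝ) (z : ℂ) : Fin g → ℝ :=
  (slitMatrix g)⁻¹ *ᵥ ((imPeriod x)⁻¹ *ᵥ fun i => (Q x z i).im)

lemma slitMatrix_mulVec_slitMeasure (x : Fin (2 * g + 2) → ℝ) (z : ℂ) :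
    slitMatrix g *ᵥ slitMeasure x z = (imPeriod x)⁻¹ *ᵥ fun i => (Q x z i).im := by
  rw [slitMeasure, Matrix.mulVec_mulVec, Matrix.mul_nonsing_inv _ (isUnit_det_slitMatrix g),
    Matrix.one_mulVec]

lemma slitMeasure_of_im_Q_eq_zero {z : ℂ} (h : ∀ i, (Q x z i).im = 0) (k : Fin g) :
    slitMeasure x z k = 0 := by
  have : (fun i => (Q x z i).im) = 0 := funext h
  simp [slitMeasure, this]

lemma slitMeasure_slit (hx : StrictMono x) (j k : Fin g) {s : ℝ}
    (hs : s ∈ Icc (x (slitL j)) (x (slitR j))) :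
    slitMeasure x s k = if j = k then 1 else 0 := by
  have h1 : (fun i => (Q x (s : ℂ) i).im) =
      imPeriod x *ᵥ (slitMatrix g *ᵥ Pi.single j 1) := by
    ext i
    rw [im_Q_slit hx i j hs, im_Q_slitL hx, Matrix.mulVec_single_one]
    simp only [Matrix.mulVec, dotProduct, Matrix.col_apply, slitMatrix, Matrix.of_apply, mul_ite,
      mul_zero, mul_one_div]
    rw [← Finset.sum_filter]
    congr 1
    ext l; simp
  rw [slitMeasure, h1, Matrix.mulVec_mulVec _ (imPeriod x)⁻¹,
    Matrix.nonsing_inv_mul _ (isUnit_det_imPeriod hx), Matrix.one_mulVec, Matrix.mulVec_mulVec,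
    Matrix.nonsing_inv_mul _ (isUnit_det_slitMatrix g), Matrix.one_mulVec, Pi.single_apply]
  simp [eq_comm]

lemma slitMeasure_eq_sum (x : Fin (2 * g + 2) → ℝ) (z : ℂ) (k : Fin g) :
    slitMeasure x z k = ∑ i, ((slitMatrix g)⁻¹ * (imPeriod x)⁻¹) k i * (Q x z i).im := by
  rw [slitMeasure, Matrix.mulVec_mulVec]; rfl

lemma isReflectedHarmonicMeasure_slitMeasure (hx : StrictMono x) (k : Fin g) :
    IsReflectedHarmonicMeasure x k fun z => slitMeasure x z k := by
  set b : Fin g → ℝ := fun i => ((slitMatrix g)⁻¹ * (imPeriod x)⁻¹) k i with hb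
  have heq : (fun z => slitMeasure x z k) = fun z => ∑ i, b i * (Q x z i).im :=
    funext fun z => slitMeasure_eq_sum x z k
  refine ⟨?_, ?_, ?_, fun j s hs => slitMeasure_slit hx j k hs, ?_, ?_⟩
  · have him : (fun z => slitMeasure x z k) = fun z => (∑ i, (b i : ℂ) * Q x z i).im := by
      rw [heq]; ext z; simp [Complex.im_sum]
    rw [him]
    intro z hz
    have hd : DifferentiableOn ℂ (fun z => ∑ i, (b i : ℂ) * Q x z i) {z : ℂ | 0 < z.im} :=
      DifferentiableOn.fun_sum fun i _ w hw =>
        ((hasDerivAt_Q hx i hw).differentiableAt.const_mul _).differentiableWithinAt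
    exact (hd.analyticAt
      ((isOpen_lt continuous_const Complex.continuous_im).mem_nhds hz)).harmonicAt_im
  · choose B hB using fun i => exists_norm_Q_le hx i
    refine ⟨∑ i, |b i| * B i, fun z hz => ?_⟩
    rw [slitMeasure_eq_sum]
    refine (Finset.abs_sum_le_sum_abs _ _).trans (Finset.sum_le_sum fun i _ => ?_)
    rw [abs_mul]
    exact mul_le_mul_of_nonneg_left ((Complex.abs_im_le_norm _).trans (hB i z hz)) (abs_nonneg _)
  · rw [heq]
    exact continuousOn_finsetSum _ fun i _ =>
      continuousOn_const.mul (Complex.continuous_im.comp_continuousOn (continuousOn_Q hx i))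
  · rintro s (hs | hs)
    · exact slitMeasure_of_im_Q_eq_zero (fun i => im_Q_left hx i hs) k
    · exact slitMeasure_of_im_Q_eq_zero (fun i => im_Q_right hx i hs) k
  · intro j s hs
    have hj := j.2
    have hne : ∀ l, s ≠ x l := by
      rintro l rfl
      have a1 := hx.lt_iff_lt.1 hs.1
      have a2 := hx.lt_iff_lt.1 hs.2
      rw [Fin.lt_def] at a1 a2
      simp only [freeL, freeR] at a1 a2
      omega
    have hcount := lt_iff_of_mem hx (a := 2 * (j : ℕ)) (by omega) hne hs.1.le hs.2.le
    have hQ : ∀ i, HasDerivWithinAt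
        (fun y : ℝ => b i * (Q x ((s : ℂ) + (y : ℂ) * Complex.I) i).im) 0 (Ici 0) 0 := by
      intro i
      have h1 := (Complex.imCLM.hasFDerivAt.comp_hasDerivWithinAt (0 : ℝ)
        (hasDerivWithinAt_Q_vertical hx i hne)).const_mul (b i)
      refine h1.congr_deriv ?_
      -- the density is imaginary on the free arcs
      rw [omega'_free i j hcount, mul_assoc, Complex.I_mul_I, Complex.imCLM_apply,
        Complex.im_ofReal_mul]
      simp
    have hsum := HasDerivWithinAt.fun_sum (u := Finset.univ) fun i _ => hQ i
    simp only [Finset.sum_const_zero] at hsum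
    refine hsum.congr_of_eventuallyEq (Eventually.of_forall fun y => ?_) ?_
    · exact slitMeasure_eq_sum x _ k
    · exact slitMeasure_eq_sum x _ k

end USTDrift

end

open USTDrift in
theorem mainTheorem6 (g : ℕ) (hg : 1 ≤ g)
    -- the circles representing the cycles `C_1, ..., C_{n-1}` of each configuration
    (c R : (Fin (2 * g + 2) → ℝ) → Fin g → ℝ)
    (hC : ∀ x : Fin (2 * g + 2) → ℝ, StrictMono x →
      ∀ j : Fin g, USTDrift.Encircles x j (c x j) (R x j)) :
    -- the period matrix `P` is invertible and `ψ`, `P`, `P⁻¹` are differentiable in `x_1`, with the matrix identity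
    (∀ x : Fin (2 * g + 2) → ℝ, StrictMono x →
      IsUnit (USTDrift.periodMatrix c R x).det ∧ USTDrift.psi c R x ≠ 0 ∧ USTDrift.DiffX1 (USTDrift.psi c R) x ∧
      (∀ i j, USTDrift.DiffX1 (fun y => USTDrift.periodMatrix c R y i j) x ∧
        USTDrift.DiffX1 (fun y => (USTDrift.periodMatrix c R y)⁻¹ i j) x) ∧
      (8 * Matrix.trace ((USTDrift.periodMatrix c R x)⁻¹ * USTDrift.dX1Matrix (USTDrift.periodMatrix c R) x)) •
            USTDrift.e g 1
          + (8 : ℂ) • ((USTDrift.periodMatrix c R x * USTDrift.dX1Matrix (fun y => (USTDrift.periodMatrix c R y)⁻¹) x) *ᵥ USTDrift.e g 1)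
        = (4 : ℂ) • USTDrift.e g 2) ∧
    -- the drift relation for the expansion coefficients of `P⁻¹ Q`
    (∃ a b : (Fin (2 * g + 2) → ℝ) → Fin g → ℂ, ∀ x : Fin (2 * g + 2) → ℝ, StrictMono x →
      USTDrift.HasHalfIntegerExpansion (fun z : ℝ => (USTDrift.periodMatrix c R x)⁻¹ *ᵥ USTDrift.Q x (z : ℂ))
        (x 0) (a x) (b x) ∧
      USTDrift.DiffX1 a x ∧
      (4 * (USTDrift.dX1 (USTDrift.psi c R) x / USTDrift.psi c R x)) • a x + (4 : ℂ) • USTDrift.dX1 a x = (6 : ℂ) • b x) ∧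
    -- the reflected harmonic measures of the slits exist and are unique, and
    (∃ H : (Fin (2 * g + 2) → ℝ) → ℂ → Fin g → ℝ,
      (∀ x : Fin (2 * g + 2) → ℝ, StrictMono x → ∀ k : Fin g,
        USTDrift.IsReflectedHarmonicMeasure x k (fun z => H x z k) ∧
        ∀ h : ℂ → ℝ, USTDrift.IsReflectedHarmonicMeasure x k h →
          Set.EqOn h (fun z => H x z k) USTDrift.closedUpper) ∧
      -- `Re (P⁻¹ Q)` is their image by a fixed triangular invertible matrix, and
      (∃ T : Matrix (Fin g) (Fin g) ℝ, T.BlockTriangular id ∧ IsUnit T.det ∧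
        ∀ x : Fin (2 * g + 2) → ℝ, StrictMono x → ∀ z ∈ USTDrift.closedUpper,
          (fun i => (((USTDrift.periodMatrix c R x)⁻¹ *ᵥ USTDrift.Q x z) i).re) = T *ᵥ H x z) ∧
      -- the drift relation holds for the expansion coefficients of their vector
      (∃ a b : (Fin (2 * g + 2) → ℝ) → Fin g → ℝ, ∀ x : Fin (2 * g + 2) → ℝ, StrictMono x →
        USTDrift.HasHalfIntegerExpansion (fun z : ℝ => H x (z : ℂ)) (x 0) (a x) (b x) ∧
        USTDrift.DiffX1 a x ∧
        ∀ k : Fin g, 4 * (USTDrift.dX1 (USTDrift.psi c R) x / USTDrift.psi c R x) * ((a x k : ℝ) : ℂ)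
            + 4 * ((USTDrift.dX1 a x k : ℝ) : ℂ) = 6 * ((b x k : ℝ) : ℂ))) := by
  have hrows : ∀ x : Fin (2 * g + 2) → ℝ, StrictMono x → ∃ A', HasDerivX1Rows x A' := by
    intro x hx
    obtain ⟨A', h1, h2⟩ := exists_hasDerivAt_imPeriod hx (hC x hx)
    exact ⟨A', h1, h2⟩
  refine ⟨fun x hx => ?_, ?_, ?_⟩
  · obtain ⟨A', h⟩ := hrows x hx
    refine ⟨?_, psi_ne_zero hC hx, (hasDerivAt_psi hC hx h).differentiableAt, fun i j =>
      ⟨(hasDerivAt_periodMatrix hC hx h i j).differentiableAt,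
        (hasDerivAt_periodMatrix_inv hC hx h i j).differentiableAt⟩, period_identity hC hx h⟩
    rw [det_periodMatrix hC hx, isUnit_iff_ne_zero]
    exact mul_ne_zero (pow_ne_zero _ Complex.I_ne_zero)
      (Complex.ofReal_ne_zero.2 (det_imPeriod_ne_zero hx))
  · refine ⟨fun x => ofRealVec g (coeffA x), fun x => ofRealVec g (coeffB x), fun x hx => ?_⟩
    obtain ⟨A', h⟩ := hrows x hx
    have hder : HasDerivAt (fun s => ofRealVec g (coeffA (Function.update x 0 s)))
        (ofRealVec g (coeffADeriv x A')) (x 0) :=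
      (ofRealVec g).hasFDerivAt.comp_hasDerivAt (x 0) (hasDerivAt_coeffA hx h)
    refine ⟨hasHalfIntegerExpansion_inv_mulVec_Q hC hx, hder.differentiableAt, ?_⟩
    rw [dX1_psi_div_psi hC hx h, dX1, hder.deriv]
    ext k
    have hk := congrArg (fun r : ℝ => (r : ℂ)) (congrFun (drift_relation hx h) k)
    simp only [Pi.add_apply, Pi.smul_apply, smul_eq_mul, ofRealVec_apply] at hk ⊢
    push_cast at hk
    exact hk
  · refine ⟨slitMeasure, fun x hx k => ⟨isReflectedHarmonicMeasure_slitMeasure hx k,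
      fun h hh z hz => ?_⟩, ⟨slitMatrix g, blockTriangular_slitMatrix g, isUnit_det_slitMatrix g,
      fun x hx z _ => ?_⟩, fun x => (slitMatrix g)⁻¹ *ᵥ coeffA x,
      fun x => (slitMatrix g)⁻¹ *ᵥ coeffB x, fun x hx => ?_⟩
    · have hm := isReflectedHarmonicMeasure_slitMeasure hx k
      exact le_antisymm (hh.le hx hm hz) (hm.le hx hh hz)
    · rw [slitMatrix_mulVec_slitMeasure]
      exact funext fun i => periodMatrix_inv_mulVec_re hC hx z i
    · obtain ⟨A', h⟩ := hrows x hx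
      set L := (slitMatrix g)⁻¹.mulVecLin.toContinuousLinearMap with hL
      have hder : HasDerivAt (fun s => (slitMatrix g)⁻¹ *ᵥ coeffA (Function.update x 0 s))
          ((slitMatrix g)⁻¹ *ᵥ coeffADeriv x A') (x 0) :=
        L.hasFDerivAt.comp_hasDerivAt (x 0) (hasDerivAt_coeffA hx h)
      refine ⟨(hasHalfIntegerExpansion_inv_mulVec_im_Q hx).clm L, hder.differentiableAt,
        fun k => ?_⟩
      rw [dX1_psi_div_psi hC hx h, dX1, hder.deriv]
      have hvec := congrArg (fun v => (slitMatrix g)⁻¹ *ᵥ v) (drift_relation hx h)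
      simp only [Matrix.mulVec_add, Matrix.mulVec_smul] at hvec
      have hk := congrArg (fun r : ℝ => (r : ℂ)) (congrFun hvec k)
      simp only [Pi.add_apply, Pi.smul_apply, smul_eq_mul] at hk
      push_cast at hk
      exact hk
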